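/- **Setting.** Let $\Gamma=(K,L,\Omega,I,J,\rho,g)$ be a stochastic game with incomplete information on both sides: $K,L,\Omega,I,J$ are finite nonempty sets (types of Players 1 and 2, states, actions of Players 1 and 2), $\rho:\Omega\times I\times J\to\Delta(\Omega)$ and $g:K\times L\times\Omega\times I\times J\to\mathbb R$. A state $\omega$ is *absorbing* if for all $(k,\ell)$ the map $(i,j)\mapsto g(k,\ell,\omega,i,j)$ is constant and $\rho(\omega\mid\omega,i,j)=1$ for all $(i,j)$. $\Gamma$ is an *absorbing game* if exactly one state is non-absorbing. Let $X=\Delta(I)^K$, $Y=\Delta(J)^L$. For $p\in\Delta(K)$ and $x\in X$ put $\bar x^p(i)=\sum_k p(k)x(i|k)$, and let $p^x(\cdot|i)\in\Delta(K)$ be given by $p^x(k|i)=x(i|k)p(k)/\bar x^p(i)$ if $\bar x^p(i)\ne0$, and $p^x(\cdot|i)=p$ otherwise; define $\bar y^q(j)$ and $q^y(\cdot|j)$ similarly for $q\in\Delta(L)$, $y\in Y$. The *belief game* $\Gamma^e$ is the stochastic game with state space $\Omega^e=\Delta(K)\times\Delta(L)\times\Omega$, action sets $X$ and $Y$, stage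 payoff $$g^e(p,q,\omega,x,y)=\sum_{k,\ell,i,j}p(k)q(\ell)x(i|k)y(j|\ell)g(k,\ell,\omega,i,j),$$ and transition: from $(p,q,\omega)$ under $(x,y)$ the next state is $(p^x(\cdot|i),q^y(\cdot|j),\omega')$, where $(i,j,\omega')$ has probability $\rho(\omega'|\omega,i,j)\,\bar x^p(i)\,\bar y^q(j)$. States and actions $(x,y)$ are observed. Behavior strategies are measurable maps from histories in $\bigcup_{m\ge1}(\Omega^e\times X\times Y)^{m-1}\times\Omega^e$ to $\Delta(X)$ (for Player 1) or $\Delta(Y)$ (for Player 2). A pure stationary strategy of Player 1 is a measurable map $\sigma:\Omega^e\to X$. An initial state $\omega^e$ and strategies $\sigma,\tau$ induce a law $\mathbb P^e_{\omega^e,\sigma,\tau}$ on plays $(\omega^e_m,x_m,y_m)_{m\ge1}$, with $\omega^e_m=(p_m,q_m,\omega_m)$ and expectation $\mathbb E^e_{\omega^e,\sigma,\tau}$. For $\lambda\in(0,1]$, $\Gamma^e_\lambda(\omega^e)$ is the zero-sum game with payoff $\gamma^e_\lambda(\omega^e,\sigma,\tau)=\mathbb E^e_{\omega^e,\sigma,\tau}\big[\sum_{m\ge1}\lambda(1-\lambda)^{m-1}g^e(\omega^e_m,x_m,y_m)\big]$.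 For $\varepsilon>0$, the *$\varepsilon$-frontier* is $F_\varepsilon=\{p\in\Delta(K):\exists k,\ p(k)\le\varepsilon\}$. A stationary strategy $\sigma$ is *$\varepsilon$-ambiguous* if for all $(p,q,\omega)\in\Omega^e$, with $x=\sigma(p,q,\omega)$, one has $p^x(k|i)\ge\varepsilon\min_{k'\in K}p(k')$ for all $k\in K$, $i\in I$. **Proposition.** Let $\Gamma$ be an absorbing game with incomplete information on both sides, $\varepsilon\in(0,1/4]$ and $\lambda\in(0,1]$. For every $\omega^e\in\Omega^e$ the game $\Gamma^e_\lambda(\omega^e)$, played in behavior strategies, has a value $$v^e_\lambda(\omega^e)=\sup_\sigma\inf_\tau\gamma^e_\lambda(\omega^e,\sigma,\tau)=\inf_\tau\sup_\sigma\gamma^e_\lambda(\omega^e,\sigma,\tau),$$ and Player 1 has a pure stationary strategy $\sigma$ in $\Gamma^e_\lambda$ such that 1. $\sigma$ is $\varepsilon$-ambiguous; 2. $\sigma$ is $12\varepsilon\|g\|_\infty$-optimal: $\gamma^e_\lambda(\omega^e,\sigma,\tau)\ge v^e_\lambda(\omega^e)-12\varepsilon\|g\|_\infty$ for all $\omega^e\in\Omega^e$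 and all behavior strategies $\tau$ of Player 2; 3. for all $\omega^e\in\Omega^e$ and all behavior strategies $\tau$ of Player 2, $$\mathbb E^e_{\omega^e,\sigma,\tau}\Big(\sum_{m=1}^{T}\|p_{m+1}-p_m\|_1\Big)\le 3\sqrt{|K|}\,\varepsilon^{-5},$$ where $T=\max\{m\ge1:\ p_m\in\Delta(K)\setminus F_\varepsilon\}$ ($T=0$ if there is no such $m$, and $T=\infty$ if there are infinitely many). -/

import Mathlib

open MeasureTheory ProbabilityTheory

/-- A zero-sum stochastic game with incomplete information on both sides: `K` and `L` are the type
sets of Players 1 and 2, `Ω` is the state space, `I` and `J` are the action sets, `ρ` is the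
transition function and `g` the payoff function (all sets are finite). -/
structure IncompleteInfoGame (K L Ω I J : Type*) [Fintype Ω] where
  ρ : Ω → I → J → stdSimplex ℝ Ω
  g : K → L → Ω → I → J → ℝ

/-- `Δ(A)^T`: a mixed action, type by type; `x k i` is the probability `x(i|k)`. -/
abbrev MixedAction (T A : Type*) [Fintype A] := T → stdSimplex ℝ A

/-- `x̄^p(i) = ∑ k, p(k) x(i|k)`. -/
noncomputable def meanAction {T A : Type*} [Fintype T] [Fintype A]
    (p : stdSimplex ℝ T) (x : MixedAction T A) (i : A) : ℝ :=
  ∑ k, p k * x k i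

theorem meanAction_nonneg {T A : Type*} [Fintype T] [Fintype A]
    (p : stdSimplex ℝ T) (x : MixedAction T A) (i : A) : 0 ≤ meanAction p x i :=
  Finset.sum_nonneg fun k _ => mul_nonneg (p.2.1 k) ((x k).2.1 i)

theorem sum_meanAction {T A : Type*} [Fintype T] [Fintype A]
    (p : stdSimplex ℝ T) (x : MixedAction T A) : ∑ i, meanAction p x i = 1 := by
  unfold meanAction
  rw [Finset.sum_comm]
  simp [← Finset.mul_sum]

/-- The posterior belief `p^x(·|i)`; by convention it is `p` when `x̄^p(i) = 0`. -/
noncomputable def posteriorBelief {T A : Type*} [Fintype T] [Fintype A]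
    (p : stdSimplex ℝ T) (x : MixedAction T A) (i : A) : stdSimplex ℝ T :=
  if h : meanAction p x i = 0 then p
  else ⟨fun k => x k i * p k / meanAction p x i,
    fun k => div_nonneg (mul_nonneg ((x k).2.1 i) (p.2.1 k)) (meanAction_nonneg p x i), by
      rw [← Finset.sum_div, div_eq_one_iff_eq h]
      exact Finset.sum_congr rfl fun k _ => mul_comm _ _⟩

theorem measurable_stdSimplex_apply {T : Type*} [Fintype T] (k : T) :
    Measurable fun p : stdSimplex ℝ T => p k :=
  (measurable_pi_apply k).comp measurable_subtype_coe

theorem measurable_meanAction {T A : Type*} [Fintype T] [Fintype A] (i : A) :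
    Measurable fun z : stdSimplex ℝ T × MixedAction T A => meanAction z.1 z.2 i := by
  unfold meanAction
  refine Finset.measurable_sum _ fun k _ => Measurable.mul ?_ ?_
  · exact (measurable_stdSimplex_apply k).comp measurable_fst
  · exact (measurable_stdSimplex_apply i).comp ((measurable_pi_apply k).comp measurable_snd)

theorem posteriorBelief_apply {T A : Type*} [Fintype T] [Fintype A]
    (p : stdSimplex ℝ T) (x : MixedAction T A) (i : A) (k : T) :
    posteriorBelief p x i k =
      if meanAction p x i = 0 then p k else x k i * p k / meanAction p x i := by
  unfold posteriorBelief
  split_ifs <;> rfl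

theorem measurable_posteriorBelief {T A : Type*} [Fintype T] [Fintype A] (i : A) :
    Measurable fun z : stdSimplex ℝ T × MixedAction T A => posteriorBelief z.1 z.2 i := by
  refine Measurable.subtype_mk (f := fun z : stdSimplex ℝ T × MixedAction T A =>
    (posteriorBelief z.1 z.2 i).1) (measurable_pi_lambda _ fun k => ?_)
  have e : (fun z : stdSimplex ℝ T × MixedAction T A => (posteriorBelief z.1 z.2 i).1 k) =
      fun z => if meanAction z.1 z.2 i = 0 then z.1 k
        else z.2 k i * z.1 k / meanAction z.1 z.2 i := by
    funext z
    exact posteriorBelief_apply z.1 z.2 i k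
  rw [e]
  have hp : Measurable fun z : stdSimplex ℝ T × MixedAction T A => z.1 k :=
    (measurable_stdSimplex_apply k).comp measurable_fst
  refine Measurable.ite (measurable_meanAction i (measurableSet_singleton 0)) hp ?_
  exact (((measurable_stdSimplex_apply i).comp
    ((measurable_pi_apply k).comp measurable_snd)).mul hp).div (measurable_meanAction i)

/-- The state space `Ω^e = Δ(K) × Δ(L) × Ω` of the belief game `Γ^e`. -/
abbrev BeliefState (K L Ω : Type*) [Fintype K] [Fintype L] :=
  stdSimplex ℝ K × stdSimplex ℝ L × Ω

/-- What is recorded at one stage of the belief game: the current state and the two mixed actions,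
an element of `Ω^e × X × Y`. -/
abbrev Stage (K L Ω I J : Type*) [Fintype K] [Fintype L] [Fintype I] [Fintype J] :=
  BeliefState K L Ω × MixedAction K I × MixedAction L J

/-- A behavior strategy of a player whose set of (mixed) actions is `A`, in the game `Γ^e`: after
`n` completed stages, given the history in `(Ω^e × X × Y)^n × Ω^e`, a law on `A` that depends
measurably on the history. -/
structure BehaviorStrategy (K L Ω I J A : Type*) [Fintype K] [Fintype L] [Fintype I] [Fintype J]
    [MeasurableSpace Ω] [MeasurableSpace A] where
  toKernel : (n : ℕ) → Kernel ((Fin n → Stage K L Ω I J) × BeliefState K L Ω) A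
  isMarkov : ∀ n, IsMarkovKernel (toKernel n)

/-- A pure stationary strategy of Player 1: a measurable map from states to mixed actions. -/
structure StationaryStrategy (K L Ω I : Type*) [Fintype K] [Fintype L] [Fintype I]
    [MeasurableSpace Ω] where
  toFun : BeliefState K L Ω → MixedAction K I
  measurable : Measurable toFun

/-- A pure stationary strategy, as a behavior strategy. -/
noncomputable def StationaryStrategy.toBehavior {K L Ω I J : Type*} [Fintype K] [Fintype L]
    [Fintype I] [Fintype J] [MeasurableSpace Ω] (σ : StationaryStrategy K L Ω I) :
    BehaviorStrategy K L Ω I J (MixedAction K I) where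
  toKernel _ := Kernel.deterministic (fun h => σ.toFun h.2) (σ.measurable.comp measurable_snd)
  isMarkov _ := inferInstance

/-- The action `x` is `ε`-ambiguous at the belief `p`. -/
def IsAmbiguousAt {K I : Type*} [Fintype K] [Fintype I] (ε : ℝ) (x : MixedAction K I)
    (p : stdSimplex ℝ K) : Prop :=
  ∀ k i, ε * (⨅ k', p k') ≤ posteriorBelief p x i k

/-- A stationary strategy is `ε`-ambiguous if at each state it plays an action which is
`ε`-ambiguous at the current belief. -/
def StationaryStrategy.IsAmbiguous {K L Ω I : Type*} [Fintype K] [Fintype L] [Fintype I]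
    [MeasurableSpace Ω] (ε : ℝ) (σ : StationaryStrategy K L Ω I) : Prop :=
  ∀ w : BeliefState K L Ω, IsAmbiguousAt ε (σ.toFun w) w.1

/-- The `ε`-frontier of `Δ(K)`. -/
def frontierSet (K : Type*) [Fintype K] (ε : ℝ) : Set (stdSimplex ℝ K) :=
  {p | ∃ k, p k ≤ ε}

/-- The belief on Player 1's type at the stage of index `m`, i.e. at stage `m + 1`. -/
def beliefAt {K L Ω I J : Type*} [Fintype K] [Fintype L] [Fintype I] [Fintype J]
    (h : ℕ → Stage K L Ω I J) (m : ℕ) : stdSimplex ℝ K :=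
  (h m).1.1

/-- The last stage `T` (stages are numbered from `1`) at which the belief on Player 1's type is
outside the `ε`-frontier; `0` if there is no such stage, `⊤` if there are infinitely many. -/
noncomputable def lastStage {K L Ω I J : Type*} [Fintype K] [Fintype L] [Fintype I] [Fintype J]
    (ε : ℝ) (h : ℕ → Stage K L Ω I J) : ℕ∞ :=
  sSup {t : ℕ∞ | ∃ m : ℕ, t = ((m + 1 : ℕ) : ℕ∞) ∧ beliefAt h m ∉ frontierSet K ε}

open Classical in
/-- `∑_{m=1}^T ‖p_{m+1} - p_m‖₁`, where stage `m` of the sum has index `m - 1`. -/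
noncomputable def beliefVariation {K L Ω I J : Type*} [Fintype K] [Fintype L] [Fintype I]
    [Fintype J] (ε : ℝ) (h : ℕ → Stage K L Ω I J) : ENNReal :=
  ∑' m : ℕ, if ((m + 1 : ℕ) : ℕ∞) ≤ lastStage ε h then
    ENNReal.ofReal (∑ k, |beliefAt h (m + 1) k - beliefAt h m k|) else 0

namespace IncompleteInfoGame

/-- A state is absorbing if, once the types are fixed, the payoff there does not depend on the
actions, and it is never left. -/
def IsAbsorbingState {K L Ω I J : Type*} [Fintype Ω] (Γ : IncompleteInfoGame K L Ω I J)
    (w : Ω) : Prop :=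
  (∀ k l, ∃ c : ℝ, ∀ i j, Γ.g k l w i j = c) ∧ ∀ i j, Γ.ρ w i j w = 1

/-- Absorbing game: exactly one state is non-absorbing. -/
def IsAbsorbingGame {K L Ω I J : Type*} [Fintype Ω] (Γ : IncompleteInfoGame K L Ω I J) : Prop :=
  ∃! w₀ : Ω, ¬ Γ.IsAbsorbingState w₀

/-- The uniform norm `‖g‖_∞` of the payoff function. -/
noncomputable def payoffNorm {K L Ω I J : Type*} [Fintype Ω]
    (Γ : IncompleteInfoGame K L Ω I J) : ℝ :=
  ⨆ z : K × L × Ω × I × J, |Γ.g z.1 z.2.1 z.2.2.1 z.2.2.2.1 z.2.2.2.2|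

section

variable {K L Ω I J : Type*} [Fintype K] [Fintype L] [Fintype Ω] [Fintype I] [Fintype J]

/-- The payoff function `g^e` of the belief game. -/
noncomputable def payoff (Γ : IncompleteInfoGame K L Ω I J) (z : Stage K L Ω I J) : ℝ :=
  ∑ k, ∑ l, ∑ i, ∑ j,
    z.1.1 k * z.1.2.1 l * z.2.1 k i * z.2.2 l j * Γ.g k l z.1.2.2 i j

variable [MeasurableSpace Ω]

/-- The law `ρ^e(·|p,q,ω,x,y)` of the next state of the belief game: for each `(i, j, ω')`, the mass
`ρ(ω'|ω,i,j) x̄^p(i) ȳ^q(j)` is put on `(p^x(·|i), q^y(·|j), ω')`. -/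
noncomputable def transitionLaw (Γ : IncompleteInfoGame K L Ω I J) (z : Stage K L Ω I J) :
    Measure (BeliefState K L Ω) :=
  ∑ i, ∑ j, ∑ w', ENNReal.ofReal
      (Γ.ρ z.1.2.2 i j w' * meanAction z.1.1 z.2.1 i * meanAction z.1.2.1 z.2.2 j) •
    Measure.dirac (posteriorBelief z.1.1 z.2.1 i, posteriorBelief z.1.2.1 z.2.2 j, w')

variable [DiscreteMeasurableSpace Ω]

theorem measurable_transitionLaw (Γ : IncompleteInfoGame K L Ω I J) :
    Measurable Γ.transitionLaw := by
  refine Measure.measurable_of_measurable_coe _ fun s hs => ?_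
  simp only [transitionLaw, Measure.coe_finsetSum, Finset.sum_apply, Measure.smul_apply,
    smul_eq_mul]
  refine Finset.measurable_sum _ fun i _ => Finset.measurable_sum _ fun j _ =>
    Finset.measurable_sum _ fun w' _ => Measurable.mul ?_ ?_
  · refine ENNReal.measurable_ofReal.comp ((Measurable.mul ?_ ?_).mul ?_)
    · exact (Measurable.of_discrete (f := fun w => Γ.ρ w i j w')).comp
        (measurable_snd.comp (measurable_snd.comp measurable_fst))
    · exact (measurable_meanAction i).comp
        ((measurable_fst.comp measurable_fst).prodMk (measurable_fst.comp measurable_snd))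
    · exact (measurable_meanAction j).comp
        ((measurable_fst.comp (measurable_snd.comp measurable_fst)).prodMk
          (measurable_snd.comp measurable_snd))
  · refine (Measure.measurable_coe hs).comp (Measure.measurable_dirac.comp ?_)
    refine Measurable.prodMk ?_ (Measurable.prodMk ?_ measurable_const)
    · exact (measurable_posteriorBelief i).comp
        ((measurable_fst.comp measurable_fst).prodMk (measurable_fst.comp measurable_snd))
    · exact (measurable_posteriorBelief j).comp
        ((measurable_fst.comp (measurable_snd.comp measurable_fst)).prodMk
          (measurable_snd.comp measurable_snd))

/-- The transition function `ρ^e` of the belief game, as a Markov kernel. -/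
noncomputable def transition (Γ : IncompleteInfoGame K L Ω I J) :
    Kernel (Stage K L Ω I J) (BeliefState K L Ω) :=
  ⟨Γ.transitionLaw, Γ.measurable_transitionLaw⟩

instance (Γ : IncompleteInfoGame K L Ω I J) : IsMarkovKernel Γ.transition := by
  refine ⟨fun z => ⟨?_⟩⟩
  change Γ.transitionLaw z Set.univ = 1
  simp only [transitionLaw, Measure.coe_finsetSum, Finset.sum_apply, Measure.smul_apply,
    smul_eq_mul, measure_univ, mul_one]
  have h1 : ∀ i j w', 0 ≤
      Γ.ρ z.1.2.2 i j w' * meanAction z.1.1 z.2.1 i * meanAction z.1.2.1 z.2.2 j :=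
    fun i j w' => mul_nonneg (mul_nonneg ((Γ.ρ z.1.2.2 i j).2.1 w') (meanAction_nonneg _ _ _))
      (meanAction_nonneg _ _ _)
  simp_rw [← ENNReal.ofReal_sum_of_nonneg fun w' _ => h1 _ _ w']
  simp_rw [← ENNReal.ofReal_sum_of_nonneg fun j _ => Finset.sum_nonneg fun w' _ => h1 _ j w']
  rw [← ENNReal.ofReal_sum_of_nonneg fun i _ => Finset.sum_nonneg fun j _ =>
    Finset.sum_nonneg fun w' _ => h1 i j w']
  simp_rw [← Finset.sum_mul, stdSimplex.sum_eq_one, one_mul, ← Finset.mul_sum,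
    sum_meanAction, mul_one]
  simp [sum_meanAction]

/-- Given a history `(h, w)` of `n` completed stages and a current state, the law of the current
stage `(w, x, y)`: `x` and `y` are drawn independently according to the two strategies. -/
noncomputable def stageKernel
    (σ : BehaviorStrategy K L Ω I J (MixedAction K I))
    (τ : BehaviorStrategy K L Ω I J (MixedAction L J)) (n : ℕ) :
    Kernel ((Fin n → Stage K L Ω I J) × BeliefState K L Ω) (Stage K L Ω I J) :=
  Kernel.deterministic Prod.snd measurable_snd ×ₖ (σ.toKernel n ×ₖ τ.toKernel n)

instance (σ : BehaviorStrategy K L Ω I J (MixedAction K I))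
    (τ : BehaviorStrategy K L Ω I J (MixedAction L J)) (n : ℕ) :
    IsMarkovKernel (stageKernel σ τ n) := by
  have := σ.isMarkov n
  have := τ.isMarkov n
  unfold stageKernel
  infer_instance

/-- Given the stages of index `0, …, n`, the law of the stage of index `n + 1`: a new state is drawn
according to `ρ^e`, and then actions are drawn according to the two strategies. -/
noncomputable def nextStage (Γ : IncompleteInfoGame K L Ω I J)
    (σ : BehaviorStrategy K L Ω I J (MixedAction K I))
    (τ : BehaviorStrategy K L Ω I J (MixedAction L J)) (n : ℕ) :
    Kernel (Finset.Iic n → Stage K L Ω I J) (Stage K L Ω I J) :=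
  stageKernel σ τ (n + 1) ∘ₖ
    (Kernel.deterministic
        (fun (h : Finset.Iic n → Stage K L Ω I J) (m : Fin (n + 1)) =>
          h ⟨m, Finset.mem_Iic.2 (Nat.lt_succ_iff.1 m.2)⟩)
        (measurable_pi_lambda _ fun _ => measurable_pi_apply _) ×ₖ
      Γ.transition.comap (fun h => h ⟨n, Finset.mem_Iic.2 le_rfl⟩) (measurable_pi_apply _))

instance (Γ : IncompleteInfoGame K L Ω I J)
    (σ : BehaviorStrategy K L Ω I J (MixedAction K I))
    (τ : BehaviorStrategy K L Ω I J (MixedAction L J)) (n : ℕ) :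
    IsMarkovKernel (Γ.nextStage σ τ n) := by
  unfold nextStage
  infer_instance

/-- The law `P^e_{w,σ,τ}` of the infinite history of the belief game with initial state `w`. -/
noncomputable def law (Γ : IncompleteInfoGame K L Ω I J) (w : BeliefState K L Ω)
    (σ : BehaviorStrategy K L Ω I J (MixedAction K I))
    (τ : BehaviorStrategy K L Ω I J (MixedAction L J)) : Measure (ℕ → Stage K L Ω I J) :=
  Kernel.trajMeasure (X := fun _ => Stage K L Ω I J)
    (stageKernel σ τ 0 (Fin.elim0, w)) (Γ.nextStage σ τ)

/-- The `lam`-discounted payoff `γ^e_λ(w, σ, τ)`. -/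
noncomputable def discountedPayoff (Γ : IncompleteInfoGame K L Ω I J) (lam : ℝ)
    (w : BeliefState K L Ω)
    (σ : BehaviorStrategy K L Ω I J (MixedAction K I))
    (τ : BehaviorStrategy K L Ω I J (MixedAction L J)) : ℝ :=
  ∫ h, ∑' m : ℕ, lam * (1 - lam) ^ m * Γ.payoff (h m) ∂(Γ.law w σ τ)

/-- `v` is the value of the discounted game `Γ^e_λ(w)`: maxmin and minmax (over behavior strategies)
both equal `v`. -/
def IsDiscountedValue (Γ : IncompleteInfoGame K L Ω I J) (lam : ℝ) (w : BeliefState K L Ω)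
    (v : ℝ) : Prop :=
  (⨆ σ, ⨅ τ, Γ.discountedPayoff lam w σ τ) = v ∧ (⨅ τ, ⨆ σ, Γ.discountedPayoff lam w σ τ) = v

end

end IncompleteInfoGame

/-! An action `x` at belief `p` is encoded by the joint measure `a i k = x k i * p k`, and
continuation payoffs are extended to nonnegative vectors, homogeneously of degree one in each
variable. Bayes' rule then disappears: the probability of `(i, j)` times the continuation payoff at
the posteriors is just `F w (a i) (b j)`, and the one-shot game is played on compact convex sets of
matrices.

Value. If `F` is superadditive in the first variable and subadditive in the second (`IsSaddle`), the
one-shot payoff is concave-convex, so Sion's theorem gives a value, which is again a saddle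
function. The resulting operator contracts distances by `1 - lam`; its fixed point
(`exists_shapley_fixedPoint`) is the value of the discounted game, because nearly optimal actions
can be selected measurably and the one-stage inequality can be iterated along the play.

Strategy. Player 1 takes a nearly optimal action and blurs it (`blurAction`): actions that move the
belief by at most `ε` are redrawn among themselves independently of the type, and with probability
`ε` the action is redrawn independently of the type altogether. The law of the action is unchanged.
The second redrawing makes every posterior at least `ε` times the prior, which is ambiguity.

Loss. As long as the state stays put, revealing less cannot hurt Player 1: this is Jensen's
inequality for the concave `F v`. So blurring costs something only through the stage payoff and
through transitions that leave the current state. In an absorbing game the state is left at most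
once, and with `χ` the indicator of the non-absorbing state, the one-stage loss is at most `8 ε ‖g‖
(χ - (1 - lam) E χ')`. This telescopes to a total of `8 ε ‖g‖`; the remaining `4 ε ‖g‖` pays for
near optimality.

Variation. After blurring, an action outside the merged class moves the belief by at least `ε (1 -
ε)`. Since the expected move is zero, the merged class contributes no more than these big moves. A
big move is dominated by its square, and expected squares telescope into the increase of the squared
Euclidean norm, which is at most one. Hence the expected variation over the whole play is at most `2
|K| / (ε (1 - ε))`. If `ε |K| ≥ 1` the frontier is the whole simplex and there is nothing to sum;
otherwise elementary arithmetic yields the stated bound. -/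

section

/-! ### Joint measures of actions and types, and homogeneous saddle functions -/

/-- Matrices with nonnegative entries, indexed by actions and types, whose marginal on types is
`π`. -/
def splittings {T : Type*} (A : Type*) [Fintype A] (π : T → ℝ) : Set (A → T → ℝ) :=
  {a | (∀ i k, 0 ≤ a i k) ∧ ∀ k, ∑ i, a i k = π k}

/-- Superadditive and homogeneous functions of the first of two nonnegative vectors, with a bound
`M` on the growth. -/
structure IsHalfSaddle {K L : Type*} [Fintype K] [Fintype L] (M : ℝ)
    (F : (K → ℝ) → (L → ℝ) → ℝ) : Prop where
  abs_apply_le : ∀ π θ, 0 ≤ π → 0 ≤ θ → |F π θ| ≤ M * ((∑ k, π k) * ∑ l, θ l)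
  smul : ∀ (c : ℝ) π θ, 0 ≤ c → 0 ≤ π → 0 ≤ θ → F (c • π) θ = c * F π θ
  superadd : ∀ π π' θ, 0 ≤ π → 0 ≤ π' → 0 ≤ θ → F π θ + F π' θ ≤ F (π + π') θ
  add_le : ∀ π π' θ, 0 ≤ π → 0 ≤ π' → 0 ≤ θ →
    F (π + π') θ ≤ F π θ + M * ((∑ k, π' k) * ∑ l, θ l)

/-- Functions of two nonnegative vectors that are homogeneous, superadditive in the first variable
and subadditive in the second one. -/
structure IsSaddle {K L : Type*} [Fintype K] [Fintype L] (M : ℝ)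
    (F : (K → ℝ) → (L → ℝ) → ℝ) : Prop where
  left : IsHalfSaddle M F
  right : IsHalfSaddle M fun θ π => -F π θ

/-- `V` is the value of the zero-sum game `f` on `X × Y`, and both players have optimal actions. -/
def IsGameValue {X Y : Type*} (A : Set X) (B : Set Y) (f : X → Y → ℝ) (V : ℝ) : Prop :=
  (∃ a ∈ A, ∀ b ∈ B, V ≤ f a b) ∧ ∃ b ∈ B, ∀ a ∈ A, f a b ≤ V

/-- The stage payoff, in terms of the joint measures `a` and `b` on actions and types. -/
def stageForm {K L I J : Type*} [Fintype K] [Fintype L] [Fintype I] [Fintype J]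
    (g : K → L → I → J → ℝ) (a : I → K → ℝ) (b : J → L → ℝ) : ℝ :=
  ∑ i, ∑ j, ∑ k, ∑ l, g k l i j * a i k * b j l

/-- The expectation of the continuation payoff `F`, in terms of the joint measures `a` and `b` on
actions and types. -/
def continuationForm {K L Ω I J : Type*} [Fintype Ω] [Fintype I] [Fintype J]
    (ρ : I → J → Ω → ℝ) (F : Ω → (K → ℝ) → (L → ℝ) → ℝ) (a : I → K → ℝ) (b : J → L → ℝ) : ℝ :=
  ∑ i, ∑ j, ∑ w, ρ i j w * F w (a i) (b j)

/-- The payoff of the one-shot game with continuation payoff `F`, in terms of the joint measures `a`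
and `b` on actions and types. -/
def shapley {K L Ω I J : Type*} [Fintype K] [Fintype L] [Fintype Ω] [Fintype I]
    [Fintype J] (lam : ℝ) (ρ : I → J → Ω → ℝ) (g : K → L → I → J → ℝ)
    (F : Ω → (K → ℝ) → (L → ℝ) → ℝ) (a : I → K → ℝ) (b : J → L → ℝ) : ℝ :=
  lam * stageForm g a b + (1 - lam) * continuationForm ρ F a b

variable {K L Ω I J : Type*} [Fintype K] [Fintype L] [Fintype Ω] [Fintype I] [Fintype J]

/-- Exchanging the players and changing signs is a symmetry of the whole setting, so the arguments
below are written for Player 1 only and transferred by the `swap` lemmas. -/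
theorem IsSaddle.swap {M : ℝ} {F : (K → ℝ) → (L → ℝ) → ℝ} (h : IsSaddle M F) :
    IsSaddle M fun θ π => -F π θ :=
  ⟨h.right, by simpa using h.left⟩

theorem IsGameValue.swap {X Y : Type*} {A : Set X} {B : Set Y} {f : X → Y → ℝ} {V : ℝ}
    (h : IsGameValue A B f V) : IsGameValue B A (fun y x => -f x y) (-V) := by
  obtain ⟨⟨a, ha, h1⟩, b, hb, h2⟩ := h
  exact ⟨⟨b, hb, fun a' ha' => neg_le_neg (h2 a' ha')⟩, a, ha, fun b' hb' => neg_le_neg (h1 b' hb')⟩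

theorem IsGameValue.le_of_forall {X Y : Type*} {A : Set X} {B : Set Y} {f : X → Y → ℝ} {V c : ℝ}
    (h : IsGameValue A B f V) {a : X} (ha : a ∈ A) (hc : ∀ b ∈ B, c ≤ f a b) : c ≤ V := by
  obtain ⟨-, b, hb, h2⟩ := h
  exact (hc b hb).trans (h2 a ha)

theorem IsGameValue.ge_of_forall {X Y : Type*} {A : Set X} {B : Set Y} {f : X → Y → ℝ} {V c : ℝ}
    (h : IsGameValue A B f V) {b : Y} (hb : b ∈ B) (hc : ∀ a ∈ A, f a b ≤ c) : V ≤ c := by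
  obtain ⟨⟨a, ha, h1⟩, -⟩ := h
  exact (h1 b hb).trans (hc a ha)

/-- The sign and the order of the players in the one-shot game. -/
theorem shapley_swap (lam : ℝ) (ρ : I → J → Ω → ℝ) (g : K → L → I → J → ℝ)
    (F : Ω → (K → ℝ) → (L → ℝ) → ℝ) (a : I → K → ℝ) (b : J → L → ℝ) :
    shapley lam (fun j i => ρ i j) (fun l k j i => -g k l i j) (fun w θ π => -F w π θ) b a =
      -shapley lam ρ g F a b := by
  unfold shapley stageForm continuationForm
  rw [Finset.sum_comm, Finset.sum_comm (s := (Finset.univ : Finset J))]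
  have h (i j) : ∑ l, ∑ k, -g k l i j * b j l * a i k = -∑ k, ∑ l, g k l i j * a i k * b j l := by
    rw [Finset.sum_comm]
    simp only [← Finset.sum_neg_distrib]
    exact Finset.sum_congr rfl fun _ _ => Finset.sum_congr rfl fun _ _ => by ring
  simp only [h, mul_neg, Finset.sum_neg_distrib]
  ring

section splittings

variable {T A : Type*} [Fintype A] {π π' : T → ℝ} {a a' : A → T → ℝ}

theorem splittings_nonneg (ha : a ∈ splittings A π) (i : A) : 0 ≤ a i := fun k => ha.1 i k

theorem sum_splittings [Fintype T] (ha : a ∈ splittings A π) : ∑ i, ∑ k, a i k = ∑ k, π k := by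
  rw [Finset.sum_comm]
  exact Finset.sum_congr rfl fun k _ => ha.2 k

theorem add_mem_splittings (ha : a ∈ splittings A π) (ha' : a' ∈ splittings A π') :
    a + a' ∈ splittings A (π + π') :=
  ⟨fun i k => add_nonneg (ha.1 i k) (ha'.1 i k), fun k => by
    simp [Finset.sum_add_distrib, ha.2 k, ha'.2 k]⟩

theorem smul_mem_splittings {c : ℝ} (hc : 0 ≤ c) (ha : a ∈ splittings A π) :
    c • a ∈ splittings A (c • π) :=
  ⟨fun i k => mul_nonneg hc (ha.1 i k), fun k => by
    simp [← Finset.mul_sum, ha.2 k]⟩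

/-- Each column `k` is cut in the proportions `π k : π' k`. Where both vanish the column is zero, so
the convention `0 / 0 = 0` does no harm. -/
theorem exists_mem_splittings_add (hπ : 0 ≤ π) (hπ' : 0 ≤ π') (ha : a ∈ splittings A (π + π')) :
    ∃ b ∈ splittings A π, ∃ c ∈ splittings A π', a = b + c := by
  have h0 : ∀ k, π k + π' k = 0 → ∀ i, a i k = 0 := fun k hk i => by
    have h := ha.2 k
    rw [Pi.add_apply, hk] at h
    exact (Finset.sum_eq_zero_iff_of_nonneg fun i _ => ha.1 i k).1 h i (Finset.mem_univ i)
  refine ⟨fun i k => a i k * (π k / (π k + π' k)), ⟨fun i k => mul_nonneg (ha.1 i k)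
    (div_nonneg (hπ k) (add_nonneg (hπ k) (hπ' k))), fun k => ?_⟩,
    fun i k => a i k * (π' k / (π k + π' k)), ⟨fun i k => mul_nonneg (ha.1 i k)
    (div_nonneg (hπ' k) (add_nonneg (hπ k) (hπ' k))), fun k => ?_⟩, ?_⟩
  · rw [← Finset.sum_mul, ha.2 k, Pi.add_apply]
    by_cases hk : π k + π' k = 0
    · have := hπ k
      have := hπ' k
      simp only [Pi.zero_apply] at *
      rw [hk]; linarith
    · field_simp
  · rw [← Finset.sum_mul, ha.2 k, Pi.add_apply]
    by_cases hk : π k + π' k = 0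
    · have := hπ k
      have := hπ' k
      simp only [Pi.zero_apply] at *
      rw [hk]; linarith
    · field_simp
  · funext i k
    simp only [Pi.add_apply]
    by_cases hk : π k + π' k = 0
    · simp [h0 k hk i]
    · field_simp

theorem convex_splittings : Convex ℝ (splittings A π) := by
  intro a ha b hb s t hs ht hst
  have h := add_mem_splittings (smul_mem_splittings hs ha) (smul_mem_splittings ht hb)
  rwa [← add_smul, hst, one_smul] at h

theorem nonempty_splittings [Nonempty A] (hπ : 0 ≤ π) : (splittings A π).Nonempty := by
  refine ⟨fun i k => (Fintype.card A : ℝ)⁻¹ * π k, fun i k => mul_nonneg (by positivity) (hπ k),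
    fun k => ?_⟩
  simp

theorem isCompact_splittings : IsCompact (splittings A π) := by
  have hc : IsClosed (splittings A π) := by
    have : splittings A π = (⋂ i, ⋂ k, {a | 0 ≤ a i k}) ∩ ⋂ k, {a | ∑ i, a i k = π k} := by
      ext a
      simp [splittings]
    rw [this]
    refine IsClosed.inter (isClosed_iInter fun i => isClosed_iInter fun k => ?_)
      (isClosed_iInter fun k => ?_)
    · exact isClosed_le continuous_const (by fun_prop)
    · exact isClosed_eq (by fun_prop) continuous_const
  refine (isCompact_Icc (a := (0 : A → T → ℝ)) (b := fun _ k => π k)).of_isClosed_subset hc ?_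
  intro a ha
  refine ⟨fun i k => ha.1 i k, fun i k => ?_⟩
  change a i k ≤ π k
  rw [← ha.2 k]
  exact Finset.single_le_sum (f := fun i => a i k) (fun i _ => ha.1 i k) (Finset.mem_univ i)

end splittings

namespace IsHalfSaddle

variable {M : ℝ} {F : (K → ℝ) → (L → ℝ) → ℝ}

theorem le_add (h : IsHalfSaddle M F) {π π' : K → ℝ} {θ : L → ℝ} (hπ : 0 ≤ π) (hπ' : 0 ≤ π')
    (hθ : 0 ≤ θ) : F π θ - M * ((∑ k, π' k) * ∑ l, θ l) ≤ F (π + π') θ := by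
  have h1 := h.superadd π π' θ hπ hπ' hθ
  have h2 := (abs_le.1 (h.abs_apply_le π' θ hπ' hθ)).1
  linarith

/-- Both vectors dominate `π ⊓ π'`, and passing from it to either one only adds mass, which `add_le`
and `le_add` control. The two added masses sum to the `ℓ¹` distance. -/
theorem abs_sub_le (h : IsHalfSaddle M F) {π π' : K → ℝ} {θ : L → ℝ} (hπ : 0 ≤ π)
    (hπ' : 0 ≤ π') (hθ : 0 ≤ θ) :
    |F π θ - F π' θ| ≤ M * ((∑ k, |π k - π' k|) * ∑ l, θ l) := by
  have key : ∀ π : K → ℝ, 0 ≤ π → ∀ m : K → ℝ, 0 ≤ m → m ≤ π →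
      |F π θ - F m θ| ≤ M * ((∑ k, (π k - m k)) * ∑ l, θ l) := by
    intro π hπ m hm hle
    have e : π = m + (π - m) := by simp
    have h0 : 0 ≤ π - m := sub_nonneg.2 hle
    have h1 := h.add_le m (π - m) θ hm h0 hθ
    have h2 := h.le_add (π' := π - m) hm h0 hθ
    rw [← e] at h1 h2
    simp only [Pi.sub_apply] at h1 h2
    rw [abs_le]
    constructor <;> linarith
  have hm : 0 ≤ π ⊓ π' := le_inf hπ hπ'
  have h1 := key π hπ (π ⊓ π') hm inf_le_left
  have h2 := key π' hπ' (π ⊓ π') hm inf_le_right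
  have e : (∑ k, |π k - π' k|) = ∑ k, (π k - (π ⊓ π') k) + ∑ k, (π' k - (π ⊓ π') k) := by
    rw [← Finset.sum_add_distrib]
    refine Finset.sum_congr rfl fun k _ => ?_
    simp only [Pi.inf_apply]
    rcases le_total (π k) (π' k) with hk | hk
    · rw [inf_eq_left.2 hk, abs_of_nonpos (by linarith)]; ring
    · rw [inf_eq_right.2 hk, abs_of_nonneg (by linarith)]; ring
  rw [e, add_mul, mul_add]
  rw [abs_le] at h1 h2 ⊢
  constructor <;> linarith [h1.1, h1.2, h2.1, h2.2]

end IsHalfSaddle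

namespace IsSaddle

variable {M : ℝ} {F : (K → ℝ) → (L → ℝ) → ℝ}

theorem abs_sub_le (h : IsSaddle M F) {π π' : K → ℝ} {θ θ' : L → ℝ} (hπ : 0 ≤ π)
    (hπ' : 0 ≤ π') (hθ : 0 ≤ θ) (hθ' : 0 ≤ θ') :
    |F π θ - F π' θ'| ≤ M * ((∑ k, |π k - π' k|) * ∑ l, θ l) +
      M * ((∑ l, |θ l - θ' l|) * ∑ k, π' k) := by
  have h1 := h.left.abs_sub_le hπ hπ' hθ
  have h2 := h.right.abs_sub_le hθ hθ' hπ'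
  rw [neg_sub_neg, abs_sub_comm] at h2
  refine (_root_.abs_sub_le _ (F π' θ) _).trans (add_le_add h1 ?_)
  exact h2

theorem continuousOn (h : IsSaddle M F) :
    ContinuousOn (fun z : (K → ℝ) × (L → ℝ) => F z.1 z.2) (Set.Ici 0 ×ˢ Set.Ici 0) := by
  rintro ⟨π, θ⟩ ⟨hπ, hθ⟩
  rw [ContinuousWithinAt, tendsto_iff_dist_tendsto_zero]
  have hc : Continuous fun z : (K → ℝ) × (L → ℝ) =>
      M * ((∑ k, |z.1 k - π k|) * ∑ l, z.2 l) + M * ((∑ l, |z.2 l - θ l|) * ∑ k, π k) := by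
    fun_prop
  have h0 := (hc.tendsto (π, θ)).mono_left (nhdsWithin_le_nhds (s := Set.Ici 0 ×ˢ Set.Ici 0))
  simp only [sub_self, abs_zero, Finset.sum_const_zero, zero_mul, mul_zero, add_zero] at h0
  refine tendsto_of_tendsto_of_tendsto_of_le_of_le' tendsto_const_nhds h0
    (Filter.Eventually.of_forall fun _ => dist_nonneg) ?_
  filter_upwards [self_mem_nhdsWithin] with z hz
  exact h.abs_sub_le hz.1 hπ hz.2 hθ

end IsSaddle

end

/-! ### Estimates for the one-shot payoff -/

section

variable {K L Ω I J : Type*} [Fintype K] [Fintype L] [Fintype Ω] [Fintype I] [Fintype J]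

section forms

variable {M : ℝ} {g : K → L → I → J → ℝ} {ρ : I → J → Ω → ℝ}
  {F F' : Ω → (K → ℝ) → (L → ℝ) → ℝ} {a a' : I → K → ℝ} {b b' : J → L → ℝ}

theorem stageForm_add : stageForm g (a + a') b = stageForm g a b + stageForm g a' b := by
  simp only [stageForm, Pi.add_apply, ← Finset.sum_add_distrib]
  exact Finset.sum_congr rfl fun i _ => Finset.sum_congr rfl fun j _ =>
    Finset.sum_congr rfl fun k _ => Finset.sum_congr rfl fun l _ => by ring

theorem stageForm_smul (c : ℝ) : stageForm g (c • a) b = c * stageForm g a b := by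
  simp only [stageForm, Pi.smul_apply, smul_eq_mul, Finset.mul_sum]
  exact Finset.sum_congr rfl fun i _ => Finset.sum_congr rfl fun j _ =>
    Finset.sum_congr rfl fun k _ => Finset.sum_congr rfl fun l _ => by ring

theorem stageForm_sub : stageForm g (a - a') b = stageForm g a b - stageForm g a' b := by
  rw [sub_eq_add_neg, stageForm_add, ← neg_one_smul ℝ a', stageForm_smul]
  ring

theorem abs_stageForm_le (hg : ∀ k l i j, |g k l i j| ≤ M) (hb : 0 ≤ b) :
    |stageForm g a b| ≤ M * ((∑ i, ∑ k, |a i k|) * ∑ j, ∑ l, b j l) := by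
  have e : M * ((∑ i, ∑ k, |a i k|) * ∑ j, ∑ l, b j l) =
      ∑ i, ∑ j, ∑ k, ∑ l, M * |a i k| * b j l := by
    rw [Finset.sum_mul_sum, Finset.mul_sum]
    refine Finset.sum_congr rfl fun i _ => ?_
    rw [Finset.mul_sum]
    refine Finset.sum_congr rfl fun j _ => ?_
    rw [Finset.sum_mul_sum, Finset.mul_sum]
    refine Finset.sum_congr rfl fun k _ => ?_
    rw [Finset.mul_sum]
    exact Finset.sum_congr rfl fun l _ => by ring
  rw [e]
  unfold stageForm
  refine (Finset.abs_sum_le_sum_abs _ _).trans (Finset.sum_le_sum fun i _ => ?_)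
  refine (Finset.abs_sum_le_sum_abs _ _).trans (Finset.sum_le_sum fun j _ => ?_)
  refine (Finset.abs_sum_le_sum_abs _ _).trans (Finset.sum_le_sum fun k _ => ?_)
  refine (Finset.abs_sum_le_sum_abs _ _).trans (Finset.sum_le_sum fun l _ => ?_)
  rw [abs_mul, abs_mul, abs_of_nonneg (hb j l)]
  exact mul_le_mul_of_nonneg_right (mul_le_mul_of_nonneg_right (hg k l i j) (abs_nonneg _)) (hb j l)

omit [Fintype K] [Fintype L] in
theorem continuationForm_le (hρ : ∀ i j w, 0 ≤ ρ i j w) (hρ' : ∀ i j, ∑ w, ρ i j w = 1) {c : ℝ}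
    {s : I → ℝ} {t : J → ℝ}
    (h : ∀ i j w, F w (a i) (b j) ≤ F' w (a' i) (b' j) + c * (s i * t j)) :
    continuationForm ρ F a b ≤ continuationForm ρ F' a' b' + c * ((∑ i, s i) * ∑ j, t j) := by
  have e : c * ((∑ i, s i) * ∑ j, t j) = ∑ i, ∑ j, ∑ w, ρ i j w * (c * (s i * t j)) := by
    simp only [← Finset.sum_mul, hρ', one_mul]
    rw [Finset.sum_mul_sum, Finset.mul_sum]
    exact Finset.sum_congr rfl fun i _ => Finset.mul_sum _ _ _
  rw [e]
  unfold continuationForm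
  simp only [← Finset.sum_add_distrib, ← mul_add]
  exact Finset.sum_le_sum fun i _ => Finset.sum_le_sum fun j _ => Finset.sum_le_sum fun w _ =>
    mul_le_mul_of_nonneg_left (h i j w) (hρ i j w)

variable {lam : ℝ}

theorem shapley_add_le (hlam : 0 ≤ lam) (hlam' : lam ≤ 1) (hρ : ∀ i j w, 0 ≤ ρ i j w)
    (hρ' : ∀ i j, ∑ w, ρ i j w = 1) (hg : ∀ k l i j, |g k l i j| ≤ M)
    (hF : ∀ w, IsHalfSaddle M (F w)) (ha : 0 ≤ a) (ha' : 0 ≤ a') (hb : 0 ≤ b) :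
    shapley lam ρ g F (a + a') b ≤
      shapley lam ρ g F a b + M * ((∑ i, ∑ k, a' i k) * ∑ j, ∑ l, b j l) := by
  have h1 := (abs_le.1 (abs_stageForm_le (a := a') hg hb)).2
  have h2 := continuationForm_le (F := F) (F' := F) (a := a + a') (a' := a) (b := b) (b' := b)
    hρ hρ' (c := M) (s := fun i => ∑ k, a' i k)
    (t := fun j => ∑ l, b j l) fun i j w => (hF w).add_le _ _ _ (ha i) (ha' i) (hb j)
  simp only [abs_of_nonneg (ha' _ _)] at h1
  unfold shapley
  rw [stageForm_add]
  have h3 := mul_le_mul_of_nonneg_left h1 hlam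
  have h4 := mul_le_mul_of_nonneg_left h2 (sub_nonneg.2 hlam')
  linarith

theorem shapley_superadd (hlam' : lam ≤ 1) (hρ : ∀ i j w, 0 ≤ ρ i j w)
    (hF : ∀ w, IsHalfSaddle M (F w)) (ha : 0 ≤ a) (ha' : 0 ≤ a') (hb : 0 ≤ b) :
    shapley lam ρ g F a b + shapley lam ρ g F a' b ≤ shapley lam ρ g F (a + a') b := by
  have h : continuationForm ρ F a b + continuationForm ρ F a' b ≤
      continuationForm ρ F (a + a') b := by
    unfold continuationForm
    simp only [← Finset.sum_add_distrib, ← mul_add]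
    exact Finset.sum_le_sum fun i _ => Finset.sum_le_sum fun j _ => Finset.sum_le_sum fun w _ =>
      mul_le_mul_of_nonneg_left ((hF w).superadd _ _ _ (ha i) (ha' i) (hb j)) (hρ i j w)
  unfold shapley
  rw [stageForm_add]
  have h4 := mul_le_mul_of_nonneg_left h (sub_nonneg.2 hlam')
  linarith

theorem continuationForm_smul (hF : ∀ w, IsHalfSaddle M (F w)) {c : ℝ} (hc : 0 ≤ c) (ha : 0 ≤ a)
    (hb : 0 ≤ b) : continuationForm ρ F (c • a) b = c * continuationForm ρ F a b := by
  simp only [continuationForm, Finset.mul_sum]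
  refine Finset.sum_congr rfl fun i _ => Finset.sum_congr rfl fun j _ =>
    Finset.sum_congr rfl fun w _ => ?_
  rw [Pi.smul_apply, (hF w).smul c _ _ hc (ha i) (hb j)]
  ring

theorem shapley_smul (hF : ∀ w, IsHalfSaddle M (F w)) {c : ℝ} (hc : 0 ≤ c) (ha : 0 ≤ a)
    (hb : 0 ≤ b) : shapley lam ρ g F (c • a) b = c * shapley lam ρ g F a b := by
  unfold shapley
  rw [stageForm_smul, continuationForm_smul hF hc ha hb]
  ring

theorem abs_shapley_le (hlam : 0 ≤ lam) (hlam' : lam ≤ 1) (hρ : ∀ i j w, 0 ≤ ρ i j w)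
    (hρ' : ∀ i j, ∑ w, ρ i j w = 1) (hg : ∀ k l i j, |g k l i j| ≤ M)
    (hF : ∀ w, IsHalfSaddle M (F w)) (ha : 0 ≤ a) (hb : 0 ≤ b) :
    |shapley lam ρ g F a b| ≤ M * ((∑ i, ∑ k, a i k) * ∑ j, ∑ l, b j l) := by
  have h0 : shapley lam ρ g F (0 : I → K → ℝ) b = 0 := by
    have := shapley_smul (lam := lam) (ρ := ρ) (g := g) hF le_rfl ha hb
    simpa using this
  have h1 := shapley_add_le hlam hlam' hρ hρ' hg hF (le_refl (0 : I → K → ℝ)) ha hb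
  have hs := (abs_le.1 (abs_stageForm_le (a := a) hg hb)).1
  -- The lower bound compares with the zero continuation payoff; the upper bound `h1` adds `a` to
  -- the zero matrix, whose payoff vanishes by homogeneity.
  have h2 := continuationForm_le (F := fun _ _ _ => 0) (F' := F) (a := a) (a' := a) (b := b)
    (b' := b) hρ hρ' (c := M) (s := fun i => ∑ k, a i k)
    (t := fun j => ∑ l, b j l) fun i j w => by
      linarith [(abs_le.1 ((hF w).abs_apply_le _ _ (ha i) (hb j))).1]
  rw [h0, zero_add, zero_add] at h1
  refine abs_le.2 ⟨?_, h1⟩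
  simp only [abs_of_nonneg (ha _ _)] at hs
  simp only [continuationForm, mul_zero, Finset.sum_const_zero] at h2
  have h3 := mul_le_mul_of_nonneg_left hs hlam
  have h4 := mul_le_mul_of_nonneg_left h2 (sub_nonneg.2 hlam')
  unfold shapley continuationForm
  linarith

theorem shapley_sub_le (hlam : 0 ≤ lam) (hlam' : lam ≤ 1) (hρ : ∀ i j w, 0 ≤ ρ i j w)
    (hρ' : ∀ i j, ∑ w, ρ i j w = 1) (hg : ∀ k l i j, |g k l i j| ≤ M)
    (hF : ∀ w, IsHalfSaddle M (F w)) (ha : 0 ≤ a) (ha' : 0 ≤ a') (hb : 0 ≤ b) :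
    shapley lam ρ g F a b ≤ shapley lam ρ g F a' b +
      M * ((∑ i, ∑ k, |a i k - a' i k|) * ∑ j, ∑ l, b j l) := by
  have h1 := (abs_le.1 (abs_stageForm_le (a := a - a') hg hb)).2
  have h2 := continuationForm_le (F := F) (F' := F) (a := a) (a' := a') (b := b) (b' := b)
    hρ hρ' (c := M) (s := fun i => ∑ k, |a i k - a' i k|)
    (t := fun j => ∑ l, b j l) fun i j w => by
      linarith [(abs_le.1 ((hF w).abs_sub_le (ha i) (ha' i) (hb j))).2]
  rw [stageForm_sub] at h1
  simp only [Pi.sub_apply] at h1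
  unfold shapley
  have h3 := mul_le_mul_of_nonneg_left h1 hlam
  have h4 := mul_le_mul_of_nonneg_left h2 (sub_nonneg.2 hlam')
  linarith

theorem shapley_le_of_le (hlam' : lam ≤ 1) (hρ : ∀ i j w, 0 ≤ ρ i j w)
    (hρ' : ∀ i j, ∑ w, ρ i j w = 1) {c : ℝ}
    (h : ∀ w π θ, 0 ≤ π → 0 ≤ θ → F w π θ ≤ F' w π θ + c * ((∑ k, π k) * ∑ l, θ l))
    (ha : 0 ≤ a) (hb : 0 ≤ b) :
    shapley lam ρ g F a b ≤ shapley lam ρ g F' a b +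
      (1 - lam) * c * ((∑ i, ∑ k, a i k) * ∑ j, ∑ l, b j l) := by
  have h2 := continuationForm_le (F := F) (F' := F') (a := a) (a' := a) (b := b) (b' := b)
    hρ hρ' (c := c) (s := fun i => ∑ k, a i k)
    (t := fun j => ∑ l, b j l) fun i j w => h w _ _ (ha i) (hb j)
  unfold shapley
  have h4 := mul_le_mul_of_nonneg_left h2 (sub_nonneg.2 hlam')
  linarith

theorem continuousOn_shapley (hF : ∀ w, IsSaddle M (F w)) :
    ContinuousOn (fun z : (I → K → ℝ) × (J → L → ℝ) => shapley lam ρ g F z.1 z.2)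
      (Set.Ici 0 ×ˢ Set.Ici 0) := by
  unfold shapley stageForm continuationForm
  refine ContinuousOn.add ?_ (continuousOn_const.mul ?_)
  · exact Continuous.continuousOn (by fun_prop)
  · refine continuousOn_finsetSum _ fun i _ => continuousOn_finsetSum _ fun j _ =>
      continuousOn_finsetSum _ fun w _ => continuousOn_const.mul ?_
    refine (hF w).continuousOn.comp (f := fun z : (I → K → ℝ) × (J → L → ℝ) => (z.1 i, z.2 j))
      (Continuous.continuousOn (by fun_prop)) ?_
    rintro ⟨a, b⟩ ⟨ha, hb⟩
    exact ⟨ha i, hb j⟩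

end forms

/-! ### Value of the one-shot game -/

section value

variable {M : ℝ} {g : K → L → I → J → ℝ} {ρ : I → J → Ω → ℝ} {lam : ℝ}
  {F F' : Ω → (K → ℝ) → (L → ℝ) → ℝ} {π : K → ℝ} {θ : L → ℝ}

theorem concaveOn_shapley (hlam' : lam ≤ 1) (hρ : ∀ i j w, 0 ≤ ρ i j w)
    (hF : ∀ w, IsHalfSaddle M (F w)) {b : J → L → ℝ} (hb : 0 ≤ b) :
    ConcaveOn ℝ (splittings I π) fun a => shapley lam ρ g F a b := by
  refine ⟨convex_splittings, fun a ha a' ha' s t hs ht _ => ?_⟩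
  have h0 : 0 ≤ a := splittings_nonneg ha
  have h0' : 0 ≤ a' := splittings_nonneg ha'
  rw [smul_eq_mul, smul_eq_mul, ← shapley_smul hF hs h0 hb, ← shapley_smul hF ht h0' hb]
  exact shapley_superadd hlam' hρ hF (smul_nonneg hs h0) (smul_nonneg ht h0') hb

/-- Homogeneity and superadditivity give concavity in `a`; the exchange of players gives convexity
in `b`. The sets of splittings are compact and convex, so Sion's theorem applies. -/
theorem exists_isGameValue_shapley [Nonempty I] [Nonempty J] (hlam' : lam ≤ 1)
    (hρ : ∀ i j w, 0 ≤ ρ i j w) (hF : ∀ w, IsSaddle M (F w)) (hπ : 0 ≤ π) (hθ : 0 ≤ θ) :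
    ∃ V, IsGameValue (splittings I π) (splittings J θ) (shapley lam ρ g F) V := by
  have hcont := continuousOn_shapley (lam := lam) (ρ := ρ) (g := g) hF
  have hc1 : ∀ b ∈ splittings J θ,
      ContinuousOn (fun a => shapley lam ρ g F a b) (splittings I π) := fun b hb =>
    hcont.comp (f := fun a => (a, b)) (by fun_prop) fun a ha =>
      ⟨splittings_nonneg ha, splittings_nonneg hb⟩
  have hc2 : ∀ a ∈ splittings I π,
      ContinuousOn (fun b => shapley lam ρ g F a b) (splittings J θ) := fun a ha =>
    hcont.comp (f := fun b => (a, b)) (by fun_prop) fun b hb =>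
      ⟨splittings_nonneg ha, splittings_nonneg hb⟩
  have hconv : ∀ a ∈ splittings I π,
      ConvexOn ℝ (splittings J θ) fun b => shapley lam ρ g F a b := fun a ha => by
    have h := concaveOn_shapley (π := θ) (M := M) (lam := lam) (ρ := fun j i => ρ i j)
      (g := fun l k j i => -g k l i j) hlam' (fun j i => hρ i j) (fun w => (hF w).right)
      (b := a) (splittings_nonneg ha)
    simp only [shapley_swap] at h
    exact neg_concaveOn_iff.1 h
  -- The minimizer is the first variable in this form of Sion's theorem, hence the order `b`, `a`.
  obtain ⟨b, hb, a, ha, h⟩ := Sion.exists_isSaddlePointOn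
    (f := fun b a => shapley lam ρ g F a b) (nonempty_splittings hθ) convex_splittings
    isCompact_splittings (fun a ha => (hc2 a ha).lowerSemicontinuousOn)
    (fun a ha => (hconv a ha).quasiconvexOn) convex_splittings (nonempty_splittings hπ)
    isCompact_splittings (fun b hb => (hc1 b hb).upperSemicontinuousOn)
    fun b hb => (concaveOn_shapley hlam' hρ (fun w => (hF w).left)
      (splittings_nonneg hb)).quasiconcaveOn
  exact ⟨shapley lam ρ g F a b, ⟨a, ha, fun b' hb' => h b' hb' a ha⟩,
    b, hb, fun a' ha' => h b hb a' ha'⟩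

/-- The value of the one-shot game inherits the properties of the continuation payoff (those that
concern the first player). -/
theorem isHalfSaddle_value (hlam : 0 ≤ lam) (hlam' : lam ≤ 1) (hρ : ∀ i j w, 0 ≤ ρ i j w)
    (hρ' : ∀ i j, ∑ w, ρ i j w = 1) (hg : ∀ k l i j, |g k l i j| ≤ M)
    (hF : ∀ w, IsHalfSaddle M (F w)) {V : (K → ℝ) → (L → ℝ) → ℝ}
    (hV : ∀ π θ, 0 ≤ π → 0 ≤ θ →
      IsGameValue (splittings I π) (splittings J θ) (shapley lam ρ g F) (V π θ)) :
    IsHalfSaddle M V := by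
  have bound : ∀ π θ, ∀ a ∈ splittings I π, ∀ b ∈ splittings J θ,
      |shapley lam ρ g F a b| ≤ M * ((∑ k, π k) * ∑ l, θ l) := fun π θ a ha b hb => by
    have h := abs_shapley_le hlam hlam' hρ hρ' hg hF (splittings_nonneg ha) (splittings_nonneg hb)
    rwa [sum_splittings ha, sum_splittings hb] at h
  have smul_le : ∀ (c : ℝ) π θ, 0 ≤ c → 0 ≤ π → 0 ≤ θ → c * V π θ ≤ V (c • π) θ := by
    intro c π θ hc hπ hθ
    obtain ⟨⟨a, ha, h1⟩, -⟩ := hV π θ hπ hθ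
    refine (hV (c • π) θ (smul_nonneg hc hπ) hθ).le_of_forall (smul_mem_splittings hc ha)
      fun b hb => ?_
    rw [shapley_smul hF hc (splittings_nonneg ha) (splittings_nonneg hb)]
    exact mul_le_mul_of_nonneg_left (h1 b hb) hc
  refine ⟨?_, ?_, ?_, ?_⟩
  · intro π θ hπ hθ
    obtain ⟨⟨a, ha, h1⟩, b, hb, h2⟩ := hV π θ hπ hθ
    rw [le_antisymm (h1 b hb) (h2 a ha)]
    exact bound π θ a ha b hb
  · intro c π θ hc hπ hθ
    refine le_antisymm ?_ (smul_le c π θ hc hπ hθ)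
    rcases hc.eq_or_lt with rfl | hc0
    -- For `c = 0` scaling back is impossible, but there the growth bound already forces the value
    -- to be zero.
    · obtain ⟨⟨a, ha, h1⟩, b, hb, h2⟩ := hV ((0 : ℝ) • π) θ (by simp) hθ
      have h3 := bound _ θ a ha b hb
      rw [le_antisymm (h1 b hb) (h2 a ha), zero_mul]
      simp only [Pi.smul_apply, zero_smul, Finset.sum_const_zero, zero_mul, mul_zero] at h3
      exact (abs_le.1 h3).2
    · have h := smul_le c⁻¹ (c • π) θ (inv_nonneg.2 hc) (smul_nonneg hc hπ) hθ
      rw [inv_smul_smul₀ hc0.ne'] at h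
      rwa [inv_mul_le_iff₀ hc0] at h
  · intro π π' θ hπ hπ' hθ
    obtain ⟨⟨a, ha, h1⟩, -⟩ := hV π θ hπ hθ
    obtain ⟨⟨a', ha', h1'⟩, -⟩ := hV π' θ hπ' hθ
    -- Player 1 can add up optimal splittings of the two parts.
    refine (hV (π + π') θ (add_nonneg hπ hπ') hθ).le_of_forall (add_mem_splittings ha ha')
      fun b hb => ?_
    exact (add_le_add (h1 b hb) (h1' b hb)).trans (shapley_superadd hlam' hρ hF
      (splittings_nonneg ha) (splittings_nonneg ha') (splittings_nonneg hb))
  · intro π π' θ hπ hπ' hθ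
    -- Player 2 keeps the optimal reply to `π`: any splitting of `π + π'` is one of `π` plus one of
    -- `π'`, and the latter part brings at most its mass times `M`.
    obtain ⟨-, b, hb, h2⟩ := hV π θ hπ hθ
    refine (hV (π + π') θ (add_nonneg hπ hπ') hθ).ge_of_forall hb fun a ha => ?_
    obtain ⟨c, hc, d, hd, rfl⟩ := exists_mem_splittings_add hπ hπ' ha
    have h := shapley_add_le hlam hlam' hρ hρ' hg hF (splittings_nonneg hc) (splittings_nonneg hd)
      (splittings_nonneg hb)
    rw [sum_splittings hd, sum_splittings hb] at h
    linarith [h2 c hc]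

theorem isSaddle_value (hlam : 0 ≤ lam) (hlam' : lam ≤ 1) (hρ : ∀ i j w, 0 ≤ ρ i j w)
    (hρ' : ∀ i j, ∑ w, ρ i j w = 1) (hg : ∀ k l i j, |g k l i j| ≤ M)
    (hF : ∀ w, IsSaddle M (F w)) {V : (K → ℝ) → (L → ℝ) → ℝ}
    (hV : ∀ π θ, 0 ≤ π → 0 ≤ θ →
      IsGameValue (splittings I π) (splittings J θ) (shapley lam ρ g F) (V π θ)) :
    IsSaddle M V := by
  refine ⟨isHalfSaddle_value hlam hlam' hρ hρ' hg (fun w => (hF w).left) hV, ?_⟩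
  refine isHalfSaddle_value (lam := lam) (ρ := fun j i => ρ i j) (g := fun l k j i => -g k l i j)
    hlam hlam' (fun j i => hρ i j) (fun j i => hρ' i j) (fun l k j i => by simpa using hg k l i j)
    (fun w => (hF w).right) fun θ π hθ hπ => ?_
  have h := (hV π θ hπ hθ).swap
  simp only [← shapley_swap] at h
  exact h

/-- The contraction property: Player 1's optimal action in the first game meets Player 2's in the
second. Errors are measured relative to the total masses, since homogeneous functions are not
uniformly bounded. -/
theorem value_le_of_le (hlam' : lam ≤ 1) (hρ : ∀ i j w, 0 ≤ ρ i j w)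
    (hρ' : ∀ i j, ∑ w, ρ i j w = 1) {c : ℝ}
    (h : ∀ w π θ, 0 ≤ π → 0 ≤ θ → F w π θ ≤ F' w π θ + c * ((∑ k, π k) * ∑ l, θ l)) {V V' : ℝ}
    (hV : IsGameValue (splittings I π) (splittings J θ) (shapley lam ρ g F) V)
    (hV' : IsGameValue (splittings I π) (splittings J θ) (shapley lam ρ g F') V') :
    V ≤ V' + (1 - lam) * c * ((∑ k, π k) * ∑ l, θ l) := by
  obtain ⟨⟨a, ha, h1⟩, -⟩ := hV
  obtain ⟨-, b, hb, h2⟩ := hV'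
  have h3 := shapley_le_of_le (g := g) hlam' hρ hρ' h (splittings_nonneg ha) (splittings_nonneg hb)
  rw [sum_splittings ha, sum_splittings hb] at h3
  linarith [h1 b hb, h2 a ha]

end value

end

/-! ### Fixed point of the Shapley operator -/

section

variable {K L Ω I J : Type*} [Fintype K] [Fintype L] [Fintype Ω] [Fintype I] [Fintype J]

section fixedPoint

open Filter Topology

theorem IsHalfSaddle.of_tendsto {M : ℝ} {f : ℕ → (K → ℝ) → (L → ℝ) → ℝ}
    {F : (K → ℝ) → (L → ℝ) → ℝ} (hf : ∀ n, IsHalfSaddle M (f n))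
    (h : ∀ π θ, 0 ≤ π → 0 ≤ θ → Tendsto (fun n => f n π θ) atTop (𝓝 (F π θ))) :
    IsHalfSaddle M F where
  abs_apply_le π θ hπ hθ :=
    le_of_tendsto' (h π θ hπ hθ).abs fun n => (hf n).abs_apply_le π θ hπ hθ
  smul c π θ hc hπ hθ :=
    tendsto_nhds_unique (h _ θ (smul_nonneg hc hπ) hθ) (by
      simp only [fun n => (hf n).smul c π θ hc hπ hθ]
      exact (h π θ hπ hθ).const_mul c)
  superadd π π' θ hπ hπ' hθ :=
    le_of_tendsto_of_tendsto' ((h π θ hπ hθ).add (h π' θ hπ' hθ))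
      (h _ θ (add_nonneg hπ hπ') hθ) fun n => (hf n).superadd π π' θ hπ hπ' hθ
  add_le π π' θ hπ hπ' hθ :=
    le_of_tendsto_of_tendsto' (h _ θ (add_nonneg hπ hπ') hθ)
      ((h π θ hπ hθ).add_const _) fun n => (hf n).add_le π π' θ hπ hπ' hθ

theorem IsSaddle.of_tendsto {M : ℝ} {f : ℕ → (K → ℝ) → (L → ℝ) → ℝ}
    {F : (K → ℝ) → (L → ℝ) → ℝ} (hf : ∀ n, IsSaddle M (f n))
    (h : ∀ π θ, 0 ≤ π → 0 ≤ θ → Tendsto (fun n => f n π θ) atTop (𝓝 (F π θ))) :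
    IsSaddle M F :=
  ⟨.of_tendsto (fun n => (hf n).left) h,
    .of_tendsto (fun n => (hf n).right) fun θ π hθ hπ => (h π θ hπ hθ).neg⟩

/-- The Shapley equation has a solution that is homogeneous, superadditive in the first belief and
subadditive in the second one. -/
theorem exists_shapley_fixedPoint [Nonempty I] [Nonempty J] {M lam : ℝ}
    {g : K → L → Ω → I → J → ℝ} {ρ : Ω → I → J → Ω → ℝ} (hM : 0 ≤ M) (hlam : 0 < lam)
    (hlam' : lam ≤ 1) (hρ : ∀ v i j w, 0 ≤ ρ v i j w) (hρ' : ∀ v i j, ∑ w, ρ v i j w = 1)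
    (hg : ∀ k l v i j, |g k l v i j| ≤ M) :
    ∃ F : Ω → (K → ℝ) → (L → ℝ) → ℝ, (∀ v, IsSaddle M (F v)) ∧ ∀ v π θ, 0 ≤ π → 0 ≤ θ →
      IsGameValue (splittings I π) (splittings J θ) (shapley lam (ρ v) (fun k l => g k l v) F)
        (F v π θ) := by
  have hlam1 : 0 ≤ 1 - lam := sub_nonneg.2 hlam'
  have hstep : ∀ F : {F : Ω → (K → ℝ) → (L → ℝ) → ℝ // ∀ v, IsSaddle M (F v)},
      ∃ F' : {F : Ω → (K → ℝ) → (L → ℝ) → ℝ // ∀ v, IsSaddle M (F v)}, ∀ v π θ, 0 ≤ π → 0 ≤ θ →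
      IsGameValue (splittings I π) (splittings J θ) (shapley lam (ρ v) (fun k l => g k l v) F.1)
        (F'.1 v π θ) := by
    intro F
    have h : ∀ v π θ, ∃ V, 0 ≤ π → 0 ≤ θ → IsGameValue (splittings I π) (splittings J θ)
        (shapley lam (ρ v) (fun k l => g k l v) F.1) V := fun v π θ => by
      by_cases h : 0 ≤ π ∧ 0 ≤ θ
      · obtain ⟨V, hV⟩ := exists_isGameValue_shapley (lam := lam) (g := fun k l => g k l v) hlam'
          (hρ v) F.2 h.1 h.2
        exact ⟨V, fun _ _ => hV⟩
      · exact ⟨0, fun h1 h2 => absurd ⟨h1, h2⟩ h⟩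
    choose V hV using h
    exact ⟨⟨V, fun v => isSaddle_value hlam.le hlam' (hρ v) (hρ' v) (fun k l i j => hg k l v i j)
      F.2 (hV v)⟩, hV⟩
  choose step hstep using hstep
  have h0 : ∀ v : Ω, IsSaddle M fun (_ : K → ℝ) (_ : L → ℝ) => (0 : ℝ) := fun _ => by
    have hp : ∀ (π : K → ℝ) (θ : L → ℝ), 0 ≤ π → 0 ≤ θ → 0 ≤ M * ((∑ k, π k) * ∑ l, θ l) :=
      fun π θ hπ hθ => mul_nonneg hM (mul_nonneg (Finset.sum_nonneg fun k _ => hπ k)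
        (Finset.sum_nonneg fun l _ => hθ l))
    refine ⟨⟨?_, by simp, by simp, ?_⟩, ⟨?_, by simp, by simp, ?_⟩⟩
    · intro π θ hπ hθ; simpa using hp π θ hπ hθ
    · intro π π' θ _ hπ hθ; simpa using hp π' θ hπ hθ
    · intro θ π hθ hπ; simpa [mul_comm (∑ l, θ l)] using hp π θ hπ hθ
    · intro π π' θ _ hπ hθ; simpa [mul_comm (∑ l, π' l)] using hp θ π' hθ hπ
  -- Value iteration from the zero function, inside the set of saddle functions so that each
  -- one-shot game has a value.
  let f : ℕ → {F : Ω → (K → ℝ) → (L → ℝ) → ℝ // ∀ v, IsSaddle M (F v)} :=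
    fun n => step^[n] ⟨fun _ _ _ => 0, h0⟩
  have hf : ∀ n v π θ, 0 ≤ π → 0 ≤ θ →
      IsGameValue (splittings I π) (splittings J θ)
        (shapley lam (ρ v) (fun k l => g k l v) (f n).1) ((f (n + 1)).1 v π θ) := by
    intro n
    have : f (n + 1) = step (f n) := Function.iterate_succ_apply' step n _
    rw [this]
    exact hstep (f n)
  have hd : ∀ n v π θ, 0 ≤ π → 0 ≤ θ → |(f n).1 v π θ - (f (n + 1)).1 v π θ| ≤
      (1 - lam) ^ n * M * ((∑ k, π k) * ∑ l, θ l) := by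
    intro n
    induction n with
    | zero =>
      intro v π θ hπ hθ
      have := ((f 1).2 v).left.abs_apply_le π θ hπ hθ
      simpa [f] using this
    | succ n ih =>
      intro v π θ hπ hθ
      have h1 := value_le_of_le (c := (1 - lam) ^ n * M) hlam' (hρ v) (hρ' v)
        (fun w π θ hπ hθ => by linarith [(abs_le.1 (ih w π θ hπ hθ)).2])
        (hf n v π θ hπ hθ) (hf (n + 1) v π θ hπ hθ)
      have h2 := value_le_of_le (c := (1 - lam) ^ n * M) hlam' (hρ v) (hρ' v)
        (fun w π θ hπ hθ => by linarith [(abs_le.1 (ih w π θ hπ hθ)).1])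
        (hf (n + 1) v π θ hπ hθ) (hf n v π θ hπ hθ)
      rw [pow_succ', mul_assoc (1 - lam), abs_le]
      constructor <;> linarith
  have hlt : 1 - lam < 1 := by linarith
  -- Convergence matters only on nonnegative vectors; elsewhere the limit takes an arbitrary value.
  have hex : ∀ v π θ, ∃ V, 0 ≤ π → 0 ≤ θ → Tendsto (fun n => (f n).1 v π θ) atTop (𝓝 V) := by
    intro v π θ
    by_cases h : 0 ≤ π ∧ 0 ≤ θ
    · have hc : CauchySeq fun n => (f n).1 v π θ :=
        cauchySeq_of_le_geometric (1 - lam) (M * ((∑ k, π k) * ∑ l, θ l)) hlt fun n => by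
          rw [Real.dist_eq]
          exact (hd n v π θ h.1 h.2).trans_eq (by ring)
      obtain ⟨V, hV⟩ := cauchySeq_tendsto_of_complete hc
      exact ⟨V, fun _ _ => hV⟩
    · exact ⟨0, fun h1 h2 => absurd ⟨h1, h2⟩ h⟩
  choose F hF using hex
  have hsad : ∀ v, IsSaddle M (F v) := fun v => .of_tendsto (fun n => (f n).2 v) (hF v)
  refine ⟨F, hsad, fun v π θ hπ hθ => ?_⟩
  have hdist : ∀ n v π θ, 0 ≤ π → 0 ≤ θ → |(f n).1 v π θ - F v π θ| ≤
      M / lam * (1 - lam) ^ n * ((∑ k, π k) * ∑ l, θ l) := by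
    intro n v π θ hπ hθ
    have h := dist_le_of_le_geometric_of_tendsto (1 - lam) (M * ((∑ k, π k) * ∑ l, θ l)) hlt
      (fun n => by
        rw [Real.dist_eq]
        exact (hd n v π θ hπ hθ).trans_eq (by ring)) (hF v π θ hπ hθ) n
    rw [Real.dist_eq, sub_sub_cancel] at h
    exact h.trans_eq (by ring)
  -- `V` is the value with continuation payoff `F` itself. By the contraction property the iterates
  -- converge to `V` as well as to `F v π θ`.
  obtain ⟨V, hV⟩ := exists_isGameValue_shapley (lam := lam) (g := fun k l => g k l v) hlam'
    (hρ v) hsad hπ hθ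
  have hlim : Tendsto (fun n => (f (n + 1)).1 v π θ) atTop (𝓝 V) := by
    rw [tendsto_iff_dist_tendsto_zero]
    have hz : Tendsto (fun n : ℕ => (1 - lam) * (M / lam * (1 - lam) ^ n) *
        ((∑ k, π k) * ∑ l, θ l)) atTop (𝓝 0) := by
      have := tendsto_pow_atTop_nhds_zero_of_lt_one hlam1 hlt
      simpa using ((this.const_mul (M / lam)).const_mul (1 - lam)).mul_const
        ((∑ k, π k) * ∑ l, θ l)
    refine squeeze_zero (fun _ => dist_nonneg) (fun n => ?_) hz
    have h1 := value_le_of_le (c := M / lam * (1 - lam) ^ n) hlam' (hρ v) (hρ' v)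
      (fun w π θ hπ hθ => by linarith [(abs_le.1 (hdist n w π θ hπ hθ)).2])
      (hf n v π θ hπ hθ) hV
    have h2 := value_le_of_le (c := M / lam * (1 - lam) ^ n) hlam' (hρ v) (hρ' v)
      (fun w π θ hπ hθ => by linarith [(abs_le.1 (hdist n w π θ hπ hθ)).1])
      hV (hf n v π θ hπ hθ)
    rw [Real.dist_eq, abs_le]
    constructor <;> linarith
  rwa [tendsto_nhds_unique ((hF v π θ hπ hθ).comp (tendsto_add_atTop_nat 1)) hlim]

end fixedPoint

end

/-! ### From mixed actions to joint measures -/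

section reweight

variable {T A : Type*} [Fintype A]

/-- The joint measure of the action and the type, when the type has mass function `p` and the
action is drawn according to `x`. -/
def reweight (x : MixedAction T A) (p : T → ℝ) (i : A) (k : T) : ℝ := x k i * p k

theorem reweight_mem_splittings (x : MixedAction T A) {p : T → ℝ} (hp : 0 ≤ p) :
    reweight x p ∈ splittings A p :=
  ⟨fun i k => mul_nonneg (stdSimplex.zero_le _ _) (hp k), fun k => by
    simp [reweight, ← Finset.sum_mul]⟩

theorem reweight_nonneg (x : MixedAction T A) {p : T → ℝ} (hp : 0 ≤ p) : 0 ≤ reweight x p :=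
  splittings_nonneg (reweight_mem_splittings x hp)

/-- Disintegration with respect to the type. A type of mass zero may play anything, its column being
zero. -/
theorem exists_reweight_eq [Nonempty A] {p : T → ℝ} (hp : 0 ≤ p) {a : A → T → ℝ}
    (ha : a ∈ splittings A p) : ∃ x : MixedAction T A, reweight x p = a := by
  classical
  obtain ⟨z⟩ : Nonempty (stdSimplex ℝ A) := inferInstance
  refine ⟨fun k => if hk : p k = 0 then z else ⟨fun i => a i k / p k,
    fun i => div_nonneg (ha.1 i k) (hp k), by rw [← Finset.sum_div, ha.2 k, div_self hk]⟩, ?_⟩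
  funext i k
  by_cases hk : p k = 0
  · have h := ha.2 k
    rw [hk] at h
    simp [reweight, hk,
      (Finset.sum_eq_zero_iff_of_nonneg fun i _ => ha.1 i k).1 h i (Finset.mem_univ i)]
  · simp only [reweight, hk, dite_false]
    exact div_mul_cancel₀ _ hk

variable [Fintype T]

theorem stdSimplex_coe_nonneg (p : stdSimplex ℝ T) : 0 ≤ (p : T → ℝ) := fun k => p.2.1 k

theorem sum_reweight (x : MixedAction T A) (p : stdSimplex ℝ T) (i : A) :
    ∑ k, reweight x p i k = meanAction p x i :=
  Finset.sum_congr rfl fun _ _ => mul_comm _ _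

theorem reweight_eq_zero {x : MixedAction T A} {p : stdSimplex ℝ T} {i : A}
    (h : meanAction p x i = 0) : reweight x p i = 0 := by
  rw [← sum_reweight] at h
  funext k
  exact (Finset.sum_eq_zero_iff_of_nonneg fun k _ =>
    reweight_nonneg x (stdSimplex_coe_nonneg p) i k).1 h k (Finset.mem_univ k)

/-- The convention for the posterior after an action of probability zero is invisible here, since
both sides then vanish. -/
theorem meanAction_smul_posteriorBelief (x : MixedAction T A) (p : stdSimplex ℝ T) (i : A) :
    meanAction p x i • (posteriorBelief p x i : T → ℝ) = reweight x p i := by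
  funext k
  simp only [Pi.smul_apply, smul_eq_mul]
  rw [posteriorBelief_apply]
  split_ifs with h
  · rw [reweight_eq_zero h, h, zero_mul]; rfl
  · rw [mul_div_cancel₀ _ h]; rfl

theorem meanAction_mul_posteriorBelief (x : MixedAction T A) (p : stdSimplex ℝ T) (i : A) (k : T) :
    meanAction p x i * posteriorBelief p x i k = reweight x p i k :=
  congrFun (meanAction_smul_posteriorBelief x p i) k

theorem continuous_stdSimplex_apply (k : T) : Continuous fun p : stdSimplex ℝ T => p k :=
  (continuous_apply k).comp continuous_subtype_val

theorem continuous_reweight :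
    Continuous fun z : MixedAction T A × stdSimplex ℝ T => reweight z.1 (z.2 : T → ℝ) := by
  refine continuous_pi fun i => continuous_pi fun k => ?_
  exact ((continuous_stdSimplex_apply i).comp ((continuous_apply k).comp continuous_fst)).mul
    ((continuous_stdSimplex_apply k).comp continuous_snd)

end reweight

namespace IncompleteInfoGame

variable {K L Ω I J : Type*} [Fintype K] [Fintype L] [Fintype Ω] [Fintype I] [Fintype J]

theorem payoff_eq_stageForm (Γ : IncompleteInfoGame K L Ω I J) (z : Stage K L Ω I J) :
    Γ.payoff z = stageForm (fun k l => Γ.g k l z.1.2.2) (reweight z.2.1 z.1.1)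
      (reweight z.2.2 z.1.2.1) := by
  unfold payoff stageForm reweight
  have h (f : K → L → I → J → ℝ) :
      ∑ k, ∑ l, ∑ i, ∑ j, f k l i j = ∑ i, ∑ j, ∑ k, ∑ l, f k l i j := by
    have h' (k) : ∑ l, ∑ i, ∑ j, f k l i j = ∑ i, ∑ j, ∑ l, f k l i j := by
      rw [Finset.sum_comm]
      exact Finset.sum_congr rfl fun i _ => Finset.sum_comm
    simp only [h']
    rw [Finset.sum_comm]
    exact Finset.sum_congr rfl fun i _ => Finset.sum_comm
  rw [h]
  refine Finset.sum_congr rfl fun i _ => Finset.sum_congr rfl fun j _ =>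
    Finset.sum_congr rfl fun k _ => Finset.sum_congr rfl fun l _ => ?_
  change _ = Γ.g k l z.1.2.2 i j * (z.2.1 k i * z.1.1 k) * (z.2.2 l j * z.1.2.1 l)
  ring

theorem abs_g_le_payoffNorm (Γ : IncompleteInfoGame K L Ω I J) (k : K) (l : L) (w : Ω) (i : I)
    (j : J) : |Γ.g k l w i j| ≤ Γ.payoffNorm :=
  le_ciSup (f := fun z : K × L × Ω × I × J => |Γ.g z.1 z.2.1 z.2.2.1 z.2.2.2.1 z.2.2.2.2|)
    (Set.finite_range _).bddAbove (k, l, w, i, j)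

omit [Fintype K] [Fintype L] [Fintype I] [Fintype J] in
theorem payoffNorm_nonneg (Γ : IncompleteInfoGame K L Ω I J) : 0 ≤ Γ.payoffNorm :=
  Real.iSup_nonneg fun _ => abs_nonneg _

theorem abs_payoff_le (Γ : IncompleteInfoGame K L Ω I J) (z : Stage K L Ω I J) :
    |Γ.payoff z| ≤ Γ.payoffNorm := by
  have ha := reweight_mem_splittings z.2.1 (stdSimplex_coe_nonneg z.1.1)
  have hb := reweight_mem_splittings z.2.2 (stdSimplex_coe_nonneg z.1.2.1)
  have h := abs_stageForm_le (g := fun k l => Γ.g k l z.1.2.2) (a := reweight z.2.1 z.1.1)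
    (fun k l i j => Γ.abs_g_le_payoffNorm k l z.1.2.2 i j) (splittings_nonneg hb)
  simp only [abs_of_nonneg (ha.1 _ _)] at h
  rw [sum_splittings ha, sum_splittings hb] at h
  rw [payoff_eq_stageForm]
  simpa [stdSimplex.sum_eq_one] using h

variable [MeasurableSpace Ω]

theorem measurable_payoff [DiscreteMeasurableSpace Ω] (Γ : IncompleteInfoGame K L Ω I J) :
    Measurable Γ.payoff := by
  unfold payoff
  refine Finset.measurable_sum _ fun k _ => Finset.measurable_sum _ fun l _ =>
    Finset.measurable_sum _ fun i _ => Finset.measurable_sum _ fun j _ => ?_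
  refine (((Measurable.mul ?_ ?_).mul ?_).mul ?_).mul ?_
  · exact (measurable_stdSimplex_apply k).comp (measurable_fst.comp measurable_fst)
  · exact (measurable_stdSimplex_apply l).comp
      (measurable_fst.comp (measurable_snd.comp measurable_fst))
  · exact (measurable_stdSimplex_apply i).comp
      ((measurable_pi_apply k).comp (measurable_fst.comp measurable_snd))
  · exact (measurable_stdSimplex_apply j).comp
      ((measurable_pi_apply l).comp (measurable_snd.comp measurable_snd))
  · exact (Measurable.of_discrete (f := fun w => Γ.g k l w i j)).comp
      (measurable_snd.comp (measurable_snd.comp measurable_fst))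

omit [MeasurableSpace Ω] in
theorem transitionLaw_weight_nonneg (Γ : IncompleteInfoGame K L Ω I J) (z : Stage K L Ω I J)
    (i : I) (j : J) (w : Ω) :
    0 ≤ Γ.ρ z.1.2.2 i j w * meanAction z.1.1 z.2.1 i * meanAction z.1.2.1 z.2.2 j :=
  mul_nonneg (mul_nonneg ((Γ.ρ z.1.2.2 i j).2.1 w) (meanAction_nonneg _ _ _))
    (meanAction_nonneg _ _ _)

theorem integral_transition [DiscreteMeasurableSpace Ω] (Γ : IncompleteInfoGame K L Ω I J)
    (z : Stage K L Ω I J) {f : BeliefState K L Ω → ℝ} (hf : Measurable f) :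
    ∫ s, f s ∂(Γ.transition z) = ∑ i, ∑ j, ∑ w,
      Γ.ρ z.1.2.2 i j w * meanAction z.1.1 z.2.1 i * meanAction z.1.2.1 z.2.2 j *
      f (posteriorBelief z.1.1 z.2.1 i, posteriorBelief z.1.2.1 z.2.2 j, w) := by
  change ∫ s, f s ∂(Γ.transitionLaw z) = _
  have hd : ∀ (c : ℝ) s, Integrable f (ENNReal.ofReal c • Measure.dirac s) := fun c s =>
    ((integrable_dirac' hf.stronglyMeasurable (by simp))).smul_measure ENNReal.ofReal_ne_top
  unfold transitionLaw
  rw [integral_finsetSum_measure fun i _ => ?_]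
  · refine Finset.sum_congr rfl fun i _ => ?_
    rw [integral_finsetSum_measure fun j _ => ?_]
    · refine Finset.sum_congr rfl fun j _ => ?_
      rw [integral_finsetSum_measure fun w _ => hd _ _]
      refine Finset.sum_congr rfl fun w _ => ?_
      rw [integral_smul_measure, integral_dirac' _ _ hf.stronglyMeasurable,
        ENNReal.toReal_ofReal (Γ.transitionLaw_weight_nonneg z i j w), smul_eq_mul]
    · exact integrable_finsetSum_measure.2 fun w _ => hd _ _
  · exact integrable_finsetSum_measure.2 fun j _ => integrable_finsetSum_measure.2 fun w _ => hd _ _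

/-- Homogeneity in each variable absorbs the weights `meanAction` into the posteriors and turns them
into the rows of the joint measures. -/
theorem integral_transition_eq_continuationForm [DiscreteMeasurableSpace Ω] {M : ℝ}
    (Γ : IncompleteInfoGame K L Ω I J) {F : Ω → (K → ℝ) → (L → ℝ) → ℝ}
    (hF : ∀ v, IsSaddle M (F v)) (z : Stage K L Ω I J)
    (hm : Measurable fun s : BeliefState K L Ω => F s.2.2 s.1 s.2.1) :
    ∫ s, F s.2.2 s.1 s.2.1 ∂(Γ.transition z) =
      continuationForm (fun i j w => Γ.ρ z.1.2.2 i j w) F (reweight z.2.1 z.1.1)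
        (reweight z.2.2 z.1.2.1) := by
  rw [Γ.integral_transition z hm]
  refine Finset.sum_congr rfl fun i _ => Finset.sum_congr rfl fun j _ =>
    Finset.sum_congr rfl fun w _ => ?_
  have h1 := (hF w).left.smul (meanAction z.1.1 z.2.1 i) (posteriorBelief z.1.1 z.2.1 i : K → ℝ)
    (reweight z.2.2 z.1.2.1 j) (meanAction_nonneg _ _ _) (stdSimplex_coe_nonneg _)
    (reweight_nonneg _ (stdSimplex_coe_nonneg _) j)
  have h2 := (hF w).right.smul (meanAction z.1.2.1 z.2.2 j)
    (posteriorBelief z.1.2.1 z.2.2 j : L → ℝ) (posteriorBelief z.1.1 z.2.1 i : K → ℝ)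
    (meanAction_nonneg _ _ _) (stdSimplex_coe_nonneg _) (stdSimplex_coe_nonneg _)
  rw [meanAction_smul_posteriorBelief] at h1 h2
  rw [h1, neg_eq_iff_eq_neg.1 h2]
  ring

end IncompleteInfoGame

/-! ### Law of the play and iteration of one-stage inequalities -/

namespace IncompleteInfoGame

variable {K L Ω I J : Type*} [Fintype K] [Fintype L] [Fintype Ω] [Fintype I] [Fintype J]
  [MeasurableSpace Ω] [DiscreteMeasurableSpace Ω]
  (Γ : IncompleteInfoGame K L Ω I J) (w : BeliefState K L Ω)
  (σ : BehaviorStrategy K L Ω I J (MixedAction K I))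
  (τ : BehaviorStrategy K L Ω I J (MixedAction L J))

instance : IsProbabilityMeasure (Γ.law w σ τ) := by
  unfold law
  infer_instance

theorem law_map_zero : (Γ.law w σ τ).map (fun h => h 0) = stageKernel σ τ 0 (Fin.elim0, w) := by
  let μ := stageKernel σ τ 0 (Fin.elim0, w)
  have h1 : (Γ.law w σ τ).map (Preorder.frestrictLe (π := fun _ => Stage K L Ω I J) 0) =
      μ.map (MeasurableEquiv.piUnique
        (fun _ : Finset.Iic (0 : ℕ) => Stage K L Ω I J)).symm := by
    unfold law Kernel.trajMeasure
    rw [Measure.map_comp _ _ (by fun_prop), Kernel.traj_map_frestrictLe, Kernel.partialTraj_self,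
      Measure.id_comp]
  have h2 : (fun h : ℕ → Stage K L Ω I J => h 0) = (MeasurableEquiv.piUnique
        (fun _ : Finset.Iic (0 : ℕ) => Stage K L Ω I J)) ∘
      (Preorder.frestrictLe (π := fun _ => Stage K L Ω I J) 0) := rfl
  rw [h2, ← Measure.map_map (by fun_prop) (by fun_prop), h1,
    Measure.map_map (by fun_prop) (by fun_prop), MeasurableEquiv.self_comp_symm, Measure.map_id]

/-- Whatever the strategies, the new state depends on the past only through the last stage. This is
why functions of the state can be followed along the play by means of `Γ.transition` alone. -/
theorem fst_nextStage (n : ℕ) : (Γ.nextStage σ τ n).map Prod.fst =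
    Γ.transition.comap (fun h => h ⟨n, Finset.mem_Iic.2 le_rfl⟩) (measurable_pi_apply _) := by
  have := σ.isMarkov (n + 1)
  have := τ.isMarkov (n + 1)
  unfold nextStage
  rw [Kernel.map_comp]
  have h : (stageKernel σ τ (n + 1)).map Prod.fst =
      Kernel.deterministic Prod.snd measurable_snd := by
    unfold stageKernel
    rw [← Kernel.fst_eq, Kernel.fst_prod]
  rw [h, Kernel.deterministic_comp_eq_map, ← Kernel.snd_eq, Kernel.snd_prod]

/-- The joint law of a stage and the next state. -/
theorem lintegral_law_succ (n : ℕ) {f : Stage K L Ω I J → BeliefState K L Ω → ENNReal}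
    (hf : Measurable (Function.uncurry f)) :
    ∫⁻ h, f (h n) (h (n + 1)).1 ∂(Γ.law w σ τ) =
      ∫⁻ h, ∫⁻ s, f (h n) s ∂(Γ.transition (h n)) ∂(Γ.law w σ τ) := by
  have key := Kernel.map_frestrictLe_trajMeasure_compProd_eq_map_trajMeasure
    (X := fun _ => Stage K L Ω I J) (μ₀ := stageKernel σ τ 0 (Fin.elim0, w))
    (κ := Γ.nextStage σ τ) (a := n)
  change (Γ.law w σ τ).map _ ⊗ₘ _ = (Γ.law w σ τ).map _ at key
  let last : (Finset.Iic n → Stage K L Ω I J) → Stage K L Ω I J :=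
    fun h => h ⟨n, Finset.mem_Iic.2 le_rfl⟩
  have hlast : Measurable last := measurable_pi_apply _
  let G : (Finset.Iic n → Stage K L Ω I J) × Stage K L Ω I J → ENNReal :=
    fun z => f (last z.1) z.2.1
  have hG : Measurable G := hf.comp ((hlast.comp measurable_fst).prodMk
    (measurable_fst.comp measurable_snd))
  have hl : Measurable fun h : Finset.Iic n → Stage K L Ω I J =>
      ∫⁻ s, f (last h) s ∂(Γ.transition (last h)) :=
    (Measurable.lintegral_kernel_prod_right' (κ := Γ.transition) hf).comp hlast
  calc ∫⁻ h, f (h n) (h (n + 1)).1 ∂(Γ.law w σ τ)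
      = ∫⁻ z, G z ∂((Γ.law w σ τ).map fun x => (Preorder.frestrictLe n x, x (n + 1))) := by
        rw [lintegral_map hG (by fun_prop)]
        rfl
    _ = ∫⁻ h, ∫⁻ z, G (h, z) ∂(Γ.nextStage σ τ n h)
          ∂((Γ.law w σ τ).map (Preorder.frestrictLe n)) := by
        rw [← key, Measure.lintegral_compProd hG]
    _ = ∫⁻ h, ∫⁻ s, f (last h) s ∂(Γ.transition (last h))
          ∂((Γ.law w σ τ).map (Preorder.frestrictLe n)) := by
        refine lintegral_congr fun h => ?_
        have h1 := DFunLike.congr_fun (Γ.fst_nextStage σ τ n) h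
        rw [Kernel.map_apply _ measurable_fst, Kernel.comap_apply] at h1
        rw [← h1]
        exact (lintegral_map (f := fun s => f (last h) s) (hf.comp measurable_prodMk_left)
          measurable_fst).symm
    _ = _ := by
        rw [lintegral_map hl (by fun_prop)]
        rfl

/-- A property that holds with probability one at each stage, whatever the past, holds almost
surely at each stage. -/
theorem ae_law_of_ae_stageKernel {B : Set (Stage K L Ω I J)} (hB : MeasurableSet B)
    (h : ∀ n x, stageKernel σ τ n x Bᶜ = 0) (n : ℕ) : ∀ᵐ h ∂(Γ.law w σ τ), h n ∈ B := by
  cases n with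
  | zero =>
    have h0 := h 0 (Fin.elim0, w)
    rw [← Γ.law_map_zero w σ τ, Measure.map_apply (measurable_pi_apply 0) hB.compl] at h0
    exact h0
  | succ n =>
    have key := Kernel.map_frestrictLe_trajMeasure_compProd_eq_map_trajMeasure
      (X := fun _ => Stage K L Ω I J) (μ₀ := stageKernel σ τ 0 (Fin.elim0, w))
      (κ := Γ.nextStage σ τ) (a := n)
    change (Γ.law w σ τ).map _ ⊗ₘ _ = (Γ.law w σ τ).map _ at key
    have hn : ∀ x, Γ.nextStage σ τ n x Bᶜ = 0 := fun x => by
      unfold nextStage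
      rw [Kernel.comp_apply' _ _ _ hB.compl]
      simp [h]
    have h1 : ((Γ.law w σ τ).map fun x => (Preorder.frestrictLe n x, x (n + 1)))
        (Set.univ ×ˢ Bᶜ) = 0 := by
      rw [← key, Measure.compProd_apply_prod MeasurableSet.univ hB.compl]
      simp [hn]
    rw [Measure.map_apply (by fun_prop) (MeasurableSet.univ.prod hB.compl)] at h1
    refine measure_mono_null (fun x hx => ?_) h1
    exact ⟨Set.mem_univ _, hx⟩

end IncompleteInfoGame

namespace IncompleteInfoGame

variable {K L Ω I J : Type*} [Fintype K] [Fintype L] [Fintype Ω] [Fintype I] [Fintype J]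
  [MeasurableSpace Ω] [DiscreteMeasurableSpace Ω]
  (Γ : IncompleteInfoGame K L Ω I J) (w : BeliefState K L Ω)
  (σ : BehaviorStrategy K L Ω I J (MixedAction K I))
  (τ : BehaviorStrategy K L Ω I J (MixedAction L J))

theorem law_map_succ (n : ℕ) :
    (Γ.law w σ τ).map (fun h => (h n, (h (n + 1)).1)) =
      (Γ.law w σ τ).map (fun h => h n) ⊗ₘ Γ.transition := by
  refine Measure.ext_of_lintegral _ fun f hf => ?_
  rw [lintegral_map hf (by fun_prop), Measure.lintegral_compProd hf,
    lintegral_map (Measurable.lintegral_kernel_prod_right' hf) (by fun_prop)]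
  exact Γ.lintegral_law_succ w σ τ n (f := fun z s => f (z, s)) hf

theorem integral_law_succ (n : ℕ) {u : BeliefState K L Ω → ℝ} (hu : Measurable u) {C : ℝ}
    (hC : ∀ s, |u s| ≤ C) :
    ∫ h, u (h (n + 1)).1 ∂(Γ.law w σ τ) =
      ∫ h, ∫ s, u s ∂(Γ.transition (h n)) ∂(Γ.law w σ τ) := by
  have hm : Measurable fun h : ℕ → Stage K L Ω I J => h n := by fun_prop
  have := Measure.isProbabilityMeasure_map (μ := Γ.law w σ τ) hm.aemeasurable
  have hi : Integrable (fun z : Stage K L Ω I J × BeliefState K L Ω => u z.2)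
      ((Γ.law w σ τ).map (fun h => h n) ⊗ₘ Γ.transition) :=
    .of_bound (hu.comp measurable_snd).aestronglyMeasurable C (.of_forall fun z => hC z.2)
  have h := Measure.integral_compProd hi
  have hs : StronglyMeasurable fun z : Stage K L Ω I J => ∫ s, u s ∂(Γ.transition z) :=
    StronglyMeasurable.integral_kernel_prod_right' (κ := Γ.transition)
      (f := fun z : Stage K L Ω I J × BeliefState K L Ω => u z.2)
      (hu.comp measurable_snd).stronglyMeasurable
  rw [← law_map_succ, integral_map
    (f := fun z : Stage K L Ω I J × BeliefState K L Ω => u z.2) (by fun_prop)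
    (hu.comp measurable_snd).aestronglyMeasurable, integral_map hm.aemeasurable
    hs.aestronglyMeasurable] at h
  exact h

theorem ae_law_zero : ∀ᵐ h ∂(Γ.law w σ τ), (h 0).1 = w := by
  have := σ.isMarkov 0
  have := τ.isMarkov 0
  have h1 : (Γ.law w σ τ).map (fun h => (h 0).1) = Measure.dirac w := by
    have e : (fun h : ℕ → Stage K L Ω I J => (h 0).1) = Prod.fst ∘ fun h => h 0 := rfl
    rw [e, ← Measure.map_map measurable_fst (by fun_prop), law_map_zero,
      ← Kernel.map_apply _ measurable_fst]
    unfold stageKernel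
    rw [← Kernel.fst_eq, Kernel.fst_prod, Kernel.deterministic_apply]
  have h2 : ∀ᵐ s ∂((Γ.law w σ τ).map (fun h => (h 0).1)), s = w := by
    rw [h1]
    exact (ae_dirac_iff (measurableSet_singleton w)).2 rfl
  exact ae_of_ae_map (measurable_fst.comp (measurable_pi_apply 0)).aemeasurable h2

section discounted

variable {lam : ℝ} {r : Stage K L Ω I J → ℝ} {M : ℝ}

theorem hasSum_integral_discounted (hlam : 0 < lam) (hlam' : lam ≤ 1) (hr : Measurable r)
    (hM : ∀ z, |r z| ≤ M) :
    HasSum (fun m => lam * (1 - lam) ^ m * ∫ h, r (h m) ∂(Γ.law w σ τ))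
      (∫ h, ∑' m : ℕ, lam * (1 - lam) ^ m * r (h m) ∂(Γ.law w σ τ)) := by
  have hlam1 : 0 ≤ 1 - lam := sub_nonneg.2 hlam'
  have hb : ∀ (m : ℕ) (h : ℕ → Stage K L Ω I J),
      ‖lam * (1 - lam) ^ m * r (h m)‖ ≤ (1 - lam) ^ m * (lam * M) := fun m h => by
    rw [Real.norm_eq_abs, abs_mul, abs_of_nonneg (mul_nonneg hlam.le (pow_nonneg hlam1 m))]
    nlinarith [mul_le_mul_of_nonneg_left (hM (h m)) (mul_nonneg hlam.le (pow_nonneg hlam1 m))]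
  have hs : Summable fun m : ℕ => (1 - lam) ^ m * (lam * M) :=
    (summable_geometric_of_lt_one hlam1 (by linarith)).mul_right _
  have hm : ∀ m, Measurable fun h : ℕ → Stage K L Ω I J => lam * (1 - lam) ^ m * r (h m) :=
    fun m => (hr.comp (measurable_pi_apply m)).const_mul _
  simp only [← integral_const_mul]
  exact hasSum_integral_of_dominated_convergence (fun m _ => (1 - lam) ^ m * (lam * M))
    (fun m => (hm m).aestronglyMeasurable) (fun m => .of_forall fun h => hb m h)
    (.of_forall fun _ => hs) (integrable_const _)
    (.of_forall fun h => (hs.of_norm_bounded (hb · h)).hasSum)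

/-- A bounded function of the state that is, along the play, below its one-stage evaluation, is
below the discounted payoff. -/
theorem le_discounted_of_ae_le (hlam : 0 < lam) (hlam' : lam ≤ 1) (hr : Measurable r)
    (hM : ∀ z, |r z| ≤ M) {u : BeliefState K L Ω → ℝ} (hu : Measurable u) {C : ℝ}
    (hC : ∀ s, |u s| ≤ C)
    (h : ∀ m, ∀ᵐ h ∂(Γ.law w σ τ),
      u (h m).1 ≤ lam * r (h m) + (1 - lam) * ∫ s, u s ∂(Γ.transition (h m))) :
    u w ≤ ∫ h, ∑' m : ℕ, lam * (1 - lam) ^ m * r (h m) ∂(Γ.law w σ τ) := by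
  have hlam1 : 0 ≤ 1 - lam := sub_nonneg.2 hlam'
  have hsum := Γ.hasSum_integral_discounted w σ τ hlam hlam' hr hM
  let a : ℕ → ℝ := fun m => ∫ h, u (h m).1 ∂(Γ.law w σ τ)
  have hs : Measurable fun z : Stage K L Ω I J => ∫ s, u s ∂(Γ.transition z) :=
    (StronglyMeasurable.integral_kernel_prod_right' (κ := Γ.transition)
      (f := fun z : Stage K L Ω I J × BeliefState K L Ω => u z.2)
      (hu.comp measurable_snd).stronglyMeasurable).measurable
  have hstep : ∀ m, a m ≤ lam * (∫ h, r (h m) ∂(Γ.law w σ τ)) + (1 - lam) * a (m + 1) := by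
    intro m
    have i1 : Integrable (fun h => u (h m).1) (Γ.law w σ τ) :=
      .of_bound (hu.comp (measurable_fst.comp (measurable_pi_apply m))).aestronglyMeasurable C
        (.of_forall fun h => hC _)
    have i2 : Integrable (fun h => r (h m)) (Γ.law w σ τ) :=
      .of_bound (hr.comp (measurable_pi_apply m)).aestronglyMeasurable M
        (.of_forall fun h => hM _)
    have i3 : Integrable (fun h => ∫ s, u s ∂(Γ.transition (h m))) (Γ.law w σ τ) :=
      .of_bound (hs.comp (measurable_pi_apply m)).aestronglyMeasurable C
        (.of_forall fun h => by
          refine (norm_integral_le_of_norm_le_const (.of_forall hC)).trans_eq ?_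
          simp)
    have := integral_mono_ae i1 ((i2.const_mul lam).add (i3.const_mul (1 - lam))) (h m)
    rw [integral_add' (i2.const_mul lam) (i3.const_mul (1 - lam)), integral_const_mul,
      integral_const_mul, ← Γ.integral_law_succ w σ τ m hu hC] at this
    exact this
  have h0 : a 0 = u w := by
    have : a 0 = ∫ _, u w ∂(Γ.law w σ τ) := by
      refine integral_congr_ae ?_
      filter_upwards [Γ.ae_law_zero w σ τ] with h hh
      rw [hh]
    simpa using this
  -- The inequality is unfolded over `n` stages; the remainder vanishes in the limit because `u` is
  -- bounded.
  have hn : ∀ n, u w ≤ (∑ m ∈ Finset.range n,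
      lam * (1 - lam) ^ m * ∫ h, r (h m) ∂(Γ.law w σ τ)) + (1 - lam) ^ n * a n := by
    intro n
    induction n with
    | zero => simp [h0]
    | succ n ih =>
      rw [Finset.sum_range_succ, pow_succ]
      have := mul_le_mul_of_nonneg_left (hstep n) (pow_nonneg hlam1 n)
      linarith
  have hz : Filter.Tendsto (fun n => (1 - lam) ^ n * a n) Filter.atTop (nhds 0) := by
    have hp := (tendsto_pow_atTop_nhds_zero_of_lt_one hlam1 (by linarith)).mul_const C
    rw [zero_mul] at hp
    refine squeeze_zero_norm (fun n => ?_) hp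
    rw [norm_mul, norm_pow, Real.norm_of_nonneg hlam1]
    refine mul_le_mul_of_nonneg_left ?_ (pow_nonneg hlam1 n)
    refine (norm_integral_le_of_norm_le_const (.of_forall fun h => hC _)).trans_eq ?_
    simp
  have := hsum.tendsto_sum_nat.add hz
  rw [add_zero] at this
  exact ge_of_tendsto' this hn

end discounted

/-- If along the play the expected variation of the state is dominated by the expected increase of
a function bounded by `1`, then the expected total variation is bounded. -/
theorem lintegral_tsum_le_of_ae_le {D : Stage K L Ω I J → BeliefState K L Ω → ENNReal}
    (hD : Measurable (Function.uncurry D)) {q : BeliefState K L Ω → ENNReal} (hq : Measurable q)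
    (hq1 : ∀ s, q s ≤ 1) {C : ENNReal}
    (h : ∀ m, ∀ᵐ h ∂(Γ.law w σ τ), ∫⁻ s, D (h m) s ∂(Γ.transition (h m)) + C * q (h m).1 ≤
      C * ∫⁻ s, q s ∂(Γ.transition (h m))) :
    ∫⁻ h, ∑' m : ℕ, D (h m) (h (m + 1)).1 ∂(Γ.law w σ τ) ≤ C := by
  have hDm : ∀ m, Measurable fun h : ℕ → Stage K L Ω I J => D (h m) (h (m + 1)).1 := fun m =>
    hD.comp (f := fun h : ℕ → Stage K L Ω I J => (h m, (h (m + 1)).1)) (by fun_prop)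
  rw [lintegral_tsum fun m => (hDm m).aemeasurable]
  have hqm : ∀ m, Measurable fun h : ℕ → Stage K L Ω I J => q (h m).1 := fun m =>
    hq.comp (by fun_prop)
  -- Telescoping without subtraction, as required in `ENNReal`: the expected variation so far is at
  -- most `C` times the current expectation of `q`.
  have hn : ∀ n, (∑ m ∈ Finset.range n, ∫⁻ h, D (h m) (h (m + 1)).1 ∂(Γ.law w σ τ)) ≤
      C * ∫⁻ h, q (h n).1 ∂(Γ.law w σ τ) := by
    intro n
    induction n with
    | zero => simp
    | succ n ih =>
      rw [Finset.sum_range_succ]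
      refine (add_le_add_left ih _).trans ?_
      rw [Γ.lintegral_law_succ w σ τ n hD, Γ.lintegral_law_succ w σ τ n (f := fun _ s => q s)
        (hq.comp measurable_snd), ← lintegral_const_mul _ (hqm n), ← lintegral_const_mul,
        ← lintegral_add_left ((hqm n).const_mul C)]
      · refine lintegral_mono_ae ?_
        filter_upwards [h n] with z hz
        rw [add_comm]
        exact hz
      · exact (Measurable.lintegral_kernel_prod_right' (κ := Γ.transition)
          (f := fun z : Stage K L Ω I J × BeliefState K L Ω => q z.2)
          (hq.comp measurable_snd)).comp (measurable_pi_apply n)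
  refine ENNReal.tsum_le_of_sum_range_le fun n => (hn n).trans ?_
  calc C * ∫⁻ h, q (h n).1 ∂(Γ.law w σ τ) ≤ C * 1 := by
        gcongr
        refine (lintegral_mono fun h => hq1 _).trans_eq ?_
        simp
    _ = C := mul_one C

end IncompleteInfoGame

/-! ### Merging actions -/

section merge

variable {T A : Type*} [Fintype T]

open Classical in
/-- The joint measure obtained from `a` when each action in `S` is redrawn in `S`, independently of
the type, according to its total mass. -/
noncomputable def mergeForm (S : Finset A) (a : A → T → ℝ) (i : A) : T → ℝ :=
  if i ∈ S then ((∑ k, a i k) / ∑ i' ∈ S, ∑ k, a i' k) • ∑ i' ∈ S, a i' else a i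

variable {S : Finset A} {a : A → T → ℝ}

theorem mergeForm_of_mem {i : A} (hi : i ∈ S) :
    mergeForm S a i = ((∑ k, a i k) / ∑ i' ∈ S, ∑ k, a i' k) • ∑ i' ∈ S, a i' := if_pos hi

theorem mergeForm_of_notMem {i : A} (hi : i ∉ S) : mergeForm S a i = a i := if_neg hi

theorem eq_zero_of_sum_eq_zero (ha : 0 ≤ a) (hS : ∑ i ∈ S, ∑ k, a i k = 0) {i : A} (hi : i ∈ S) :
    a i = 0 := by
  have h := (Finset.sum_eq_zero_iff_of_nonneg
    fun i _ => Finset.sum_nonneg fun k _ => ha i k).1 hS i hi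
  funext k
  exact (Finset.sum_eq_zero_iff_of_nonneg fun k _ => ha i k).1 h k (Finset.mem_univ k)

/-- The degenerate case: a class of total mass zero has zero rows, so dividing by that mass changes
nothing. -/
theorem mergeForm_of_sum_eq_zero (ha : 0 ≤ a) (hS : ∑ i ∈ S, ∑ k, a i k = 0) :
    mergeForm S a = a := by
  funext i
  by_cases hi : i ∈ S
  · rw [mergeForm_of_mem hi, hS, div_zero, zero_smul, eq_zero_of_sum_eq_zero ha hS hi]
  · exact mergeForm_of_notMem hi

theorem mergeForm_nonneg (ha : 0 ≤ a) : 0 ≤ mergeForm S a := by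
  intro i
  by_cases hi : i ∈ S
  · rw [mergeForm_of_mem hi]
    exact smul_nonneg (div_nonneg (Finset.sum_nonneg fun k _ => ha i k)
      (Finset.sum_nonneg fun i _ => Finset.sum_nonneg fun k _ => ha i k))
      (Finset.sum_nonneg fun i _ => ha i)
  · rw [mergeForm_of_notMem hi]
    exact ha i

theorem sum_weights (hS : ∑ i ∈ S, ∑ k, a i k ≠ 0) :
    ∑ i ∈ S, (∑ k, a i k) / ∑ i' ∈ S, ∑ k, a i' k = 1 := by
  rw [← Finset.sum_div, div_self hS]

theorem sum_mergeForm [Fintype A] (ha : 0 ≤ a) : ∑ i, mergeForm S a i = ∑ i, a i := by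
  classical
  by_cases hS : ∑ i ∈ S, ∑ k, a i k = 0
  · rw [mergeForm_of_sum_eq_zero ha hS]
  rw [← Finset.sum_add_sum_compl S, ← Finset.sum_add_sum_compl S a]
  congr 1
  · rw [Finset.sum_congr rfl fun i hi => mergeForm_of_mem hi, ← Finset.sum_smul, sum_weights hS,
      one_smul]
  · exact Finset.sum_congr rfl fun i hi => mergeForm_of_notMem (Finset.mem_compl.1 hi)

/-- Merging leaves the law of the action unchanged. Only the information it carries is altered, so
the law of the next state in `Ω` is unaffected. -/
theorem sum_apply_mergeForm (ha : 0 ≤ a) (i : A) : ∑ k, mergeForm S a i k = ∑ k, a i k := by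
  by_cases hS : ∑ i ∈ S, ∑ k, a i k = 0
  · rw [mergeForm_of_sum_eq_zero ha hS]
  by_cases hi : i ∈ S
  · rw [mergeForm_of_mem hi]
    simp only [Pi.smul_apply, smul_eq_mul, Finset.sum_apply, ← Finset.mul_sum]
    have h : ∑ k, ∑ i ∈ S, a i k = ∑ i ∈ S, ∑ k, a i k := Finset.sum_comm
    rw [h, div_mul_cancel₀ _ hS]
  · rw [mergeForm_of_notMem hi]

theorem mergeForm_univ [Fintype A] {p : T → ℝ} (ha : a ∈ splittings A p) (hp : ∑ k, p k = 1) (i : A) :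
    mergeForm Finset.univ a i = (∑ k, a i k) • p := by
  rw [mergeForm_of_mem (Finset.mem_univ i), sum_splittings ha, hp, div_one]
  congr 1
  funext k
  rw [Finset.sum_apply, ha.2 k]

/-- How far the belief moves, on the event that the action is `i`. -/
def deviation (p : T → ℝ) (a : A → T → ℝ) (i : A) : ℝ := ∑ k, |a i k - (∑ k', a i k') * p k|

theorem deviation_nonneg (p : T → ℝ) (a : A → T → ℝ) (i : A) : 0 ≤ deviation p a i :=
  Finset.sum_nonneg fun _ _ => abs_nonneg _

theorem deviation_le_two {p : T → ℝ} (hp : 0 ≤ p) (hp1 : ∑ k, p k = 1) (ha : 0 ≤ a) (i : A) :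
    deviation p a i ≤ 2 * ∑ k, a i k := by
  have hm : 0 ≤ ∑ k, a i k := Finset.sum_nonneg fun k _ => ha i k
  calc deviation p a i ≤ ∑ k, (a i k + (∑ k', a i k') * p k) := by
        refine Finset.sum_le_sum fun k _ => ?_
        have h1 := ha i k
        have h2 := mul_nonneg hm (hp k)
        simp only [Pi.zero_apply] at h1
        rw [abs_le]
        constructor <;> linarith
    _ = 2 * ∑ k, a i k := by
        rw [Finset.sum_add_distrib, ← Finset.mul_sum, hp1]
        ring

/-- After merging the actions in `S`, the belief moves by the average of the former moves. -/
theorem deviation_mergeForm {p : T → ℝ} (ha : 0 ≤ a) (hS : ∑ i ∈ S, ∑ k, a i k ≠ 0) {i : A}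
    (hi : i ∈ S) : deviation p (mergeForm S a) i = (∑ k, a i k) / (∑ i' ∈ S, ∑ k, a i' k) *
      ∑ k, |∑ i' ∈ S, (a i' k - (∑ k', a i' k') * p k)| := by
  have hw : 0 ≤ (∑ k, a i k) / (∑ i' ∈ S, ∑ k, a i' k) :=
    div_nonneg (Finset.sum_nonneg fun k _ => ha i k)
      (Finset.sum_nonneg fun i _ => Finset.sum_nonneg fun k _ => ha i k)
  unfold deviation
  rw [sum_apply_mergeForm ha, mergeForm_of_mem hi, Finset.mul_sum]
  refine Finset.sum_congr rfl fun k _ => ?_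
  rw [← abs_of_nonneg hw, ← abs_mul, abs_of_nonneg hw]
  congr 1
  rw [Finset.sum_sub_distrib, ← Finset.sum_mul]
  simp only [Pi.smul_apply, Finset.sum_apply, smul_eq_mul]
  field_simp

/-- Merged actions share one posterior, an average of the former ones; the triangle inequality
applies. -/
theorem deviation_mergeForm_le {p : T → ℝ} (ha : 0 ≤ a) {δ : ℝ}
    (h : ∀ i ∈ S, deviation p a i ≤ δ * ∑ k, a i k) {i : A} (hi : i ∈ S) :
    deviation p (mergeForm S a) i ≤ δ * ∑ k, a i k := by
  by_cases hS : ∑ i ∈ S, ∑ k, a i k = 0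
  · rw [mergeForm_of_sum_eq_zero ha hS]
    exact h i hi
  have hw : 0 ≤ (∑ k, a i k) / (∑ i' ∈ S, ∑ k, a i' k) :=
    div_nonneg (Finset.sum_nonneg fun k _ => ha i k)
      (Finset.sum_nonneg fun i _ => Finset.sum_nonneg fun k _ => ha i k)
  rw [deviation_mergeForm ha hS hi]
  have h1 : ∑ k, |∑ i' ∈ S, (a i' k - (∑ k', a i' k') * p k)| ≤
      δ * ∑ i' ∈ S, ∑ k, a i' k := by
    calc _ ≤ ∑ k, ∑ i' ∈ S, |a i' k - (∑ k', a i' k') * p k| :=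
          Finset.sum_le_sum fun k _ => Finset.abs_sum_le_sum_abs _ _
      _ = ∑ i' ∈ S, deviation p a i' := Finset.sum_comm
      _ ≤ ∑ i' ∈ S, δ * ∑ k, a i' k := Finset.sum_le_sum h
      _ = _ := (Finset.mul_sum _ _ _).symm
  refine (mul_le_mul_of_nonneg_left h1 hw).trans_eq ?_
  field_simp

/-- Within `S`, the old and the new rows both lie within `δ` times the mass of the action from the
uninformative row `(∑ k, a i k) • p`, whence the factor 2. -/
theorem sum_abs_mergeForm_sub_le {p : T → ℝ} (ha : 0 ≤ a) {δ : ℝ} (hδ : 0 ≤ δ)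
    (h : ∀ i ∈ S, deviation p a i ≤ δ * ∑ k, a i k) (i : A) :
    ∑ k, |mergeForm S a i k - a i k| ≤ 2 * δ * ∑ k, a i k := by
  have hm : 0 ≤ ∑ k, a i k := Finset.sum_nonneg fun k _ => ha i k
  by_cases hi : i ∈ S
  · have h1 := deviation_mergeForm_le ha h hi
    have h2 := h i hi
    unfold deviation at h1 h2
    rw [sum_apply_mergeForm ha] at h1
    calc ∑ k, |mergeForm S a i k - a i k| ≤
        ∑ k, (|mergeForm S a i k - (∑ k', a i k') * p k| + |a i k - (∑ k', a i k') * p k|) := by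
          refine Finset.sum_le_sum fun k _ => ?_
          rw [abs_sub_comm (a i k)]
          exact abs_sub_le _ _ _
      _ ≤ 2 * δ * ∑ k, a i k := by
          rw [Finset.sum_add_distrib]
          linarith
  · rw [mergeForm_of_notMem hi]
    simp only [sub_self, abs_zero, Finset.sum_const_zero]
    positivity

/-- If the actions outside `S` are those that move the belief by more than `δ`, then after merging
`S` the expected move is controlled by the big moves. -/
theorem sum_deviation_mergeForm_le [Fintype A] [DecidableEq A] {p : T → ℝ} (ha : a ∈ splittings A p)
    (hp1 : ∑ k, p k = 1) :
    ∑ i, deviation p (mergeForm S a) i ≤ 2 * ∑ i ∈ Sᶜ, deviation p (mergeForm S a) i := by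
  have ha0 : 0 ≤ a := splittings_nonneg ha
  have hc : ∀ i ∈ Sᶜ, deviation p (mergeForm S a) i = deviation p a i := fun i hi => by
    unfold deviation
    rw [mergeForm_of_notMem (Finset.mem_compl.1 hi)]
  rw [← Finset.sum_add_sum_compl S, two_mul]
  refine add_le_add ?_ le_rfl
  by_cases hS : ∑ i ∈ S, ∑ k, a i k = 0
  · refine le_trans (le_of_eq ?_) (Finset.sum_nonneg fun i _ => deviation_nonneg _ _ _)
    refine Finset.sum_eq_zero fun i hi => ?_
    rw [mergeForm_of_sum_eq_zero ha0 hS]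
    simp [deviation, eq_zero_of_sum_eq_zero ha0 hS hi]
  rw [Finset.sum_congr rfl fun i hi => deviation_mergeForm ha0 hS hi, ← Finset.sum_mul,
    sum_weights hS, one_mul, Finset.sum_congr rfl hc]
  -- Beliefs form a martingale: the signed moves sum to zero, so those in `S` are balanced by those
  -- outside.
  have h0 : ∀ k, ∑ i ∈ S, (a i k - (∑ k', a i k') * p k) =
      -∑ i ∈ Sᶜ, (a i k - (∑ k', a i k') * p k) := fun k => by
    rw [eq_neg_iff_add_eq_zero, Finset.sum_add_sum_compl, Finset.sum_sub_distrib, ← Finset.sum_mul,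
      sum_splittings ha, hp1, ha.2 k]
    ring
  simp only [h0, abs_neg]
  calc _ ≤ ∑ k, ∑ i ∈ Sᶜ, |a i k - (∑ k', a i k') * p k| :=
        Finset.sum_le_sum fun k _ => Finset.abs_sum_le_sum_abs _ _
    _ = _ := Finset.sum_comm

end merge

/-! ### Loss caused by merging -/

section loss

variable {K L Ω I J : Type*} [Fintype K] [Fintype L] [Fintype Ω] [Fintype I] [Fintype J]

omit [Fintype I] in
theorem IsHalfSaddle.sum_le {M : ℝ} {F : (K → ℝ) → (L → ℝ) → ℝ} (hF : IsHalfSaddle M F)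
    (S : Finset I) {a : I → K → ℝ} (ha : 0 ≤ a) {θ : L → ℝ} (hθ : 0 ≤ θ) :
    ∑ i ∈ S, F (a i) θ ≤ F (∑ i ∈ S, a i) θ := by
  classical
  induction S using Finset.induction_on with
  | empty =>
    have := hF.smul 0 0 θ le_rfl le_rfl hθ
    simp only [zero_smul, zero_mul] at this
    simp [this]
  | insert i S hi ih =>
    rw [Finset.sum_insert hi, Finset.sum_insert hi]
    exact (add_le_add_right ih _).trans
      (hF.superadd _ _ θ (ha i) (Finset.sum_nonneg fun i _ => ha i) hθ)

/-- Jensen's inequality: the merged rows are proportional, hence their values add up, by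
homogeneity, to the value of the sum, which superadditivity compares with the separate rows. -/
theorem IsHalfSaddle.sum_le_mergeForm {M : ℝ} {F : (K → ℝ) → (L → ℝ) → ℝ} (hF : IsHalfSaddle M F)
    (S : Finset I) {a : I → K → ℝ} (ha : 0 ≤ a) {θ : L → ℝ} (hθ : 0 ≤ θ) :
    ∑ i, F (a i) θ ≤ ∑ i, F (mergeForm S a i) θ := by
  classical
  by_cases hS : ∑ i ∈ S, ∑ k, a i k = 0
  · rw [mergeForm_of_sum_eq_zero ha hS]
  rw [← Finset.sum_add_sum_compl S, ← Finset.sum_add_sum_compl S fun i => F (mergeForm S a i) θ]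
  refine add_le_add ?_ (Finset.sum_congr rfl fun i hi => by
    rw [mergeForm_of_notMem (Finset.mem_compl.1 hi)]).le
  refine (hF.sum_le S ha hθ).trans_eq ?_
  have h : ∀ i ∈ S, F (mergeForm S a i) θ =
      (∑ k, a i k) / (∑ i' ∈ S, ∑ k, a i' k) * F (∑ i ∈ S, a i) θ := fun i hi => by
    rw [mergeForm_of_mem hi, hF.smul _ _ _ (div_nonneg (Finset.sum_nonneg fun k _ => ha i k)
      (Finset.sum_nonneg fun i _ => Finset.sum_nonneg fun k _ => ha i k))
      (Finset.sum_nonneg fun i _ => ha i) hθ]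
  rw [Finset.sum_congr rfl h, ← Finset.sum_mul, sum_weights hS, one_mul]

variable {M : ℝ} {g : K → L → I → J → ℝ} {ρ : I → J → Ω → ℝ}
  {F : Ω → (K → ℝ) → (L → ℝ) → ℝ} {a a' : I → K → ℝ} {b : J → L → ℝ}

/-- The loss in the continuation payoff when less information is revealed comes from the
transitions that leave the current state `v`. -/
theorem continuationForm_le_of_sum_le (hM : 0 ≤ M) (hρ : ∀ i j w, 0 ≤ ρ i j w)
    (hρ' : ∀ i j, ∑ w, ρ i j w = 1) (hF : ∀ w, IsHalfSaddle M (F w)) (ha : 0 ≤ a) (ha' : 0 ≤ a')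
    (hb : 0 ≤ b) {v : Ω} {κ : ℝ} (hdev : ∀ i, ∑ k, |a' i k - a i k| ≤ κ * ∑ k, a i k)
    (hsum : ∀ j, ∑ i, F v (a i) (b j) ≤ ∑ i, F v (a' i) (b j)) :
    continuationForm ρ F a b ≤ continuationForm ρ F a' b +
      2 * M * κ * ∑ i, ∑ j, (∑ k, a i k) * (∑ l, b j l) * (1 - ρ i j v) := by
  classical
  have hb' : ∀ j, 0 ≤ ∑ l, b j l := fun j => Finset.sum_nonneg fun l _ => hb j l
  have hd : ∀ i j w, |F w (a i) (b j) - F w (a' i) (b j)| ≤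
      M * κ * ((∑ k, a i k) * ∑ l, b j l) := fun i j w => by
    refine ((hF w).abs_sub_le (ha i) (ha' i) (hb j)).trans ?_
    have := mul_le_mul_of_nonneg_left (mul_le_mul_of_nonneg_right (hdev i) (hb' j)) hM
    simp only [abs_sub_comm (a i _)]
    linarith
  have key : ∀ i j, ∑ w, ρ i j w * F w (a i) (b j) ≤ ∑ w, ρ i j w * F w (a' i) (b j) +
      (F v (a i) (b j) - F v (a' i) (b j)) +
      2 * M * κ * ((∑ k, a i k) * (∑ l, b j l) * (1 - ρ i j v)) := by
    intro i j
    set B := M * κ * ((∑ k, a i k) * ∑ l, b j l) with hB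
    -- The loss in each state is at most `B`. Keeping the loss in `v` with full weight one, rather
    -- than `ρ i j v`, costs another `B * (1 - ρ i j v)`; hence the factor 2. The full-weight term
    -- is then disposed of by `hsum`, after summation over `i`.
    have h1 : ∑ w, ρ i j w * (F w (a i) (b j) - F w (a' i) (b j) - B) ≤
        ρ i j v * (F v (a i) (b j) - F v (a' i) (b j) - B) := by
      rw [← Finset.add_sum_erase _ _ (Finset.mem_univ v)]
      have : ∑ w ∈ Finset.univ.erase v, ρ i j w * (F w (a i) (b j) - F w (a' i) (b j) - B) ≤ 0 :=
        Finset.sum_nonpos fun w _ => mul_nonpos_of_nonneg_of_nonpos (hρ i j w)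
          (by linarith [(abs_le.1 (hd i j w)).2])
      linarith
    simp only [mul_sub, Finset.sum_sub_distrib, ← Finset.sum_mul, hρ' i j] at h1
    have h2 : 0 ≤ 1 - ρ i j v := by
      rw [sub_nonneg, ← hρ' i j]
      exact Finset.single_le_sum (fun w _ => hρ i j w) (Finset.mem_univ v)
    have h3 := mul_le_mul_of_nonneg_left (abs_le.1 (hd i j v)).1 h2
    rw [← hB] at h3
    have e : 2 * M * κ * ((∑ k, a i k) * (∑ l, b j l) * (1 - ρ i j v)) = 2 * B * (1 - ρ i j v) := by
      rw [hB]; ring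
    rw [e]
    nlinarith [h1, h3]
  unfold continuationForm
  have h := Finset.sum_le_sum fun i (_ : i ∈ Finset.univ) =>
    Finset.sum_le_sum fun j (_ : j ∈ Finset.univ) => key i j
  simp only [Finset.sum_add_distrib, Finset.sum_sub_distrib, ← Finset.mul_sum] at h
  have h4 : ∑ i, ∑ j, F v (a i) (b j) ≤ ∑ i, ∑ j, F v (a' i) (b j) := by
    rw [Finset.sum_comm, Finset.sum_comm (γ := I)]
    exact Finset.sum_le_sum fun j _ => hsum j
  linarith

/-- If the payoff does not depend on the actions, then the stage payoff depends only on the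
marginal on types. -/
theorem stageForm_congr {c : K → L → ℝ} (hg : ∀ k l i j, g k l i j = c k l) {p : K → ℝ}
    (ha : a ∈ splittings I p) (ha' : a' ∈ splittings I p) : stageForm g a b = stageForm g a' b := by
  have h : ∀ a ∈ splittings I p, stageForm g a b = ∑ j, ∑ k, ∑ l, c k l * p k * b j l := by
    intro a ha
    unfold stageForm
    simp only [hg]
    rw [Finset.sum_comm]
    refine Finset.sum_congr rfl fun j _ => ?_
    rw [Finset.sum_comm]
    refine Finset.sum_congr rfl fun k _ => ?_
    rw [Finset.sum_comm]
    refine Finset.sum_congr rfl fun l _ => ?_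
    rw [← Finset.sum_mul, ← Finset.mul_sum, ha.2 k]
  rw [h a ha, h a' ha']

variable {lam : ℝ}

theorem mergeForm_mem_splittings {p : K → ℝ} (ha : a ∈ splittings I p) (S : Finset I) :
    mergeForm S a ∈ splittings I p := by
  have ha0 : 0 ≤ a := splittings_nonneg ha
  refine ⟨fun i k => mergeForm_nonneg ha0 i k, fun k => ?_⟩
  have := congrFun (sum_mergeForm (S := S) ha0) k
  rwa [Finset.sum_apply, Finset.sum_apply, ha.2 k] at this

/-- The loss in the one-shot game with continuation payoff `F` when the actions in `S` are merged:
it comes from the stage payoff, and from the transitions that leave the current state `v`. -/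
theorem shapley_le_mergeForm (hM : 0 ≤ M) (hlam : 0 ≤ lam) (hlam' : lam ≤ 1)
    (hρ : ∀ i j w, 0 ≤ ρ i j w)
    (hρ' : ∀ i j, ∑ w, ρ i j w = 1) (hF : ∀ w, IsHalfSaddle M (F w)) {p : K → ℝ} {q : L → ℝ}
    (hp1 : ∑ k, p k = 1) (hq1 : ∑ l, q l = 1) (ha : a ∈ splittings I p) (hb : b ∈ splittings J q)
    (v : Ω) {c : ℝ}
    (hg : ∀ k l i j, |g k l i j| ≤ M)
    (hc : c = 1 ∨ c = 0 ∧ ∃ c' : K → L → ℝ, ∀ k l i j, g k l i j = c' k l)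
    {κ : ℝ} (hκ : 0 ≤ κ) {S : Finset I}
    (hdev : ∀ i, ∑ k, |mergeForm S a i k - a i k| ≤ κ * ∑ k, a i k) :
    shapley lam ρ g F a b ≤ shapley lam ρ g F (mergeForm S a) b + 2 * κ * M *
      (lam * c + (1 - lam) * ∑ i, ∑ j, (∑ k, a i k) * (∑ l, b j l) * (1 - ρ i j v)) := by
  have ha0 : 0 ≤ a := splittings_nonneg ha
  have hb0 : 0 ≤ b := splittings_nonneg hb
  have h1 := continuationForm_le_of_sum_le (ρ := ρ) hM hρ hρ' hF ha0 (mergeForm_nonneg ha0) hb0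
    (v := v) hdev fun j => (hF v).sum_le_mergeForm S ha0 (hb0 j)
  -- The number `c` switches off the stage loss where payoffs do not depend on actions, as in
  -- absorbing states. When `c = 1`, the cruder factor 2 matches the continuation loss.
  have h2 : stageForm g a b ≤ stageForm g (mergeForm S a) b + 2 * κ * M * c := by
    rcases hc with rfl | ⟨rfl, c', hc'⟩
    · have h3 := (abs_le.1 (abs_stageForm_le (a := mergeForm S a - a) hg hb0)).1
      rw [stageForm_sub, sum_splittings hb, hq1, mul_one] at h3
      have h4 : ∑ i, ∑ k, |(mergeForm S a - a) i k| ≤ κ := by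
        refine (Finset.sum_le_sum fun i _ => hdev i).trans_eq ?_
        rw [← Finset.mul_sum, sum_splittings ha, hp1, mul_one]
      have h5 := mul_le_mul_of_nonneg_left h4 hM
      nlinarith [mul_nonneg hκ hM]
    · rw [stageForm_congr hc' ha (mergeForm_mem_splittings ha S)]
      simp
  unfold shapley
  have h3 := mul_le_mul_of_nonneg_left h1 (sub_nonneg.2 hlam')
  have h4 := mul_le_mul_of_nonneg_left h2 hlam
  linarith

end loss

/-! ### Blurred actions -/

section blur

variable {T A : Type*} [Fintype T] [Fintype A]

open Classical in
/-- Redraw each action in `S` in `S`, independently of the type. -/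
noncomputable def mergeAction (S : Finset A) (p : stdSimplex ℝ T) (x : MixedAction T A) :
    MixedAction T A := fun k =>
  if h : ∑ i ∈ S, meanAction p x i = 0 then x k
  else ⟨fun i => if i ∈ S then
      meanAction p x i / (∑ i' ∈ S, meanAction p x i') * ∑ i' ∈ S, x k i' else x k i, by
    refine ⟨fun i => ?_, ?_⟩
    · beta_reduce
      split_ifs
      · exact mul_nonneg (div_nonneg (meanAction_nonneg _ _ _)
          (Finset.sum_nonneg fun i _ => meanAction_nonneg _ _ _))
          (Finset.sum_nonneg fun i _ => (x k).2.1 i)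
      · exact (x k).2.1 i
    · rw [← Finset.sum_add_sum_compl S, Finset.sum_congr rfl fun i hi => if_pos hi,
        Finset.sum_congr rfl fun i hi => if_neg (Finset.mem_compl.1 hi), ← Finset.sum_mul,
        ← Finset.sum_div, div_self h, one_mul, Finset.sum_add_sum_compl]
      exact (x k).2.2⟩

open Classical in
theorem mergeAction_apply (S : Finset A) (p : stdSimplex ℝ T) (x : MixedAction T A) (k : T)
    (i : A) : mergeAction S p x k i = if ∑ i ∈ S, meanAction p x i = 0 then x k i
      else if i ∈ S then meanAction p x i / (∑ i' ∈ S, meanAction p x i') * ∑ i' ∈ S, x k i'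
      else x k i := by
  unfold mergeAction
  split_ifs <;> first | rfl | exact if_pos ‹_› | exact if_neg ‹_›

theorem reweight_mergeAction (S : Finset A) (p : stdSimplex ℝ T) (x : MixedAction T A) :
    reweight (mergeAction S p x) p = mergeForm S (reweight x p) := by
  classical
  by_cases hS : ∑ i ∈ S, meanAction p x i = 0
  · rw [mergeForm_of_sum_eq_zero (reweight_nonneg x (stdSimplex_coe_nonneg p))
      (by simpa only [sum_reweight] using hS)]
    funext i k
    simp only [reweight]
    rw [mergeAction_apply, if_pos hS]
  · funext i k
    change mergeAction S p x k i * p k = _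
    rw [mergeAction_apply, if_neg hS]
    by_cases hi : i ∈ S
    · rw [if_pos hi, mergeForm_of_mem hi]
      simp only [sum_reweight, Pi.smul_apply, Finset.sum_apply, smul_eq_mul]
      simp only [reweight]
      rw [← Finset.sum_mul, mul_assoc]
    · rw [if_neg hi, mergeForm_of_notMem hi]
      rfl

/-- Play `x` with probability `1 - ε` and `y` with probability `ε`. -/
def mixAction (ε : ℝ) (hε : ε ∈ Set.Icc (0 : ℝ) 1) (x y : MixedAction T A) : MixedAction T A :=
  fun k => ⟨fun i => (1 - ε) * x k i + ε * y k i, by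
    refine ⟨fun i => add_nonneg (mul_nonneg (sub_nonneg.2 hε.2) ((x k).2.1 i))
      (mul_nonneg hε.1 ((y k).2.1 i)), ?_⟩
    rw [Finset.sum_add_distrib, ← Finset.mul_sum, ← Finset.mul_sum, stdSimplex.sum_eq_one,
      stdSimplex.sum_eq_one]
    ring⟩

/-- The actions that move the belief by at most `ε`. -/
noncomputable def smallMoves (ε : ℝ) (p : stdSimplex ℝ T) (x : MixedAction T A) : Finset A :=
  Finset.univ.filter fun i => deviation p (reweight x p) i ≤ ε * meanAction p x i

/-- A version of `x` that reveals less information: the small moves of the belief are merged, and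
with probability `ε` nothing is revealed. -/
noncomputable def blurAction (ε : ℝ) (hε : ε ∈ Set.Icc (0 : ℝ) 1) (p : stdSimplex ℝ T)
    (x : MixedAction T A) : MixedAction T A :=
  mixAction ε hε (mergeAction (smallMoves ε p x) p x) (mergeAction Finset.univ p x)

variable {ε : ℝ} (hε : ε ∈ Set.Icc (0 : ℝ) 1) (p : stdSimplex ℝ T) (x : MixedAction T A)

theorem reweight_blurAction : reweight (blurAction ε hε p x) p =
    (1 - ε) • mergeForm (smallMoves ε p x) (reweight x p) +
      ε • mergeForm Finset.univ (reweight x p) := by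
  rw [← reweight_mergeAction, ← reweight_mergeAction]
  funext i k
  change ((1 - ε) * _ + ε * _) * p k = (1 - ε) * (_ * p k) + ε * (_ * p k)
  ring

theorem reweight_blurAction_apply (i : A) (k : T) : reweight (blurAction ε hε p x) p i k =
    (1 - ε) * mergeForm (smallMoves ε p x) (reweight x p) i k + ε * (meanAction p x i * p k) := by
  rw [reweight_blurAction]
  simp only [Pi.add_apply, Pi.smul_apply, smul_eq_mul]
  rw [mergeForm_univ (reweight_mem_splittings x (stdSimplex_coe_nonneg p)) p.2.2, sum_reweight]
  rfl

/-- Both components of the mixture have the same law of actions as `x`, so the transition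
probabilities between states survive blurring. -/
theorem meanAction_blurAction (i : A) :
    meanAction p (blurAction ε hε p x) i = meanAction p x i := by
  have h1 : ∑ k, (p : T → ℝ) k = 1 := p.2.2
  rw [← sum_reweight, Finset.sum_congr rfl fun k _ => reweight_blurAction_apply hε p x i k,
    Finset.sum_add_distrib, ← Finset.mul_sum, ← Finset.mul_sum, ← Finset.mul_sum,
    sum_apply_mergeForm (reweight_nonneg x (stdSimplex_coe_nonneg p)), sum_reweight,
    stdSimplex.sum_eq_one]
  ring

/-- The fully merged component alone contributes `ε * meanAction p x i * p k` to the joint mass, so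
the posterior is at least `ε * p k`. -/
theorem isAmbiguousAt_blurAction : IsAmbiguousAt ε (blurAction ε hε p x) p := by
  intro k i
  have hmin : ⨅ k', p k' ≤ p k := ciInf_le (Set.finite_range _).bddBelow k
  rw [posteriorBelief_apply]
  split_ifs with h
  · calc ε * (⨅ k', p k') ≤ ε * p k := mul_le_mul_of_nonneg_left hmin hε.1
      _ ≤ 1 * p k := mul_le_mul_of_nonneg_right hε.2 (p.2.1 k)
      _ = p k := one_mul _
  · rw [meanAction_blurAction] at h ⊢
    have hpos : 0 < meanAction p x i := lt_of_le_of_ne (meanAction_nonneg p x i) (Ne.symm h)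
    rw [le_div_iff₀ hpos]
    have h1 := reweight_blurAction_apply hε p x i k
    have h2 := mul_nonneg (sub_nonneg.2 hε.2) (mergeForm_nonneg (S := smallMoves ε p x)
      (reweight_nonneg x (stdSimplex_coe_nonneg p)) i k)
    have h3 := mul_le_mul_of_nonneg_left (mul_le_mul_of_nonneg_left hmin hε.1) hpos.le
    change blurAction ε hε p x k i * p k = _ at h1
    rw [h1]
    linarith

theorem measurable_mergeAction (S : Finset A) :
    Measurable fun z : stdSimplex ℝ T × MixedAction T A => mergeAction S z.1 z.2 := by
  classical
  refine measurable_pi_lambda _ fun k => Measurable.subtype_mk (f := fun z : stdSimplex ℝ T ×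
    MixedAction T A => (mergeAction S z.1 z.2 k).1) (measurable_pi_lambda _ fun i => ?_)
  have hx : ∀ i, Measurable fun z : stdSimplex ℝ T × MixedAction T A => z.2 k i := fun i =>
    (measurable_stdSimplex_apply i).comp ((measurable_pi_apply k).comp measurable_snd)
  have hs : Measurable fun z : stdSimplex ℝ T × MixedAction T A =>
      ∑ i ∈ S, meanAction z.1 z.2 i := Finset.measurable_sum _ fun i _ => measurable_meanAction i
  have e : (fun z : stdSimplex ℝ T × MixedAction T A => (mergeAction S z.1 z.2 k).1 i) = fun z =>
      if ∑ i ∈ S, meanAction z.1 z.2 i = 0 then z.2 k i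
      else if i ∈ S then
        meanAction z.1 z.2 i / (∑ i' ∈ S, meanAction z.1 z.2 i') * ∑ i' ∈ S, z.2 k i'
      else z.2 k i := funext fun z => mergeAction_apply S z.1 z.2 k i
  rw [e]
  refine Measurable.ite (hs (measurableSet_singleton 0)) (hx i) ?_
  split_ifs
  · exact ((measurable_meanAction i).div hs).mul (Finset.measurable_sum _ fun i _ => hx i)
  · exact hx i

theorem measurable_deviation (i : A) : Measurable fun z : stdSimplex ℝ T × MixedAction T A =>
    deviation z.1 (reweight z.2 z.1) i := by
  unfold deviation
  refine Finset.measurable_sum _ fun k _ => Measurable.abs (Measurable.sub ?_ (Measurable.mul ?_ ?_))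
  · exact Measurable.mul ((measurable_stdSimplex_apply i).comp
      ((measurable_pi_apply k).comp measurable_snd))
      ((measurable_stdSimplex_apply k).comp measurable_fst)
  · simp only [sum_reweight]
    exact measurable_meanAction i
  · exact (measurable_stdSimplex_apply k).comp measurable_fst

theorem measurable_smallMoves (ε : ℝ) (S : Finset A) :
    MeasurableSet {z : stdSimplex ℝ T × MixedAction T A | smallMoves ε z.1 z.2 = S} := by
  classical
  have e : {z : stdSimplex ℝ T × MixedAction T A | smallMoves ε z.1 z.2 = S} =
      ⋂ i, {z | deviation z.1 (reweight z.2 z.1) i ≤ ε * meanAction z.1 z.2 i ↔ i ∈ S} := by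
    ext z
    simp [smallMoves, Finset.ext_iff]
  rw [e]
  refine MeasurableSet.iInter fun i => ?_
  have h := measurableSet_le (measurable_deviation (T := T) i)
    ((measurable_meanAction (T := T) i).const_mul ε)
  by_cases hi : i ∈ S
  · simpa only [hi, iff_true] using h
  · simp only [hi, iff_false]
    exact h.compl

theorem measurable_blurAction :
    Measurable fun z : stdSimplex ℝ T × MixedAction T A => blurAction ε hε z.1 z.2 := by
  classical
  have h1 : Measurable fun z : stdSimplex ℝ T × MixedAction T A =>
      mergeAction (smallMoves ε z.1 z.2) z.1 z.2 := by
    -- The merged class depends on the belief and the action, but takes finitely many values, each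
    -- on a measurable set.
    intro s hs
    have e : (fun z : stdSimplex ℝ T × MixedAction T A =>
        mergeAction (smallMoves ε z.1 z.2) z.1 z.2) ⁻¹' s =
        ⋃ S : Finset A, {z | smallMoves ε z.1 z.2 = S} ∩
          (fun z => mergeAction S z.1 z.2) ⁻¹' s := by
      ext z
      simp
    rw [e]
    exact MeasurableSet.iUnion fun S => (measurable_smallMoves ε S).inter
      (measurable_mergeAction S hs)
  have h2 := measurable_mergeAction (T := T) (A := A) Finset.univ
  refine measurable_pi_lambda _ fun k => Measurable.subtype_mk (f := fun z : stdSimplex ℝ T ×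
    MixedAction T A => (blurAction ε hε z.1 z.2 k).1) (measurable_pi_lambda _ fun i => ?_)
  exact (((measurable_stdSimplex_apply i).comp ((measurable_pi_apply k).comp h1)).const_mul
    (1 - ε)).add (((measurable_stdSimplex_apply i).comp ((measurable_pi_apply k).comp h2)).const_mul ε)

end blur

/-! ### Variation of the belief under blurred actions -/

section variation

variable {T A : Type*} [Fintype T] [Fintype A]

/-- The expected posterior belief is the prior belief. -/
theorem sum_meanAction_mul_posteriorBelief (p : stdSimplex ℝ T) (x : MixedAction T A) (k : T) :
    ∑ i, meanAction p x i * posteriorBelief p x i k = p k := by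
  simp only [meanAction_mul_posteriorBelief]
  exact (reweight_mem_splittings x (stdSimplex_coe_nonneg p)).2 k

/-- The variance identity for a martingale increment: the cross term reduces by
`sum_meanAction_mul_posteriorBelief`. -/
theorem sum_meanAction_mul_sq_sub (p : stdSimplex ℝ T) (x : MixedAction T A) :
    ∑ i, meanAction p x i * ∑ k, (posteriorBelief p x i k - p k) ^ 2 =
      ∑ i, meanAction p x i * ∑ k, posteriorBelief p x i k ^ 2 - ∑ k, p k ^ 2 := by
  have h : ∀ i, meanAction p x i * ∑ k, (posteriorBelief p x i k - p k) ^ 2 =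
      meanAction p x i * ∑ k, posteriorBelief p x i k ^ 2 +
      ∑ k, (meanAction p x i * p k ^ 2 -
        2 * p k * (meanAction p x i * posteriorBelief p x i k)) := fun i => by
    simp only [Finset.mul_sum, ← Finset.sum_add_distrib]
    exact Finset.sum_congr rfl fun k _ => by ring
  simp only [h, Finset.sum_add_distrib]
  rw [Finset.sum_comm (f := fun i k => meanAction p x i * p k ^ 2 -
    2 * p k * (meanAction p x i * posteriorBelief p x i k))]
  simp only [Finset.sum_sub_distrib, ← Finset.mul_sum, ← Finset.sum_mul, sum_meanAction,
    sum_meanAction_mul_posteriorBelief]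
  simp only [mul_assoc, ← Finset.mul_sum, ← pow_two]
  ring

/-- Under a blurred action, the expected move of the belief is controlled by the expected increase of
its squared norm. -/
theorem sum_meanAction_mul_abs_le {ε : ℝ} (hε : ε ∈ Set.Icc (0 : ℝ) 1)
    (p : stdSimplex ℝ T) (x : MixedAction T A) :
    ε * (1 - ε) * ∑ i, meanAction p (blurAction ε hε p x) i *
        ∑ k, |posteriorBelief p (blurAction ε hε p x) i k - p k| ≤
      2 * Fintype.card T * (∑ i, meanAction p (blurAction ε hε p x) i *
        ∑ k, posteriorBelief p (blurAction ε hε p x) i k ^ 2 - ∑ k, p k ^ 2) := by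
  classical
  have hε1 : 0 ≤ 1 - ε := sub_nonneg.2 hε.2
  set S := smallMoves ε p x with hS
  set a := reweight x (p : T → ℝ) with ha
  have ham : a ∈ splittings A p := reweight_mem_splittings x (stdSimplex_coe_nonneg p)
  have ha0 : 0 ≤ a := splittings_nonneg ham
  have hm := meanAction_blurAction hε p x
  have hr := reweight_blurAction_apply hε p x
  set y := blurAction ε hε p x
  let n : A → ℝ := fun i => ∑ k, |posteriorBelief p y i k - p k|
  have hn0 : ∀ i, 0 ≤ n i := fun i => Finset.sum_nonneg fun _ _ => abs_nonneg _
  have hm0 : ∀ i, 0 ≤ meanAction p y i := meanAction_nonneg p y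
  -- The uninformative component has no deviation, so mixing it in scales every move by `1 - ε`.
  have hdev : ∀ i, meanAction p y i * n i = (1 - ε) * deviation p (mergeForm S a) i := by
    intro i
    have e (k : T) : meanAction p y i * |posteriorBelief p y i k - p k| =
        (1 - ε) * |mergeForm S a i k - meanAction p x i * p k| := by
      have h : meanAction p y i * (posteriorBelief p y i k - p k) =
          (1 - ε) * (mergeForm S a i k - meanAction p x i * p k) := by
        rw [mul_sub, meanAction_mul_posteriorBelief, hr, hm]
        ring
      have h2 := congrArg abs h
      rwa [abs_mul, abs_mul, abs_of_nonneg (hm0 i), abs_of_nonneg hε1] at h2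
    rw [deviation, sum_apply_mergeForm ha0, sum_reweight, Finset.mul_sum, Finset.mul_sum]
    exact Finset.sum_congr rfl fun k _ => e k
  -- Outside `S` the move exceeded `ε` before mixing, hence is at least `ε * (1 - ε)` after it if
  -- the action has positive probability: the move is dominated by its square.
  have hbig : ∀ i ∈ Sᶜ, ε * (1 - ε) * (meanAction p y i * n i) ≤ meanAction p y i * n i ^ 2 := by
    intro i hi
    have hi' : i ∉ S := Finset.mem_compl.1 hi
    have h1 : ε * meanAction p x i ≤ deviation p (mergeForm S a) i := by
      have : ¬ deviation p a i ≤ ε * meanAction p x i := fun h =>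
        hi' (Finset.mem_filter.2 ⟨Finset.mem_univ i, h⟩)
      unfold deviation at this ⊢
      rw [mergeForm_of_notMem hi']
      exact (not_le.1 this).le
    have h2 : (1 - ε) * (ε * meanAction p y i) ≤ meanAction p y i * n i := by
      rw [hdev i, hm i]
      exact mul_le_mul_of_nonneg_left h1 hε1
    nlinarith [mul_le_mul_of_nonneg_right h2 (hn0 i)]
  -- Cauchy-Schwarz, from the `ℓ¹` norm to the Euclidean one; this is the source of the factor
  -- `|K|`.
  have hsq : ∀ i, n i ^ 2 ≤ Fintype.card T * ∑ k, (posteriorBelief p y i k - p k) ^ 2 := by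
    intro i
    have h := sq_sum_le_card_mul_sum_sq (s := Finset.univ)
      (f := fun k => |posteriorBelief p y i k - p k|)
    simpa only [sq_abs, Finset.card_univ] using h
  have hsum : ∑ i, meanAction p y i * n i ≤ 2 * ∑ i ∈ Sᶜ, meanAction p y i * n i := by
    simp only [hdev, ← Finset.mul_sum]
    have := mul_le_mul_of_nonneg_left (sum_deviation_mergeForm_le (S := S) ham p.2.2) hε1
    linarith
  calc ε * (1 - ε) * ∑ i, meanAction p y i * n i
      ≤ ε * (1 - ε) * (2 * ∑ i ∈ Sᶜ, meanAction p y i * n i) :=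
        mul_le_mul_of_nonneg_left hsum (mul_nonneg hε.1 hε1)
    _ = 2 * ∑ i ∈ Sᶜ, ε * (1 - ε) * (meanAction p y i * n i) := by
        rw [← Finset.mul_sum]
        ring
    _ ≤ 2 * ∑ i ∈ Sᶜ, meanAction p y i * n i ^ 2 := by
        gcongr 2 * ?_
        exact Finset.sum_le_sum hbig
    _ ≤ 2 * ∑ i, meanAction p y i * n i ^ 2 := by
        gcongr 2 * ?_
        exact Finset.sum_le_univ_sum_of_nonneg fun i => mul_nonneg (hm0 i) (sq_nonneg _)
    _ ≤ 2 * ∑ i, meanAction p y i *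
          (Fintype.card T * ∑ k, (posteriorBelief p y i k - p k) ^ 2) := by
        gcongr 2 * ?_
        exact Finset.sum_le_sum fun i _ => mul_le_mul_of_nonneg_left (hsq i) (hm0 i)
    _ = _ := by
        rw [← sum_meanAction_mul_sq_sub, Finset.mul_sum, Finset.mul_sum]
        exact Finset.sum_congr rfl fun i _ => by ring

end variation

/-! ### One-stage loss of blurring and measurable selection -/

section

variable {K L Ω I J : Type*} [Fintype K] [Fintype L] [Fintype Ω] [Fintype I] [Fintype J]

/-- The loss in the one-shot game with continuation payoff `F` when the first player blurs the
action `x`. -/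
theorem shapley_le_blurAction {M lam : ℝ} {g : K → L → I → J → ℝ} {ρ : I → J → Ω → ℝ}
    {F : Ω → (K → ℝ) → (L → ℝ) → ℝ} (hM : 0 ≤ M) (hlam : 0 ≤ lam) (hlam' : lam ≤ 1)
    (hρ : ∀ i j w, 0 ≤ ρ i j w) (hρ' : ∀ i j, ∑ w, ρ i j w = 1)
    (hF : ∀ w, IsHalfSaddle M (F w)) (hg : ∀ k l i j, |g k l i j| ≤ M) (v : Ω) {c : ℝ}
    (hc : c = 1 ∨ c = 0 ∧ ∃ c' : K → L → ℝ, ∀ k l i j, g k l i j = c' k l)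
    {ε : ℝ} (hε : ε ∈ Set.Icc (0 : ℝ) 1) (p : stdSimplex ℝ K) (q : stdSimplex ℝ L)
    (x : MixedAction K I) (y : MixedAction L J) :
    shapley lam ρ g F (reweight x p) (reweight y q) ≤
      shapley lam ρ g F (reweight (blurAction ε hε p x) p) (reweight y q) + 8 * ε * M *
      (lam * c + (1 - lam) *
        ∑ i, ∑ j, meanAction p x i * meanAction q y j * (1 - ρ i j v)) := by
  have ha := reweight_mem_splittings x (stdSimplex_coe_nonneg p)
  have hb := reweight_mem_splittings y (stdSimplex_coe_nonneg q)
  have ha0 := splittings_nonneg ha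
  -- Merging small moves changes rows by a relative amount of at most `κ = 2 ε`.
  have h1 := shapley_le_mergeForm hM hlam hlam' hρ hρ' hF p.2.2 q.2.2 ha hb v hg hc
    (mul_nonneg zero_le_two hε.1) (S := smallMoves ε p x)
    (sum_abs_mergeForm_sub_le ha0 hε.1 fun i hi => by
      rw [sum_reweight]
      exact (Finset.mem_filter.1 hi).2)
  -- Redrawing all actions can change rows by `κ = 2`, but occurs only with weight `ε`.
  have h2 := shapley_le_mergeForm hM hlam hlam' hρ hρ' hF p.2.2 q.2.2 ha hb v hg hc zero_le_two
    (S := Finset.univ) fun i => by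
      refine le_trans (le_of_eq ?_) (deviation_le_two (stdSimplex_coe_nonneg p) p.2.2 ha0 i)
      rw [mergeForm_univ ha p.2.2]
      exact Finset.sum_congr rfl fun k _ => abs_sub_comm _ _
  simp only [sum_reweight] at h1 h2
  have h3 := shapley_superadd (lam := lam) (g := g) hlam' hρ hF
    (smul_nonneg (sub_nonneg.2 hε.2) (mergeForm_nonneg (S := smallMoves ε p x) ha0))
    (smul_nonneg hε.1 (mergeForm_nonneg (S := Finset.univ) ha0)) (splittings_nonneg hb)
  rw [shapley_smul hF (sub_nonneg.2 hε.2) (mergeForm_nonneg ha0) (splittings_nonneg hb),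
    shapley_smul hF hε.1 (mergeForm_nonneg ha0) (splittings_nonneg hb), ← reweight_blurAction hε]
    at h3
  set R := lam * c + (1 - lam) *
    ∑ i, ∑ j, meanAction p x i * meanAction q y j * (1 - ρ i j v) with hR
  have hR0 : 0 ≤ R := by
    have h0 : 0 ≤ ∑ i, ∑ j, meanAction p x i * meanAction q y j * (1 - ρ i j v) := by
      refine Finset.sum_nonneg fun i _ => Finset.sum_nonneg fun j _ => mul_nonneg
        (mul_nonneg (meanAction_nonneg _ _ _) (meanAction_nonneg _ _ _)) ?_
      rw [sub_nonneg, ← hρ' i j]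
      exact Finset.single_le_sum (fun w _ => hρ i j w) (Finset.mem_univ v)
    have hc0 : 0 ≤ c := by
      rcases hc with rfl | ⟨rfl, -⟩ <;> norm_num
    exact add_nonneg (mul_nonneg hlam hc0) (mul_nonneg (sub_nonneg.2 hlam') h0)
  have h4 := mul_le_mul_of_nonneg_left h1 (sub_nonneg.2 hε.2)
  have h5 := mul_le_mul_of_nonneg_left h2 hε.1
  have h6 := mul_nonneg (mul_nonneg (mul_nonneg hε.1 hε.1) hM) hR0
  -- The constant: `(1 - ε) * 4 ε + ε * 4 ≤ 8 ε`.
  nlinarith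

section selection

variable [MeasurableSpace Ω]

theorem measurableSet_beliefState_of_slices [DiscreteMeasurableSpace Ω]
    {s : Set (BeliefState K L Ω)}
    (h : ∀ w, MeasurableSet {z : stdSimplex ℝ K × stdSimplex ℝ L | (z.1, z.2, w) ∈ s}) :
    MeasurableSet s := by
  have e : s = ⋃ w, (fun t : BeliefState K L Ω => t.2.2) ⁻¹' {w} ∩
      (fun t => (t.1, t.2.1)) ⁻¹' {z | (z.1, z.2, w) ∈ s} := by
    ext t
    simp
  rw [e]
  refine MeasurableSet.iUnion fun w => MeasurableSet.inter ?_ ?_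
  · exact (measurable_snd.comp measurable_snd) (MeasurableSet.of_discrete (s := {w}))
  · exact (measurable_fst.prodMk (measurable_fst.comp measurable_snd)) (h w)

theorem IsSaddle.continuous_stdSimplex {M : ℝ} {F : (K → ℝ) → (L → ℝ) → ℝ} (hF : IsSaddle M F) :
    Continuous fun z : stdSimplex ℝ K × stdSimplex ℝ L => F z.1 z.2 := by
  refine hF.continuousOn.comp_continuous (f := fun z : stdSimplex ℝ K × stdSimplex ℝ L =>
    ((z.1 : K → ℝ), (z.2 : L → ℝ))) ?_ fun z =>
      ⟨stdSimplex_coe_nonneg z.1, stdSimplex_coe_nonneg z.2⟩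
  exact (continuous_subtype_val.comp continuous_fst).prodMk
    (continuous_subtype_val.comp continuous_snd)

theorem measurable_of_isSaddle [DiscreteMeasurableSpace Ω] {M : ℝ}
    {F : Ω → (K → ℝ) → (L → ℝ) → ℝ} (hF : ∀ w, IsSaddle M (F w)) :
    Measurable fun s : BeliefState K L Ω => F s.2.2 s.1 s.2.1 := fun _ hs =>
  measurableSet_beliefState_of_slices fun w => (hF w).continuous_stdSimplex.measurable hs

/-- Measurable selection of nearly optimal actions in the one-shot games. -/
theorem exists_measurable_nearlyOptimal [DiscreteMeasurableSpace Ω] [Nonempty I] {M lam : ℝ}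
    {g : K → L → Ω → I → J → ℝ} {ρ : Ω → I → J → Ω → ℝ} {F : Ω → (K → ℝ) → (L → ℝ) → ℝ}
    (hlam : 0 ≤ lam) (hlam' : lam ≤ 1) (hρ : ∀ v i j w, 0 ≤ ρ v i j w)
    (hρ' : ∀ v i j, ∑ w, ρ v i j w = 1) (hg : ∀ k l v i j, |g k l v i j| ≤ M)
    (hF : ∀ w, IsSaddle M (F w))
    (hV : ∀ v π θ, 0 ≤ π → 0 ≤ θ → IsGameValue (splittings I π) (splittings J θ)
      (shapley lam (ρ v) (fun k l => g k l v) F) (F v π θ)) {η : ℝ} (hη : 0 < η) :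
    ∃ f : BeliefState K L Ω → MixedAction K I, Measurable f ∧ ∀ s (y : MixedAction L J),
      F s.2.2 s.1 s.2.1 - η ≤ shapley lam (ρ s.2.2) (fun k l => g k l s.2.2) F
        (reweight (f s) s.1) (reweight y s.2.1) := by
  classical
  -- By the Lipschitz bound, some member of a countable dense family is `η`-optimal at each state.
  -- Choosing the first one is measurable.
  let d := TopologicalSpace.denseSeq (MixedAction K I)
  let P : ℕ → BeliefState K L Ω → Prop := fun n s => ∀ y : MixedAction L J,
      F s.2.2 s.1 s.2.1 - η ≤ shapley lam (ρ s.2.2) (fun k l => g k l s.2.2) F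
        (reweight (d n) s.1) (reweight y s.2.1)
  have hmeas : ∀ n, MeasurableSet {s | P n s} := by
    intro n
    refine measurableSet_beliefState_of_slices fun w => IsClosed.measurableSet ?_
    change IsClosed {z : stdSimplex ℝ K × stdSimplex ℝ L | ∀ y : MixedAction L J,
      F w z.1 z.2 - η ≤ shapley lam (ρ w) (fun k l => g k l w) F (reweight (d n) z.1)
        (reweight y z.2)}
    -- The uncountable quantifier over `y` is harmless: on each slice the set is an intersection of
    -- closed sets.
    rw [Set.ofPred_forall]
    refine isClosed_iInter fun y => isClosed_le
      ((hF w).continuous_stdSimplex.sub continuous_const) ?_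
    refine (continuousOn_shapley (lam := lam) (ρ := ρ w) (g := fun k l => g k l w)
      hF).comp_continuous (f := fun z : stdSimplex ℝ K × stdSimplex ℝ L =>
      (reweight (d n) (z.1 : K → ℝ), reweight y (z.2 : L → ℝ))) ?_ fun z =>
        ⟨reweight_nonneg _ (stdSimplex_coe_nonneg _), reweight_nonneg _ (stdSimplex_coe_nonneg _)⟩
    exact (continuous_reweight.comp (continuous_const.prodMk continuous_fst)).prodMk
      (continuous_reweight.comp (continuous_const.prodMk continuous_snd))
  have hex : ∀ s, ∃ n, P n s := by
    intro s
    obtain ⟨⟨a, ha, h1⟩, -⟩ := hV s.2.2 s.1 s.2.1 (stdSimplex_coe_nonneg _)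
      (stdSimplex_coe_nonneg _)
    obtain ⟨x, rfl⟩ := exists_reweight_eq (stdSimplex_coe_nonneg s.1) ha
    let ψ : MixedAction K I → ℝ := fun x' =>
      M * ∑ i, ∑ k, |reweight x s.1 i k - reweight x' s.1 i k|
    have hψ : Continuous ψ := by
      have hc : Continuous fun x' : MixedAction K I => reweight x' (s.1 : K → ℝ) :=
        continuous_reweight.comp (continuous_id.prodMk continuous_const)
      refine continuous_const.mul (continuous_finsetSum _ fun i _ => continuous_finsetSum _
        fun k _ => (continuous_const.sub ?_).abs)
      exact (continuous_apply k).comp ((continuous_apply i).comp hc)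
    obtain ⟨n, hn⟩ := (TopologicalSpace.denseRange_denseSeq (MixedAction K I)).exists_mem_open
      (isOpen_lt hψ continuous_const) (⟨x, by simpa [ψ] using hη⟩ : {x' | ψ x' < η}.Nonempty)
    refine ⟨n, fun y => ?_⟩
    have hy := reweight_mem_splittings y (stdSimplex_coe_nonneg s.2.1)
    have h2 := shapley_sub_le hlam hlam' (hρ s.2.2) (hρ' s.2.2)
      (g := fun k l => g k l s.2.2) (fun k l i j => hg k l s.2.2 i j) (fun w => (hF w).left)
      (splittings_nonneg ha) (reweight_nonneg (d n) (stdSimplex_coe_nonneg s.1))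
      (splittings_nonneg hy)
    rw [sum_splittings hy] at h2
    have h3 : ∑ l, (s.2.1 : L → ℝ) l = 1 := s.2.1.2.2
    rw [h3, mul_one] at h2
    have h4 : ψ (d n) < η := hn
    linarith [h1 _ hy]
  refine ⟨fun s => d (Nat.find (hex s)), ?_, fun s => Nat.find_spec (hex s)⟩
  exact Measurable.find (f := fun n _ => d n) (fun n => measurable_const) hmeas hex

end selection

end

/-! ### Stationary strategies and verification of the value -/

section deterministic

variable {K L Ω I J A : Type*} [Fintype K] [Fintype L] [Fintype I] [Fintype J]
  [MeasurableSpace Ω] [MeasurableSpace A]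

/-- The behavior strategy that plays a given measurable function of the current state. -/
noncomputable def deterministicStrategy (f : BeliefState K L Ω → A) (hf : Measurable f) :
    BehaviorStrategy K L Ω I J A where
  toKernel _ := Kernel.deterministic (fun h => f h.2) (hf.comp measurable_snd)
  isMarkov _ := inferInstance

theorem deterministicStrategy_apply (f : BeliefState K L Ω → A) (hf : Measurable f) (n : ℕ)
    (x : (Fin n → Stage K L Ω I J) × BeliefState K L Ω) :
    (deterministicStrategy f hf).toKernel n x = Measure.dirac (f x.2) :=
  Kernel.deterministic_apply (hf.comp measurable_snd) x

end deterministic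

namespace IncompleteInfoGame

variable {K L Ω I J : Type*} [Fintype K] [Fintype L] [Fintype Ω] [Fintype I] [Fintype J]
  [MeasurableSpace Ω] [DiscreteMeasurableSpace Ω]

section play

variable (Γ : IncompleteInfoGame K L Ω I J) (w : BeliefState K L Ω)

theorem ae_law_deterministic_left {f : BeliefState K L Ω → MixedAction K I} (hf : Measurable f)
    (τ : BehaviorStrategy K L Ω I J (MixedAction L J)) (n : ℕ) :
    ∀ᵐ h ∂(Γ.law w (deterministicStrategy f hf) τ), (h n).2.1 = f (h n).1 := by
  have hB : MeasurableSet {z : Stage K L Ω I J | z.2.1 = f z.1} :=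
    measurableSet_eq_fun (measurable_fst.comp measurable_snd) (hf.comp measurable_fst)
  refine Γ.ae_law_of_ae_stageKernel w _ τ hB (fun n x => ?_) n
  have := τ.isMarkov n
  have := (deterministicStrategy (I := I) (J := J) f hf).isMarkov n
  unfold stageKernel
  rw [Kernel.prod_apply, Kernel.prod_apply, Kernel.deterministic_apply]
  rw [deterministicStrategy_apply, Measure.dirac_prod, Measure.dirac_prod,
    Measure.map_apply (by fun_prop) hB.compl,
    Measure.map_apply (by fun_prop) (measurable_prodMk_left hB.compl)]
  simp

theorem ae_law_deterministic_right (σ : BehaviorStrategy K L Ω I J (MixedAction K I))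
    {f : BeliefState K L Ω → MixedAction L J} (hf : Measurable f) (n : ℕ) :
    ∀ᵐ h ∂(Γ.law w σ (deterministicStrategy f hf)), (h n).2.2 = f (h n).1 := by
  have hB : MeasurableSet {z : Stage K L Ω I J | z.2.2 = f z.1} :=
    measurableSet_eq_fun (measurable_snd.comp measurable_snd) (hf.comp measurable_fst)
  refine Γ.ae_law_of_ae_stageKernel w σ _ hB (fun n x => ?_) n
  have := σ.isMarkov n
  have := (deterministicStrategy (I := I) (J := J) f hf).isMarkov n
  unfold stageKernel
  rw [Kernel.prod_apply, Kernel.prod_apply, Kernel.deterministic_apply]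
  rw [deterministicStrategy_apply, Measure.dirac_prod, Measure.prod_dirac,
    Measure.map_apply (by fun_prop) hB.compl,
    Measure.map_apply (by fun_prop) (measurable_prodMk_left hB.compl)]
  simp

variable {lam : ℝ}

theorem abs_discountedPayoff_le (hlam : 0 < lam) (hlam' : lam ≤ 1)
    (σ : BehaviorStrategy K L Ω I J (MixedAction K I))
    (τ : BehaviorStrategy K L Ω I J (MixedAction L J)) :
    |Γ.discountedPayoff lam w σ τ| ≤ Γ.payoffNorm := by
  have hlam1 : 0 ≤ 1 - lam := sub_nonneg.2 hlam'
  have hb : ∀ h : ℕ → Stage K L Ω I J,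
      ‖∑' m : ℕ, lam * (1 - lam) ^ m * Γ.payoff (h m)‖ ≤ Γ.payoffNorm := by
    intro h
    have hg : HasSum (fun m : ℕ => (1 - lam) ^ m * (lam * Γ.payoffNorm)) Γ.payoffNorm := by
      have := (hasSum_geometric_of_lt_one hlam1 (by linarith)).mul_right (lam * Γ.payoffNorm)
      rwa [sub_sub_cancel, inv_mul_cancel_left₀ hlam.ne'] at this
    refine tsum_of_norm_bounded hg fun m => ?_
    rw [Real.norm_eq_abs, abs_mul, abs_of_nonneg (mul_nonneg hlam.le (pow_nonneg hlam1 m))]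
    have := mul_le_mul_of_nonneg_left (Γ.abs_payoff_le (h m))
      (mul_nonneg hlam.le (pow_nonneg hlam1 m))
    linarith
  refine (norm_integral_le_of_norm_le_const (.of_forall hb)).trans_eq ?_
  simp

/-- Nearly optimal strategies of both players give the value. -/
theorem isDiscountedValue_of_forall (hlam : 0 < lam) (hlam' : lam ≤ 1) {v : ℝ}
    (h1 : ∀ η > 0, ∃ σ, ∀ τ, v - η ≤ Γ.discountedPayoff lam w σ τ)
    (h2 : ∀ η > 0, ∃ τ, ∀ σ, Γ.discountedPayoff lam w σ τ ≤ v + η) :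
    Γ.IsDiscountedValue lam w v := by
  have hle σ τ := (abs_le.1 (Γ.abs_discountedPayoff_le w hlam hlam' σ τ)).2
  have hge σ τ := (abs_le.1 (Γ.abs_discountedPayoff_le w hlam hlam' σ τ)).1
  obtain ⟨σ₀, -⟩ := h1 1 one_pos
  obtain ⟨τ₀, -⟩ := h2 1 one_pos
  have : Nonempty (BehaviorStrategy K L Ω I J (MixedAction K I)) := ⟨σ₀⟩
  have : Nonempty (BehaviorStrategy K L Ω I J (MixedAction L J)) := ⟨τ₀⟩
  have b1 : ∀ σ, BddBelow (Set.range fun τ => Γ.discountedPayoff lam w σ τ) := fun σ =>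
    ⟨_, by rintro _ ⟨τ, rfl⟩; exact hge σ τ⟩
  have b2 : ∀ τ, BddAbove (Set.range fun σ => Γ.discountedPayoff lam w σ τ) := fun τ =>
    ⟨_, by rintro _ ⟨σ, rfl⟩; exact hle σ τ⟩
  have b3 : BddAbove (Set.range fun σ => ⨅ τ, Γ.discountedPayoff lam w σ τ) :=
    ⟨Γ.payoffNorm, by rintro _ ⟨σ, rfl⟩; exact (ciInf_le (b1 σ) τ₀).trans (hle σ τ₀)⟩
  have b4 : BddBelow (Set.range fun τ => ⨆ σ, Γ.discountedPayoff lam w σ τ) :=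
    ⟨-Γ.payoffNorm, by rintro _ ⟨τ, rfl⟩; exact (hge σ₀ τ).trans (le_ciSup (b2 τ) σ₀)⟩
  refine ⟨le_antisymm ?_ ?_, le_antisymm ?_ ?_⟩
  · refine ciSup_le fun σ => le_of_forall_pos_le_add fun η hη => ?_
    obtain ⟨τ, hτ⟩ := h2 η hη
    exact (ciInf_le (b1 σ) τ).trans (hτ σ)
  · refine le_of_forall_pos_sub_le fun η hη => ?_
    obtain ⟨σ, hσ⟩ := h1 η hη
    exact (le_ciInf hσ).trans (le_ciSup b3 σ)
  · refine le_of_forall_pos_le_add fun η hη => ?_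
    obtain ⟨τ, hτ⟩ := h2 η hη
    exact (ciInf_le b4 τ).trans (ciSup_le hτ)
  · refine le_ciInf fun τ => le_of_forall_pos_sub_le fun η hη => ?_
    obtain ⟨σ, hσ⟩ := h1 η hη
    exact (hσ τ).trans (le_ciSup (b2 τ) σ)

/-- Verification principle: the one-stage inequality holds for every action `y`, hence at the
realized one, whatever history-dependent or random device selects it. -/
theorem le_discountedPayoff_deterministic (hlam : 0 < lam) (hlam' : lam ≤ 1)
    {f : BeliefState K L Ω → MixedAction K I} (hf : Measurable f)
    {u : BeliefState K L Ω → ℝ} (hu : Measurable u) {C : ℝ} (hC : ∀ s, |u s| ≤ C)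
    (h : ∀ s y, u s ≤ lam * Γ.payoff (s, f s, y) +
      (1 - lam) * ∫ s', u s' ∂(Γ.transition (s, f s, y)))
    (τ : BehaviorStrategy K L Ω I J (MixedAction L J)) :
    u w ≤ Γ.discountedPayoff lam w (deterministicStrategy f hf) τ := by
  refine Γ.le_discounted_of_ae_le w _ τ hlam hlam' Γ.measurable_payoff Γ.abs_payoff_le hu hC
    fun m => ?_
  filter_upwards [Γ.ae_law_deterministic_left w hf τ m] with z hz
  have := h (z m).1 (z m).2.2
  rwa [← hz] at this

theorem discountedPayoff_deterministic_le (hlam : 0 < lam) (hlam' : lam ≤ 1)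
    {f : BeliefState K L Ω → MixedAction L J} (hf : Measurable f)
    {u : BeliefState K L Ω → ℝ} (hu : Measurable u) {C : ℝ} (hC : ∀ s, |u s| ≤ C)
    (h : ∀ s x, lam * Γ.payoff (s, x, f s) +
      (1 - lam) * ∫ s', u s' ∂(Γ.transition (s, x, f s)) ≤ u s)
    (σ : BehaviorStrategy K L Ω I J (MixedAction K I)) :
    Γ.discountedPayoff lam w σ (deterministicStrategy f hf) ≤ u w := by
  have key := Γ.le_discounted_of_ae_le w σ (deterministicStrategy f hf) hlam hlam'
    (r := fun z => -Γ.payoff z) Γ.measurable_payoff.neg (fun z => by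
      simpa using Γ.abs_payoff_le z) (u := fun s => -u s) hu.neg (C := C)
      (fun s => by simpa using hC s) fun m => by
    filter_upwards [Γ.ae_law_deterministic_right w σ hf m] with z hz
    have := h (z m).1 (z m).2.1
    rw [← hz] at this
    rw [integral_neg]
    linarith
  simp only [mul_neg, tsum_neg, integral_neg] at key
  exact neg_le_neg_iff.1 key

end play

section transition

variable (Γ : IncompleteInfoGame K L Ω I J) (z : Stage K L Ω I J)

theorem integral_transition_state (χ : Ω → ℝ) : ∫ s, χ s.2.2 ∂(Γ.transition z) =
    ∑ i, ∑ j, meanAction z.1.1 z.2.1 i * meanAction z.1.2.1 z.2.2 j *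
      ∑ w, Γ.ρ z.1.2.2 i j w * χ w := by
  rw [Γ.integral_transition z (f := fun s => χ s.2.2)
    ((Measurable.of_discrete (f := χ)).comp (measurable_snd.comp measurable_snd))]
  refine Finset.sum_congr rfl fun i _ => Finset.sum_congr rfl fun j _ => ?_
  rw [Finset.mul_sum]
  exact Finset.sum_congr rfl fun w _ => by ring

theorem sum_meanAction_mul_meanAction (p : stdSimplex ℝ K) (q : stdSimplex ℝ L)
    (x : MixedAction K I) (y : MixedAction L J) :
    ∑ i, ∑ j, meanAction p x i * meanAction q y j = 1 := by
  rw [← Finset.sum_mul_sum, sum_meanAction, sum_meanAction, one_mul]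

theorem lintegral_transition_fst {f : stdSimplex ℝ K → ℝ} (hf : Measurable f) (hf0 : ∀ p, 0 ≤ f p) :
    ∫⁻ s, ENNReal.ofReal (f s.1) ∂(Γ.transition z) =
      ENNReal.ofReal (∑ i, meanAction z.1.1 z.2.1 i * f (posteriorBelief z.1.1 z.2.1 i)) := by
  have hm : Measurable fun s : BeliefState K L Ω => f s.1 := hf.comp measurable_fst
  have hi : Integrable (fun s : BeliefState K L Ω => f s.1) (Γ.transition z) := by
    change Integrable _ (Γ.transitionLaw z)
    unfold transitionLaw
    exact integrable_finsetSum_measure.2 fun i _ => integrable_finsetSum_measure.2 fun j _ =>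
      integrable_finsetSum_measure.2 fun w _ =>
      (integrable_dirac' hm.stronglyMeasurable (by simp)).smul_measure ENNReal.ofReal_ne_top
  rw [← ofReal_integral_eq_lintegral_ofReal hi (.of_forall fun s => hf0 s.1),
    Γ.integral_transition z hm]
  congr 1
  refine Finset.sum_congr rfl fun i _ => ?_
  have h (j : J) (w : Ω) : Γ.ρ z.1.2.2 i j w * meanAction z.1.1 z.2.1 i *
      meanAction z.1.2.1 z.2.2 j * f (posteriorBelief z.1.1 z.2.1 i) =
      Γ.ρ z.1.2.2 i j w * (meanAction z.1.1 z.2.1 i *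
      meanAction z.1.2.1 z.2.2 j * f (posteriorBelief z.1.1 z.2.1 i)) := by ring
  simp only [h, ← Finset.sum_mul, stdSimplex.sum_eq_one, one_mul, ← Finset.mul_sum,
    sum_meanAction, mul_one]

end transition

end IncompleteInfoGame

/-! ### The frontier and the final constant -/

section frontier

variable {K L Ω I J : Type*} [Fintype K] [Fintype L] [Fintype I] [Fintype J]

/-- The smallest coordinate is at most the average `1 / |K|`, hence at most `ε`. -/
theorem mem_frontierSet_of_one_le {ε : ℝ} (h : 1 ≤ ε * Fintype.card K) (p : stdSimplex ℝ K) :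
    p ∈ frontierSet K ε := by
  by_contra hp
  have hp' : ∀ k, ε < p k := fun k => not_le.1 fun hk => hp ⟨k, hk⟩
  have hne : (Finset.univ : Finset K).Nonempty := by
    rw [Finset.univ_nonempty_iff]
    by_contra hK
    rw [not_nonempty_iff] at hK
    simp [Fintype.card_eq_zero] at h
    linarith
  have hs := Finset.sum_lt_sum_of_nonempty hne fun k _ => hp' k
  rw [stdSimplex.sum_eq_one, Finset.sum_const, Finset.card_univ, nsmul_eq_mul] at hs
  linarith

theorem beliefVariation_eq_zero {ε : ℝ} (h : 1 ≤ ε * Fintype.card K)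
    (x : ℕ → Stage K L Ω I J) : beliefVariation ε x = 0 := by
  have hl : lastStage ε x = 0 := by
    unfold lastStage
    have : {t : ℕ∞ | ∃ m : ℕ, t = ((m + 1 : ℕ) : ℕ∞) ∧ beliefAt x m ∉ frontierSet K ε} = ∅ := by
      ext t
      simp only [Set.mem_ofPred_eq, Set.mem_empty_iff_false, iff_false]
      rintro ⟨m, -, hm⟩
      exact hm (mem_frontierSet_of_one_le h _)
    rw [this, sSup_empty]
    rfl
  unfold beliefVariation
  rw [hl]
  simp

/-- The random horizon can be dropped: the variation is bounded over the whole play. -/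
theorem beliefVariation_le (ε : ℝ) (x : ℕ → Stage K L Ω I J) :
    beliefVariation ε x ≤
      ∑' m : ℕ, ENNReal.ofReal (∑ k, |(x (m + 1)).1.1 k - (x m).1.1 k|) := by
  refine ENNReal.tsum_le_tsum fun m => ?_
  split_ifs
  · exact le_rfl
  · exact zero_le

/-- With `s = √n`, the hypothesis gives `ε * s ≤ 1`, so `(ε * s) ^ 2` may be replaced by `ε * s`;
the rest is `2 ε ^ 3 ≤ 3 (1 - ε)`, valid for `ε ≤ 1 / 4`. -/
theorem card_div_le {ε : ℝ} (hε : 0 < ε) (hε' : ε ≤ 1 / 4) {n : ℝ} (hn : 0 ≤ n)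
    (h : ε * n < 1) : 2 * n / (ε * (1 - ε)) ≤ 3 * √n * ε⁻¹ ^ 5 := by
  have hs := (Real.mul_self_sqrt hn).symm
  have hs0 := Real.sqrt_nonneg n
  generalize √n = s at hs hs0 ⊢
  subst hs
  have h1 : ε * s ≤ 1 := by
    by_contra hc
    have h2 : 1 < ε * s * (ε * s) := by nlinarith
    have h3 : ε * s * (ε * s) = ε * (ε * (s * s)) := by ring
    nlinarith
  rw [inv_pow, ← div_eq_mul_inv, div_le_div_iff₀ (by nlinarith) (by positivity)]
  have h5 : (ε * s) * (ε * s) ≤ ε * s * 1 := mul_le_mul_of_nonneg_left h1 (by positivity)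
  have h6 : 2 * ε ^ 3 ≤ 3 * (1 - ε) := by
    have : ε ^ 3 ≤ (1 / 4) ^ 3 := pow_le_pow_left₀ hε.le hε' 3
    linarith
  calc 2 * (s * s) * ε ^ 5 = (2 * ε ^ 3) * ((ε * s) * (ε * s)) := by ring
    _ ≤ (2 * ε ^ 3) * (ε * s * 1) := mul_le_mul_of_nonneg_left h5 (by positivity)
    _ = (2 * ε ^ 3) * (ε * s) := by ring
    _ ≤ (3 * (1 - ε)) * (ε * s) := mul_le_mul_of_nonneg_right h6 (by positivity)
    _ = 3 * s * (ε * (1 - ε)) := by ring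

end frontier

/-! ### Assembly: variation bound, value and blurred strategy -/

namespace IncompleteInfoGame

variable {K L Ω I J : Type*} [Fintype K] [Fintype L] [Fintype Ω] [Fintype I] [Fintype J]
  [MeasurableSpace Ω] [DiscreteMeasurableSpace Ω] (Γ : IncompleteInfoGame K L Ω I J)

/-- The expected variation of the belief when the first player plays blurred actions. -/
theorem lintegral_beliefVariation_le {ε : ℝ} (hε0 : 0 < ε) (hε' : ε ≤ 1 / 4)
    (hε : ε ∈ Set.Icc (0 : ℝ) 1) {f : BeliefState K L Ω → MixedAction K I}
    (hf : Measurable fun s => blurAction ε hε s.1 (f s)) (w : BeliefState K L Ω)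
    (τ : BehaviorStrategy K L Ω I J (MixedAction L J)) :
    ∫⁻ h, beliefVariation ε h ∂(Γ.law w (deterministicStrategy _ hf) τ) ≤
      ENNReal.ofReal (3 * √(Fintype.card K : ℝ) * ε⁻¹ ^ 5) := by
  rcases le_or_gt 1 (ε * Fintype.card K) with hK | hK
  · simp [beliefVariation_eq_zero hK]
  have hpos : 0 < ε * (1 - ε) := mul_pos hε0 (by linarith)
  set C : ℝ := 2 * Fintype.card K / (ε * (1 - ε)) with hC
  have hC0 : 0 ≤ C := div_nonneg (by positivity) hpos.le
  refine le_trans ?_ (ENNReal.ofReal_le_ofReal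
    (card_div_le hε0 hε' (Nat.cast_nonneg (Fintype.card K)) hK))
  refine (lintegral_mono fun h => beliefVariation_le ε h).trans ?_
  have hq : Measurable fun p : stdSimplex ℝ K => ∑ k, p k ^ 2 :=
    Finset.measurable_sum _ fun k _ => (measurable_stdSimplex_apply k).pow_const 2
  -- The potential is the squared Euclidean norm of the belief, which lies between zero and one.
  refine Γ.lintegral_tsum_le_of_ae_le w _ τ
    (D := fun z s => ENNReal.ofReal (∑ k, |s.1 k - z.1.1 k|))
    (q := fun s => ENNReal.ofReal (∑ k, s.1 k ^ 2)) ?_ ?_ ?_ fun m => ?_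
  · refine ENNReal.measurable_ofReal.comp (Finset.measurable_sum _ fun k _ =>
      Measurable.abs (Measurable.sub ?_ ?_))
    · exact (measurable_stdSimplex_apply k).comp (measurable_fst.comp measurable_snd)
    · exact (measurable_stdSimplex_apply k).comp
        (measurable_fst.comp (measurable_fst.comp measurable_fst))
  · exact ENNReal.measurable_ofReal.comp (hq.comp measurable_fst)
  · intro s
    rw [ENNReal.ofReal_le_one, ← stdSimplex.sum_eq_one s.1]
    refine Finset.sum_le_sum fun k _ => ?_
    have h0 := s.1.2.1 k
    have h1 := stdSimplex.le_one s.1 k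
    change s.1 k ^ 2 ≤ s.1 k
    change 0 ≤ s.1 k at h0
    nlinarith
  · filter_upwards [Γ.ae_law_deterministic_left w hf τ m] with h hh
    have hd : Measurable fun p : stdSimplex ℝ K => ∑ k, |p k - (h m).1.1 k| :=
      Finset.measurable_sum _ fun k _ => ((measurable_stdSimplex_apply k).sub_const _).abs
    rw [Γ.lintegral_transition_fst (h m) hd fun p => Finset.sum_nonneg fun _ _ => abs_nonneg _,
      Γ.lintegral_transition_fst (h m) hq fun p => Finset.sum_nonneg fun _ _ => sq_nonneg _,
      ← ENNReal.ofReal_mul hC0, ← ENNReal.ofReal_mul hC0, ← ENNReal.ofReal_add]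
    · refine ENNReal.ofReal_le_ofReal ?_
      rw [hh]
      have key := sum_meanAction_mul_abs_le hε (h m).1.1 (f (h m).1)
      rw [← le_sub_iff_add_le, ← mul_sub, hC, div_mul_eq_mul_div, le_div_iff₀ hpos]
      linarith
    · exact Finset.sum_nonneg fun i _ => mul_nonneg (meanAction_nonneg _ _ _)
        (Finset.sum_nonneg fun _ _ => abs_nonneg _)
    · exact mul_nonneg hC0 (Finset.sum_nonneg fun _ _ => sq_nonneg _)

section solution

variable {lam : ℝ} {F : Ω → (K → ℝ) → (L → ℝ) → ℝ}

/-- `F` solves the Shapley equation of the discounted game. -/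
structure IsShapleySolution (lam : ℝ) (F : Ω → (K → ℝ) → (L → ℝ) → ℝ) : Prop where
  isSaddle : ∀ v, IsSaddle Γ.payoffNorm (F v)
  isGameValue : ∀ v π θ, 0 ≤ π → 0 ≤ θ → IsGameValue (splittings I π) (splittings J θ)
    (shapley lam (fun i j w => (Γ.ρ v i j : Ω → ℝ) w) (fun k l => Γ.g k l v) F) (F v π θ)

omit [MeasurableSpace Ω] [DiscreteMeasurableSpace Ω] in
theorem exists_isShapleySolution [Nonempty I] [Nonempty J] (hlam : 0 < lam) (hlam' : lam ≤ 1) :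
    ∃ F, Γ.IsShapleySolution lam F := by
  obtain ⟨F, hF, hV⟩ := exists_shapley_fixedPoint (g := Γ.g)
    (ρ := fun v i j w => (Γ.ρ v i j : Ω → ℝ) w) Γ.payoffNorm_nonneg hlam hlam'
    (fun v i j w => (Γ.ρ v i j).2.1 w) (fun v i j => (Γ.ρ v i j).2.2) Γ.abs_g_le_payoffNorm
  exact ⟨F, hF, hV⟩

namespace IsShapleySolution

variable {Γ} (h : Γ.IsShapleySolution lam F)

include h

theorem measurable : Measurable fun s : BeliefState K L Ω => F s.2.2 s.1 s.2.1 :=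
  measurable_of_isSaddle h.isSaddle

omit [MeasurableSpace Ω] [DiscreteMeasurableSpace Ω] in
theorem abs_le (s : BeliefState K L Ω) : |F s.2.2 s.1 s.2.1| ≤ Γ.payoffNorm := by
  have h := (h.isSaddle s.2.2).left.abs_apply_le s.1 s.2.1 (stdSimplex_coe_nonneg _)
    (stdSimplex_coe_nonneg _)
  simpa [stdSimplex.sum_eq_one] using h

theorem integrable (z : Stage K L Ω I J) :
    Integrable (fun s : BeliefState K L Ω => F s.2.2 s.1 s.2.1) (Γ.transition z) :=
  .of_bound h.measurable.aestronglyMeasurable Γ.payoffNorm (.of_forall h.abs_le)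

theorem stage_eq (z : Stage K L Ω I J) :
    lam * Γ.payoff z + (1 - lam) * ∫ s, F s.2.2 s.1 s.2.1 ∂(Γ.transition z) =
      shapley lam (fun i j w => (Γ.ρ z.1.2.2 i j : Ω → ℝ) w) (fun k l => Γ.g k l z.1.2.2) F
        (reweight z.2.1 z.1.1) (reweight z.2.2 z.1.2.1) := by
  rw [Γ.payoff_eq_stageForm, Γ.integral_transition_eq_continuationForm h.isSaddle z h.measurable]
  rfl

theorem integral_add_const (c : ℝ) (z : Stage K L Ω I J) :
    ∫ s, (F s.2.2 s.1 s.2.1 + c) ∂(Γ.transition z) =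
      ∫ s, F s.2.2 s.1 s.2.1 ∂(Γ.transition z) + c := by
  rw [integral_add (h.integrable z) (integrable_const c)]
  simp

theorem exists_nearlyOptimal_left [Nonempty I] (hlam : 0 < lam) (hlam' : lam ≤ 1) {η : ℝ}
    (hη : 0 < η) : ∃ f : BeliefState K L Ω → MixedAction K I, Measurable f ∧
      ∀ s (y : MixedAction L J), F s.2.2 s.1 s.2.1 - η ≤
        shapley lam (fun i j w => (Γ.ρ s.2.2 i j : Ω → ℝ) w) (fun k l => Γ.g k l s.2.2) F
          (reweight (f s) s.1) (reweight y s.2.1) :=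
  exists_measurable_nearlyOptimal (g := Γ.g) (ρ := fun v i j w => (Γ.ρ v i j : Ω → ℝ) w)
    hlam.le hlam' (fun v i j w => (Γ.ρ v i j).2.1 w) (fun v i j => (Γ.ρ v i j).2.2)
    Γ.abs_g_le_payoffNorm h.isSaddle h.isGameValue hη

theorem exists_nearlyOptimal_right [Nonempty J] (hlam : 0 < lam) (hlam' : lam ≤ 1) {η : ℝ}
    (hη : 0 < η) : ∃ f : BeliefState K L Ω → MixedAction L J, Measurable f ∧
      ∀ s (x : MixedAction K I),
        shapley lam (fun i j w => (Γ.ρ s.2.2 i j : Ω → ℝ) w) (fun k l => Γ.g k l s.2.2) F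
          (reweight x s.1) (reweight (f s) s.2.1) ≤ F s.2.2 s.1 s.2.1 + η := by
  obtain ⟨f, hf, hopt⟩ := exists_measurable_nearlyOptimal (K := L) (L := K) (I := J) (J := I)
    (lam := lam) (g := fun l k v j i => -Γ.g k l v i j)
    (ρ := fun v j i w => (Γ.ρ v i j : Ω → ℝ) w)
    (F := fun w θ π => -F w π θ) hlam.le hlam' (fun v j i w => (Γ.ρ v i j).2.1 w)
    (fun v j i => (Γ.ρ v i j).2.2)
    (fun l k v j i => by rw [abs_neg]; exact Γ.abs_g_le_payoffNorm k l v i j)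
    (fun w => (h.isSaddle w).swap) (fun v θ π hθ hπ => by
      have h := (h.isGameValue v π θ hπ hθ).swap
      simp only [← shapley_swap] at h
      exact h) hη
  refine ⟨fun s => f (s.2.1, s.1, s.2.2), hf.comp ((measurable_fst.comp measurable_snd).prodMk
    (measurable_fst.prodMk (measurable_snd.comp measurable_snd))), fun s x => ?_⟩
  have h1 := hopt (s.2.1, s.1, s.2.2) x
  rw [shapley_swap lam (fun i j w => (Γ.ρ s.2.2 i j : Ω → ℝ) w)
    (fun k l => Γ.g k l s.2.2)] at h1
  simp only at h1
  linarith

/-- The value of the discounted game is given by the solution of the Shapley equation. -/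
theorem isDiscountedValue [Nonempty I] [Nonempty J] (hlam : 0 < lam) (hlam' : lam ≤ 1)
    (w : BeliefState K L Ω) : Γ.IsDiscountedValue lam w (F w.2.2 w.1 w.2.1) := by
  refine Γ.isDiscountedValue_of_forall w hlam hlam' (fun η hη => ?_) (fun η hη => ?_)
  -- A one-stage error `lam * η` accumulates to `η`: subtracting the constant `η` from `F` gains
  -- exactly `lam * η` in the one-stage inequality.
  · obtain ⟨f, hf, hopt⟩ := h.exists_nearlyOptimal_left hlam hlam' (mul_pos hlam hη)
    refine ⟨deterministicStrategy f hf, fun τ => ?_⟩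
    refine (le_of_eq (sub_eq_add_neg _ _)).trans
      (Γ.le_discountedPayoff_deterministic w hlam hlam' hf
      (u := fun s => F s.2.2 s.1 s.2.1 + -η) (h.measurable.add_const (-η))
      (C := Γ.payoffNorm + η) (fun s => ?_) (fun s y => ?_) τ)
    · have := _root_.abs_le.1 (h.abs_le s)
      exact _root_.abs_le.2 ⟨by linarith, by linarith⟩
    · have h1 := hopt s y
      have h2 := h.stage_eq (s, f s, y)
      rw [h.integral_add_const]
      linarith
  · obtain ⟨f, hf, hopt⟩ := h.exists_nearlyOptimal_right hlam hlam' (mul_pos hlam hη)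
    refine ⟨deterministicStrategy f hf, fun σ => ?_⟩
    refine Γ.discountedPayoff_deterministic_le w hlam hlam' hf
      (u := fun s => F s.2.2 s.1 s.2.1 + η) (h.measurable.add_const η)
      (C := Γ.payoffNorm + η) (fun s => ?_) (fun s x => ?_) σ
    · have := _root_.abs_le.1 (h.abs_le s)
      exact _root_.abs_le.2 ⟨by linarith, by linarith⟩
    · have h1 := hopt s x
      have h2 := h.stage_eq (s, x, f s)
      rw [h.integral_add_const]
      linarith

open Classical in
/-- The one-stage loss of blurring in an absorbing game with non-absorbing state `w₀`. -/
theorem shapley_le_blurAction (hlam : 0 < lam) (hlam' : lam ≤ 1) {w₀ : Ω}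
    (hw₀ : ∀ w, w ≠ w₀ → Γ.IsAbsorbingState w) {ε : ℝ} (hε : ε ∈ Set.Icc (0 : ℝ) 1)
    (s : BeliefState K L Ω) (x : MixedAction K I) (y : MixedAction L J) :
    shapley lam (fun i j w => (Γ.ρ s.2.2 i j : Ω → ℝ) w) (fun k l => Γ.g k l s.2.2) F
        (reweight x s.1) (reweight y s.2.1) ≤
      shapley lam (fun i j w => (Γ.ρ s.2.2 i j : Ω → ℝ) w) (fun k l => Γ.g k l s.2.2) F
        (reweight (blurAction ε hε s.1 x) s.1) (reweight y s.2.1) +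
      8 * ε * Γ.payoffNorm * ((if s.2.2 = w₀ then 1 else 0) -
        (1 - lam) * ∫ s', (if s'.2.2 = w₀ then 1 else 0)
          ∂(Γ.transition (s, blurAction ε hε s.1 x, y))) := by
  have hρ' : ∀ v i j, ∑ w, (Γ.ρ v i j : Ω → ℝ) w = 1 := fun v i j => (Γ.ρ v i j).2.2
  have hP := Γ.integral_transition_state (s, blurAction ε hε s.1 x, y)
    fun w => if w = w₀ then 1 else 0
  simp only [meanAction_blurAction, mul_ite, mul_one, mul_zero, Finset.sum_ite_eq',
    Finset.mem_univ, if_true] at hP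
  have hloss := fun c hc => _root_.shapley_le_blurAction (lam := lam) (F := F)
    (ρ := fun i j w => (Γ.ρ s.2.2 i j : Ω → ℝ) w) (g := fun k l => Γ.g k l s.2.2)
    Γ.payoffNorm_nonneg hlam.le hlam' (fun i j w => (Γ.ρ s.2.2 i j).2.1 w) (hρ' s.2.2)
    (fun w => (h.isSaddle w).left) (fun k l i j => Γ.abs_g_le_payoffNorm k l s.2.2 i j) s.2.2
    (c := c) hc hε s.1 s.2.1 x y
  by_cases hs : s.2.2 = w₀
  -- In `w₀`, the stage loss and the leaving probability combine as `lam + (1 - lam) * (1 - P) = 1 -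
  -- (1 - lam) * P`, with `P` the probability of staying.
  · refine (hloss 1 (.inl rfl)).trans_eq ?_
    have hP' : ∑ i, ∑ j, meanAction s.1 x i * meanAction s.2.1 y j *
        (1 - (Γ.ρ s.2.2 i j : Ω → ℝ) s.2.2) =
        1 - ∑ i, ∑ j, meanAction s.1 x i * meanAction s.2.1 y j *
          (Γ.ρ s.2.2 i j : Ω → ℝ) w₀ := by
      simp only [mul_sub, mul_one, Finset.sum_sub_distrib,
        sum_meanAction_mul_meanAction s.1 s.2.1 x y, hs]
    rw [hP', if_pos hs, hP]
    change _ = _ + 8 * ε * Γ.payoffNorm * (1 - (1 - lam) * ∑ i, ∑ j,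
      meanAction s.1 x i * meanAction s.2.1 y j * (Γ.ρ s.2.2 i j : Ω → ℝ) w₀)
    ring
  -- In an absorbing state nothing is lost, and `w₀` is never reached again.
  · obtain ⟨hconst, hstay⟩ := hw₀ _ hs
    choose c' hc' using hconst
    refine (hloss 0 (.inr ⟨rfl, c', hc'⟩)).trans_eq ?_
    have hstay' : ∀ i j, (Γ.ρ s.2.2 i j : Ω → ℝ) s.2.2 = 1 := hstay
    have hleave : ∀ i j, (Γ.ρ s.2.2 i j : Ω → ℝ) w₀ = 0 := fun i j => by
      have h := hρ' s.2.2 i j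
      rw [← Finset.add_sum_erase _ _ (Finset.mem_univ s.2.2), hstay', add_eq_left] at h
      exact (Finset.sum_eq_zero_iff_of_nonneg fun w _ => (Γ.ρ s.2.2 i j).2.1 w).1 h w₀
        (Finset.mem_erase.2 ⟨Ne.symm hs, Finset.mem_univ _⟩)
    have hP0 : ∑ i, ∑ j, meanAction s.1 x i * meanAction s.2.1 y j *
        (Γ.ρ s.2.2 i j : Ω → ℝ) w₀ = 0 :=
      Finset.sum_eq_zero fun i _ => Finset.sum_eq_zero fun j _ => by rw [hleave, mul_zero]
    have hA0 : ∑ i, ∑ j, meanAction s.1 x i * meanAction s.2.1 y j *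
        (1 - (Γ.ρ s.2.2 i j : Ω → ℝ) s.2.2) = 0 :=
      Finset.sum_eq_zero fun i _ => Finset.sum_eq_zero fun j _ => by
        rw [hstay', sub_self, mul_zero]
    rw [hA0, if_neg hs, hP.trans hP0]
    ring

/-- Blurring nearly optimal actions of the one-shot games gives a nearly optimal strategy. -/
theorem le_discountedPayoff_blurAction (hlam : 0 < lam) (hlam' : lam ≤ 1) {w₀ : Ω}
    (hw₀ : ∀ w, w ≠ w₀ → Γ.IsAbsorbingState w) {ε : ℝ} (hε : ε ∈ Set.Icc (0 : ℝ) 1) {η : ℝ}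
    (hη : 0 ≤ η) {f : BeliefState K L Ω → MixedAction K I}
    (hf : Measurable fun s => blurAction ε hε s.1 (f s))
    (hopt : ∀ s (y : MixedAction L J), F s.2.2 s.1 s.2.1 - lam * η ≤
        shapley lam (fun i j w => (Γ.ρ s.2.2 i j : Ω → ℝ) w) (fun k l => Γ.g k l s.2.2) F
          (reweight (f s) s.1) (reweight y s.2.1))
    (w : BeliefState K L Ω) (τ : BehaviorStrategy K L Ω I J (MixedAction L J)) :
    F w.2.2 w.1 w.2.1 - 8 * ε * Γ.payoffNorm - η ≤
      Γ.discountedPayoff lam w (deterministicStrategy _ hf) τ := by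
  classical
  set M := Γ.payoffNorm with hMdef
  have hεM : 0 ≤ 8 * ε * M := mul_nonneg (mul_nonneg (by norm_num) hε.1) Γ.payoffNorm_nonneg
  let χ : Ω → ℝ := fun w => if w = w₀ then 1 else 0
  have hχ : ∀ w, 0 ≤ χ w ∧ χ w ≤ 1 := fun w => by
    simp only [χ]
    split_ifs <;> norm_num
  have hχm : Measurable fun s : BeliefState K L Ω => χ s.2.2 :=
    (Measurable.of_discrete (f := χ)).comp (measurable_snd.comp measurable_snd)
  have hint : ∀ z, ∫ s, (F s.2.2 s.1 s.2.1 - 8 * ε * M * χ s.2.2 - η) ∂(Γ.transition z) =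
      ∫ s, F s.2.2 s.1 s.2.1 ∂(Γ.transition z) - 8 * ε * M * ∫ s, χ s.2.2 ∂(Γ.transition z)
        - η := by
    intro z
    have hi : Integrable (fun s : BeliefState K L Ω => 8 * ε * M * χ s.2.2) (Γ.transition z) :=
      (Integrable.of_bound hχm.aestronglyMeasurable 1 (.of_forall fun s => by
        rw [Real.norm_eq_abs, abs_of_nonneg (hχ _).1]
        exact (hχ _).2)).const_mul _
    have hi' : Integrable (fun s : BeliefState K L Ω =>
        F s.2.2 s.1 s.2.1 - 8 * ε * M * χ s.2.2) (Γ.transition z) := (h.integrable z).sub hi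
    rw [integral_sub hi' (integrable_const _),
      integral_sub (h.integrable z) hi, integral_const_mul]
    simp
  have hbound : ∀ s : BeliefState K L Ω, 0 ≤ 8 * ε * M * χ s.2.2 ∧
      8 * ε * M * χ s.2.2 ≤ 8 * ε * M := fun s =>
    ⟨mul_nonneg hεM (hχ _).1, mul_le_of_le_one_right hεM (hχ _).2⟩
  -- The function `F - 8 ε M χ - η` is a subsolution: the term in `χ` pays for blurring in `w₀`
  -- until absorption, and `η` for the near optimality of `f`.
  refine le_trans ?_ (Γ.le_discountedPayoff_deterministic w hlam hlam' hf
    (u := fun s => F s.2.2 s.1 s.2.1 - 8 * ε * M * χ s.2.2 - η)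
    ((h.measurable.sub (hχm.const_mul _)).sub_const _) (C := M + 8 * ε * M + η)
    (fun s => ?_) (fun s y => ?_) τ)
  · linarith [(hbound w).2]
  · have h1 := _root_.abs_le.1 (h.abs_le s)
    have h2 := hbound s
    exact _root_.abs_le.2 ⟨by linarith, by linarith⟩
  · have h1 := hopt s y
    have h2 := h.stage_eq (s, blurAction ε hε s.1 (f s), y)
    have h3 := h.shapley_le_blurAction hlam hlam' hw₀ hε s (f s) y
    rw [← hMdef] at h3
    change _ ≤ _ + 8 * ε * M * (χ s.2.2 - (1 - lam) *
      ∫ s', χ s'.2.2 ∂(Γ.transition (s, blurAction ε hε s.1 (f s), y))) at h3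
    rw [hint]
    linarith

end IsShapleySolution

end solution

end IncompleteInfoGame

theorem Measurable.blurAction {S K I : Type*} [Fintype K] [Fintype I] [MeasurableSpace S]
    {ε : ℝ} (hε : ε ∈ Set.Icc (0 : ℝ) 1) {p : S → stdSimplex ℝ K} {x : S → MixedAction K I}
    (hp : Measurable p) (hx : Measurable x) :
    Measurable fun s => blurAction ε hε (p s) (x s) := by
  have h := (measurable_blurAction hε).comp (hp.prodMk hx)
  simp only [Function.comp_def] at h
  exact h

theorem mainTheorem4 {K L Ω I J : Type*} [Fintype K] [Fintype L] [Fintype Ω] [Fintype I]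
    [Fintype J] [Nonempty K] [Nonempty L] [Nonempty I] [Nonempty J]
    [MeasurableSpace Ω] [DiscreteMeasurableSpace Ω]
    (Γ : IncompleteInfoGame K L Ω I J) (hΓ : Γ.IsAbsorbingGame)
    (ε : ℝ) (hε : 0 < ε) (hε' : ε ≤ 1 / 4) (lam : ℝ) (hlam : 0 < lam) (hlam' : lam ≤ 1) :
    ∃ v : BeliefState K L Ω → ℝ, (∀ w, Γ.IsDiscountedValue lam w (v w)) ∧
      ∃ σ : StationaryStrategy K L Ω I,
        σ.IsAmbiguous ε ∧
        (∀ (w : BeliefState K L Ω) (τ : BehaviorStrategy K L Ω I J (MixedAction L J)),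
          v w - 12 * ε * Γ.payoffNorm ≤ Γ.discountedPayoff lam w σ.toBehavior τ) ∧
        ∀ (w : BeliefState K L Ω) (τ : BehaviorStrategy K L Ω I J (MixedAction L J)),
          ∫⁻ h, beliefVariation ε h ∂(Γ.law w σ.toBehavior τ) ≤
            ENNReal.ofReal (3 * √(Fintype.card K : ℝ) * ε⁻¹ ^ 5) := by
  obtain ⟨F, hF⟩ := Γ.exists_isShapleySolution hlam hlam'
  refine ⟨fun s => F s.2.2 s.1 s.2.1, hF.isDiscountedValue hlam hlam', ?_⟩
  obtain ⟨w₀, -, huniq⟩ := hΓ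
  have hw₀ : ∀ w, w ≠ w₀ → Γ.IsAbsorbingState w := fun w hw => by
    by_contra h
    exact hw (huniq w h)
  have hεI : ε ∈ Set.Icc (0 : ℝ) 1 := ⟨hε.le, by linarith⟩
  have hM := Γ.payoffNorm_nonneg
  -- Of the allowed `12 ε ‖g‖`, blurring takes 8 parts and selection takes 4. The selection needs a
  -- positive error, so a zero payoff is treated apart; all payoffs and values are then zero.
  obtain ⟨η, hη, hη'⟩ : ∃ η > 0, Γ.payoffNorm = 0 ∨ η = 4 * ε * Γ.payoffNorm := by
    rcases hM.eq_or_lt with h | h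
    · exact ⟨1, one_pos, .inl h.symm⟩
    · exact ⟨4 * ε * Γ.payoffNorm, by positivity, .inr rfl⟩
  obtain ⟨f, hf, hopt⟩ := hF.exists_nearlyOptimal_left hlam hlam' (mul_pos hlam hη)
  have hbm : Measurable fun s => blurAction ε hεI s.1 (f s) :=
    Measurable.blurAction hεI measurable_fst hf
  refine ⟨⟨fun s => blurAction ε hεI s.1 (f s), hbm⟩, fun s => isAmbiguousAt_blurAction hεI s.1 (f s), fun w τ => ?_,
    fun w τ => Γ.lintegral_beliefVariation_le hε hε' hεI hbm w τ⟩
  change _ ≤ Γ.discountedPayoff lam w (deterministicStrategy _ hbm) τ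
  rcases hη' with hM0 | rfl
  · have h1 := abs_le.1 (hF.abs_le w)
    have h2 := abs_le.1 (Γ.abs_discountedPayoff_le w hlam hlam' (deterministicStrategy _ hbm) τ)
    rw [hM0] at h1 h2 ⊢
    linarith
  · refine le_trans ?_ (hF.le_discountedPayoff_blurAction hlam hlam' hw₀ hεI hη.le hbm hopt w τ)
    linarith
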